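/- Let $a\ge 2$, $d\in\mathbb N$, and let $X_{ik}=\mu_i+\epsilon_{ik}$ ($i=1,\dots,a$, $k=1,2,\dots$) be independent random vectors in $\mathbb R^d$ such that, for fixed $i$ and $j$, the errors $\epsilon_{ikj}$ ($k\ge1$) are identically distributed with mean $0$ and finite second moment, and $\operatorname{Var}(\epsilon_{ik})=\Sigma_i\ge 0$ for all $k$. Consider group sizes $n_1,\dots,n_a$ with $N=\sum_i n_i\to\infty$ and (A1) $n_i/N\to\kappa_i\in(0,1]$. Write $\mu=(\mu_1^\top,\dots,\mu_a^\top)^\top$, let $\overline X$ be the vector of the stacked group means of $X_{i1},\dots,X_{in_i}$, put $\Sigma=\bigoplus_{i=1}^a\kappa_i^{-1}\Sigma_i$, and let $\widehat\Sigma_i$ be the empirical covariance matrix (with factor $1/(n_i-1)$) of group $i$. Let $\widetilde\Sigma$ be a random $ad\times ad$ matrix with $\widetilde\Sigma\to\Sigma$ in probability. Let $C=(C_1^\top,\dots,C_L^\top)^\top$ and $\beta=(\beta_1^\top,\dots,\beta_L^\top)^\top$ with $L\ge1$, $C_\ell\in\mathbb R^{r_\ell\times ad}$ and $\beta_\ell\in\mathbb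 R^{r_\ell}$. The global hypothesis is $\mathcal H_0:C\mu=\beta$ and the local hypotheses are $\mathcal H_0^{(\ell)}:C_\ell\mu=\beta_\ell$. For a measurable matrix-valued function $M$, with values $M(C_\ell,S)\in\mathbb R^{r_\ell\times r_\ell}$ that are symmetric and positive semidefinite whenever $S$ is positive semidefinite, put $t_\ell(S)=\operatorname{tr}([C_\ell^\top M(C_\ell,S)C_\ell S]^2)$ and $$Q_{N\ell}=N\,\frac{[C_\ell\overline X-\beta_\ell]^\top M(C_\ell,\widetilde\Sigma)[C_\ell\overline X-\beta_\ell]}{\sqrt{2\,t_\ell(\widetilde\Sigma)}}\,\mathbf 1\{t_\ell(\widetilde\Sigma)>0\},\qquad \ell=1,\dots,L$$ (read as $0$ if $t_\ell(\widetilde\Sigma)\le0$). Parametric bootstrap: given the data, for $b=1,2,\dots$ let $X^{\star,b}_{ik}$ ($i\le a$, $k\le n_i$) be independent with $X^{\star,b}_{ik}\sim\mathcal N_d(0,\widehat\Sigma_i)$. Let $\overline X^{\star,b}$ be the stacked group means of the $b$-th bootstrap sample, let $\widehat\Sigma^{\star,b}$ be the direct sum over $i$ of $N/n_i$ times the empirical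 covariance matrix of its $i$-th group, and let $Q^{\star,b}_{N\ell}$ be defined as $Q_{N\ell}$ with $C_\ell\overline X-\beta_\ell$ replaced by $C_\ell\overline X^{\star,b}$ and $\widetilde\Sigma$ replaced by $\widehat\Sigma^{\star,b}$. Assume for each $\ell$ that $M(C_\ell,S_N)\to M(C_\ell,\Sigma)$ in probability for the estimators $S_N=\widetilde\Sigma$ and $S_N=\widehat\Sigma^{\star,1}$ of $\Sigma$, and (A3) that $C_\ell^\top M(C_\ell,\Sigma)C_\ell\Sigma$ has a nonzero eigenvalue. Critical values (method of Munko et al.): for $\gamma\in[0,1)$ let $q_{\ell,B}(\gamma)$ be the empirical $(1-\gamma)$-quantile of $Q^{\star,1}_{N\ell},\dots,Q^{\star,B}_{N\ell}$. For $\alpha\in(0,1)$ let $$\gamma_B(\alpha)=\max\Big\{\gamma\in\{0,\tfrac1B,\dots,\tfrac{B-1}B\}:\ \tfrac1B\,\#\{b\le B:\ \exists\,\ell,\ Q^{\star,b}_{N\ell}>q_{\ell,B}(\gamma)\}\le\alpha\Big\}$$ and $q^\star_{\ell,B}=q_{\ell,B}(\gamma_B(\alpha))$. With $0/0:=1$ (and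 $x/0:=\infty$ for $x>0$), the test is $\varphi^\star_Q(N,B)=\mathbf 1\{\max_{\ell}(Q_{N\ell}/q^\star_{\ell,B})>1\}$. Then for every $\alpha\in(0,1)$ and every sequence $B_N\to\infty$: (i) if $\mathcal H_0$ is true, then $\lim_{N\to\infty}\mathbb E[\varphi^\star_Q(N,B_N)]=\alpha$; (ii) whether or not $\mathcal H_0$ is true, for every set $\mathcal T\subset\{1,\dots,L\}$ of indices of true local hypotheses the following limit exists and satisfies $$\lim_{N\to\infty}\mathbb E\Big[\max_{\ell\in\mathcal T}\mathbf 1\{Q_{N\ell}/q^\star_{\ell,B_N}>1\}\Big]\le\alpha .$$ -/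

import Mathlib

open MeasureTheory ProbabilityTheory Filter Topology Matrix

noncomputable section

namespace QFMCT

/-! ### Samples and their first two empirical moments -/

/-- A sample of `a` groups of `d`-dimensional observation vectors with group sizes `n i`. -/
abbrev Sample {a : ℕ} (d : ℕ) (n : Fin a → ℕ) : Type :=
  (i : Fin a) → Fin (n i) → EuclideanSpace ℝ (Fin d)

instance standardBorelSpace_samples {a d : ℕ} (n : Fin a → ℕ) :
    StandardBorelSpace (ℕ → Sample d n) :=
  haveI : StandardBorelSpace (Sample d n) := inferInstance
  StandardBorelSpace.pi_countable

/-- Total sample size `N = n_1 + ... + n_a`. -/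
def totalSize {a : ℕ} (n : Fin a → ℕ) : ℕ := ∑ i, n i

/-- The group-wise mean vectors stacked into one vector of dimension `a * d`. -/
def pooledMean {a d : ℕ} {n : Fin a → ℕ} (x : Sample d n) : Fin a × Fin d → ℝ :=
  fun p => (∑ k, x p.1 k p.2) / (n p.1 : ℝ)

/-- Empirical covariance matrix (with the factor `1 / (m - 1)`) of `m` vectors. -/
def empCov {d m : ℕ} (y : Fin m → EuclideanSpace ℝ (Fin d)) : Matrix (Fin d) (Fin d) ℝ :=
  Matrix.of fun j j' =>
    (∑ k, (y k j - (∑ k', y k' j) / (m : ℝ)) * (y k j' - (∑ k', y k' j') / (m : ℝ)))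
      / ((m : ℝ) - 1)

/-- Direct sum (block diagonal matrix) of `a` matrices of size `d × d`. -/
def directSum {a d : ℕ} (S : Fin a → Matrix (Fin d) (Fin d) ℝ) :
    Matrix (Fin a × Fin d) (Fin a × Fin d) ℝ :=
  Matrix.of fun p q => if p.1 = q.1 then S p.1 p.2 q.2 else 0

/-- Pooled empirical covariance matrix: the direct sum of the `N / n_i` multiples of the
empirical covariance matrices of the groups. -/
def pooledCov {a d : ℕ} {n : Fin a → ℕ} (x : Sample d n) :
    Matrix (Fin a × Fin d) (Fin a × Fin d) ℝ :=
  directSum fun i => ((totalSize n : ℝ) / (n i : ℝ)) • empCov (x i)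

/-! ### The model -/

/-- The errors of the semiparametric model, as a random vector `ε i k` for subject `k` of
group `i`: all of them are independent; within a group each component has one distribution,
centred, and the covariance matrix is `Sig i` (with finite second moments). The vectors of a group
need not be identically distributed as vectors. -/
structure IsErrorModel {Ω : Type*} [MeasurableSpace Ω] (P : Measure Ω) {a d : ℕ}
    (ε : Fin a → ℕ → Ω → EuclideanSpace ℝ (Fin d))
    (Sig : Fin a → Matrix (Fin d) (Fin d) ℝ) : Prop where
  measurable : ∀ i k, Measurable (ε i k)
  indep : iIndepFun (fun ik : Fin a × ℕ => ε ik.1 ik.2) P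
  identDistrib : ∀ i j k k', IdentDistrib (fun ω => ε i k ω j) (fun ω => ε i k' ω j) P P
  memLp : ∀ i k j, MemLp (fun ω => ε i k ω j) 2 P
  mean_zero : ∀ i k j, ∫ ω, ε i k ω j ∂P = 0
  cov_eq : ∀ i k j j',
    covariance (fun ω => ε i k ω j) (fun ω => ε i k ω j') P = Sig i j j'

/-- The observations `X_{ik} = μ_i + ε_{ik}`, `k < n i`, as one random sample. -/
def observations {Ω : Type*} {a d : ℕ} (μ : Fin a → EuclideanSpace ℝ (Fin d))
    (ε : Fin a → ℕ → Ω → EuclideanSpace ℝ (Fin d)) (n : Fin a → ℕ) (ω : Ω) : Sample d n :=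
  fun i k => μ i + ε i k ω

/-- Expectation vectors stacked into one vector of dimension `a * d`. -/
def stack {a d : ℕ} (μ : Fin a → EuclideanSpace ℝ (Fin d)) : Fin a × Fin d → ℝ :=
  fun p => μ p.1 p.2

/-- The limit covariance matrix: direct sum of the `κ_i⁻¹ Σ_i`. -/
def limitCov {a d : ℕ} (κ : Fin a → ℝ) (Sig : Fin a → Matrix (Fin d) (Fin d) ℝ) :
    Matrix (Fin a × Fin d) (Fin a × Fin d) ℝ :=
  directSum fun i => (κ i)⁻¹ • Sig i

/-- Entrywise convergence in probability of random matrices to a constant matrix. -/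
def TendstoInProb {Ω : Type*} [MeasurableSpace Ω] (P : Measure Ω) {m m' : Type*}
    (S : ℕ → Ω → Matrix m m' ℝ) (S₀ : Matrix m m' ℝ) : Prop :=
  ∀ i j, TendstoInMeasure P (fun ν ω => S ν ω i j) atTop (fun _ => S₀ i j)

/-- `f S_ν → f S₀` in probability for the estimators `S_ν`, provided these are consistent. -/
def PlugInConsistent {Ω : Type*} [MeasurableSpace Ω] (P : Measure Ω) {m m' l l' : Type*}
    (f : Matrix m m' ℝ → Matrix l l' ℝ) (S : ℕ → Ω → Matrix m m' ℝ) (S₀ : Matrix m m' ℝ) : Prop :=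
  TendstoInProb P S S₀ → TendstoInProb P (fun ν ω => f (S ν ω)) (f S₀)

/-! ### Hypothesis matrices and quadratic forms -/

/-- The `ℓ`-th block of rows of a partitioned hypothesis matrix. -/
def blockMat {L : ℕ} {r : Fin L → ℕ} {p : Type*} (C : Matrix (Σ ℓ, Fin (r ℓ)) p ℝ) (ℓ : Fin L) :
    Matrix (Fin (r ℓ)) p ℝ :=
  C.submatrix (fun s => ⟨ℓ, s⟩) id

/-- The `ℓ`-th block of a partitioned vector. -/
def blockVec {L : ℕ} {r : Fin L → ℕ} (β : (Σ ℓ, Fin (r ℓ)) → ℝ) (ℓ : Fin L) : Fin (r ℓ) → ℝ :=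
  fun s => β ⟨ℓ, s⟩

/-- A matrix-valued function `M(C, S)` of a hypothesis matrix `C` with `m` rows and of a
covariance matrix `S`; its value is an `m × m` matrix. -/
abbrev WeightFunction (a d : ℕ) : Type :=
  (m : ℕ) → Matrix (Fin m) (Fin a × Fin d) ℝ →
    Matrix (Fin a × Fin d) (Fin a × Fin d) ℝ → Matrix (Fin m) (Fin m) ℝ

/-- `tr ([Cᵀ M(C, S) C S]²)`. -/
def formTrace {a d m : ℕ} (M : WeightFunction a d) (C : Matrix (Fin m) (Fin a × Fin d) ℝ)
    (S : Matrix (Fin a × Fin d) (Fin a × Fin d) ℝ) : ℝ :=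
  ((Cᵀ * M m C S * C * S) ^ 2).trace

/-- `N · yᵀ M(C, S) y / √(2 tr ([Cᵀ M(C, S) C S]²)) · 1(tr ([Cᵀ M(C, S) C S]²) > 0)`. -/
def quadForm {a d m : ℕ} (N : ℕ) (M : WeightFunction a d)
    (C : Matrix (Fin m) (Fin a × Fin d) ℝ) (S : Matrix (Fin a × Fin d) (Fin a × Fin d) ℝ)
    (y : Fin m → ℝ) : ℝ :=
  (N : ℝ) * ((y ⬝ᵥ (M m C S *ᵥ y)) / √(2 * formTrace M C S))
    * (if 0 < formTrace M C S then 1 else 0)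

/-- The vector of test statistics `Q_{Nℓ}` of a sample, with covariance estimate `S`. -/
def testStat {a d L : ℕ} {r : Fin L → ℕ} {n : Fin a → ℕ} (M : WeightFunction a d)
    (C : Matrix (Σ ℓ, Fin (r ℓ)) (Fin a × Fin d) ℝ) (β : (Σ ℓ, Fin (r ℓ)) → ℝ)
    (S : Matrix (Fin a × Fin d) (Fin a × Fin d) ℝ) (x : Sample d n) (ℓ : Fin L) : ℝ :=
  quadForm (totalSize n) M (blockMat C ℓ) S (blockMat C ℓ *ᵥ pooledMean x - blockVec β ℓ)

/-- The vector of bootstrap quadratic forms of one bootstrap sample, built with the pooled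
empirical covariance matrix of that bootstrap sample. -/
def bootStat {a d L : ℕ} {r : Fin L → ℕ} {n : Fin a → ℕ} (M : WeightFunction a d)
    (C : Matrix (Σ ℓ, Fin (r ℓ)) (Fin a × Fin d) ℝ) (x : Sample d n) (ℓ : Fin L) : ℝ :=
  quadForm (totalSize n) M (blockMat C ℓ) (pooledCov x) (blockMat C ℓ *ᵥ pooledMean x)

/-! ### Parametric bootstrap -/

/-- `Xstar 0, Xstar 1, ...` are parametric bootstrap samples for the data `X`: given the data, they
are i.i.d., and the vectors of group `i` in each of them are i.i.d. centred normal with the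
empirical covariance matrix of group `i` of the data. -/
structure IsParametricBootstrap {Ω : Type*} [MeasurableSpace Ω] (P : Measure Ω)
    [IsFiniteMeasure P] {a d : ℕ} {n : Fin a → ℕ}
    (X : Ω → Sample d n) (Xstar : ℕ → Ω → Sample d n) : Prop where
  measurable : ∀ b, Measurable (Xstar b)
  condDistrib_eq : condDistrib (fun ω b => Xstar b ω) X P =ᵐ[P.map X] fun x =>
    Measure.infinitePi fun _ : ℕ => Measure.pi fun i => Measure.pi fun _ : Fin (n i) =>
      multivariateGaussian 0 (empCov (x i))

/-! ### Component-wise critical values at a common adapted local level -/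

/-- Empirical `p`-quantile of `B` real numbers: generalized inverse of their empirical
distribution function. -/
def empQuantile {B : ℕ} (x : Fin B → ℝ) (p : ℝ) : ℝ :=
  sInf {t | p ≤ (Nat.card {b : Fin B // x b ≤ t} : ℝ) / (B : ℝ)}

/-- Empirical family-wise error rate of the replicates `q` when each component `ℓ` is compared with
its empirical `(1 - γ)`-quantile. -/
def empFWER {B L : ℕ} (q : Fin B → Fin L → ℝ) (γ : ℝ) : ℝ :=
  (Nat.card {b : Fin B // ∃ ℓ, empQuantile (fun b' => q b' ℓ) (1 - γ) < q b ℓ} : ℝ) / (B : ℝ)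

/-- The largest local level `γ` in `{0, 1/B, ..., (B-1)/B}` whose empirical family-wise error
rate is at most `α`. -/
def localLevel {B L : ℕ} (q : Fin B → Fin L → ℝ) (α : ℝ) : ℝ :=
  sSup {γ | ∃ k : Fin B, γ = (k : ℝ) / (B : ℝ) ∧ empFWER q γ ≤ α}

/-- The critical values: component-wise empirical quantiles at the adapted local level. -/
def criticalValue {B L : ℕ} (q : Fin B → Fin L → ℝ) (α : ℝ) (ℓ : Fin L) : ℝ :=
  empQuantile (fun b => q b ℓ) (1 - localLevel q α)

/-! ### Tests -/

/-- The quotient `x / q` of nonnegative numbers in `[0, ∞]`, with `0 / 0 = 1` (and `x / 0 = ∞` for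
`x > 0`). -/
def ratio (x q : ℝ) : ENNReal :=
  if x = 0 ∧ q = 0 then 1 else ENNReal.ofReal x / ENNReal.ofReal q

/-- The global test `1 {max_ℓ (Q_ℓ / q_ℓ) > 1}`. -/
def globalTest {L : ℕ} (Q q : Fin L → ℝ) : ℝ :=
  if 1 < Finset.univ.sup (fun ℓ => ratio (Q ℓ) (q ℓ)) then 1 else 0

/-- `max_{ℓ ∈ T} 1 {Q_ℓ / q_ℓ > 1}`: some local hypothesis with index in `T` is rejected. -/
def familyRejection {L : ℕ} (T : Finset (Fin L)) (Q q : Fin L → ℝ) : ℝ :=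
  ((T.sup fun ℓ => if 1 < ratio (Q ℓ) (q ℓ) then (1 : ℕ) else 0 : ℕ) : ℝ)

end QFMCT

end

open QFMCT

noncomputable section

namespace QFMCT

/-! ### Convergence in probability to a constant -/

section ConvInProb

variable {Ω E F : Type*} [MeasurableSpace Ω] [TopologicalSpace E] [TopologicalSpace F]
  {P : Measure Ω}

/-! The conditional bootstrap law is never analysed. The bootstrap samples are replaced, without
changing their joint law, by samples built on a product space: group `i` of a replicate is the
square root of the empirical covariance matrix of the data applied to standard normal noise that is
independent of the data and across replicates (`IsParametricBootstrap.map_eq`). The normalized group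
sums of the noise, `noiseMean`, are then exactly standard normal once no group is empty
(`map_noiseMean`), and they are independent over the replicates. A bootstrap statistic is a
quadratic form in these normal vectors whose random matrix converges in probability to the fixed
matrix `limitForm`, so it differs from `g ⬝ᵥ limitForm *ᵥ g` by a null sequence
(`convInProb_bootStat_sub`).

The replicates share the data and are dependent, but the approximating forms are independent.
Chebyshev's inequality for the approximating events and Markov's inequality for the mismatch give a
weak law for the relative frequencies of joint exceedances as `B → ∞` (`convInProb_bootstrap_freq`).

The limit vector of quadratic forms is well behaved (`IsRegularLimit`): its components have no
atoms, and the joint exceedance probabilities are strictly monotone when all thresholds move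
together. This uses that each limit matrix is positive semidefinite and nonzero, which is what the
nonzero eigenvalue provides, together with the full support of the normal law. Hence there are a
common level `γ` and positive quantiles `c ℓ` at that level for which the probability of some
exceedance is exactly `α` (`exists_critical`). Critical values are sandwiched deterministically by
finitely many relative frequencies (`lt_criticalValue`, `criticalValue_le`), so they converge in
probability to `c` (`convInProb_criticalValue`).

For the data, a central limit theorem is proved by characteristic functions
(`tendstoInDistribution_scaledMean`); the error vectors of a group need not be identically
distributed, but tails are dominated through their coordinates, whose laws are common. Slutsky's
lemma adds the consistent weight matrices and the critical values, both with constant limits, so no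
joint law of data and bootstrap is needed. The portmanteau theorem then gives rejection
probabilities converging to the limit probability that some `ℓ ∈ T` exceeds `c ℓ`. For all indices
this is `α`; for a subfamily of true hypotheses it is at most `α` by inclusion. -/

lemma tendsto_measure_zero_of_subset {A B : ℕ → Set Ω}
    (hB : Tendsto (fun ν => P (B ν)) atTop (𝓝 0)) (h : ∀ᶠ ν in atTop, A ν ⊆ B ν) :
    Tendsto (fun ν => P (A ν)) atTop (𝓝 0) :=
  tendsto_of_tendsto_of_tendsto_of_le_of_le' tendsto_const_nhds hB
    (Eventually.of_forall fun _ => zero_le) (h.mono fun _ hν => measure_mono hν)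

lemma tendsto_measure_zero_union {A B : ℕ → Set Ω}
    (hA : Tendsto (fun ν => P (A ν)) atTop (𝓝 0)) (hB : Tendsto (fun ν => P (B ν)) atTop (𝓝 0)) :
    Tendsto (fun ν => P (A ν ∪ B ν)) atTop (𝓝 0) :=
  tendsto_of_tendsto_of_tendsto_of_le_of_le tendsto_const_nhds (by simpa using hA.add hB)
    (fun _ => zero_le) (fun _ => measure_union_le _ _)

lemma tendsto_measure_zero_iUnion {ι : Type*} [Fintype ι] {A : ℕ → ι → Set Ω}
    (hA : ∀ i, Tendsto (fun ν => P (A ν i)) atTop (𝓝 0)) :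
    Tendsto (fun ν => P (⋃ i, A ν i)) atTop (𝓝 0) :=
  tendsto_of_tendsto_of_tendsto_of_le_of_le tendsto_const_nhds
    (by simpa using tendsto_finsetSum Finset.univ fun i _ => hA i)
    (fun _ => zero_le) (fun ν => by simpa using measure_iUnion_le (μ := P) (A ν))

/-- Convergence in probability of random elements of a topological space to a constant. -/
def ConvInProb (P : Measure Ω) (X : ℕ → Ω → E) (c : E) : Prop :=
  ∀ U ∈ 𝓝 c, Tendsto (fun ν => P {ω | X ν ω ∉ U}) atTop (𝓝 0)

namespace ConvInProb

variable {X : ℕ → Ω → E} {Y : ℕ → Ω → F} {c : E} {c' : F}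

lemma comp (hX : ConvInProb P X c) {f : E → F} (hf : ContinuousAt f c) :
    ConvInProb P (fun ν ω => f (X ν ω)) (f c) :=
  fun _ hU => hX _ (hf hU)

lemma prodMk (hX : ConvInProb P X c) (hY : ConvInProb P Y c') :
    ConvInProb P (fun ν ω => (X ν ω, Y ν ω)) (c, c') := by
  intro U hU
  obtain ⟨u, hu, v, hv, huv⟩ := mem_nhds_prod_iff.1 hU
  refine tendsto_measure_zero_of_subset (tendsto_measure_zero_union (hX u hu) (hY v hv))
    (Eventually.of_forall fun ν ω hω => ?_)
  by_contra hcon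
  simp only [Set.mem_union, Set.mem_ofPred_eq, not_or, not_not] at hcon
  exact hω (huv ⟨hcon.1, hcon.2⟩)

lemma comp₂ {G : Type*} [TopologicalSpace G] (hX : ConvInProb P X c) (hY : ConvInProb P Y c')
    {f : E → F → G} (hf : ContinuousAt (fun q : E × F => f q.1 q.2) (c, c')) :
    ConvInProb P (fun ν ω => f (X ν ω) (Y ν ω)) (f c c') :=
  (hX.prodMk hY).comp (f := fun q : E × F => f q.1 q.2) hf

lemma pi {ι : Type*} [Finite ι] {E : ι → Type*} [∀ i, TopologicalSpace (E i)]
    {X : ℕ → Ω → ∀ i, E i} {c : ∀ i, E i} (h : ∀ i, ConvInProb P (fun ν ω => X ν ω i) (c i)) :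
    ConvInProb P X c := by
  intro U hU
  have := Fintype.ofFinite ι
  rw [nhds_pi, Filter.mem_pi'] at hU
  obtain ⟨I, t, ht, hI⟩ := hU
  refine tendsto_measure_zero_of_subset (tendsto_measure_zero_iUnion fun i => h i (t i) (ht i))
    (Eventually.of_forall fun ν ω hω => ?_)
  by_contra hcon
  simp only [Set.mem_iUnion, Set.mem_ofPred_eq, not_exists, not_not] at hcon
  exact hω (hI fun i _ => hcon i)

lemma apply {ι : Type*} {E : ι → Type*} [∀ i, TopologicalSpace (E i)]
    {X : ℕ → Ω → ∀ i, E i} {c : ∀ i, E i} (h : ConvInProb P X c) (i : ι) :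
    ConvInProb P (fun ν ω => X ν ω i) (c i) :=
  h.comp (f := fun x => x i) (continuous_apply i).continuousAt

lemma of_tendsto {x : ℕ → E} (hx : Tendsto x atTop (𝓝 c)) : ConvInProb P (fun ν _ => x ν) c :=
  fun U hU => tendsto_measure_zero_of_subset (B := fun _ => ∅) (by simp)
    ((hx.eventually hU).mono fun _ hν _ hω => hω hν)

lemma congr {X' : ℕ → Ω → E} (hX : ConvInProb P X c) (h : ∀ᶠ ν in atTop, ∀ ω, X ν ω = X' ν ω) :
    ConvInProb P X' c :=
  fun U hU => tendsto_measure_zero_of_subset (hX U hU)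
    (h.mono fun _ hν ω hω => by simpa [hν ω] using hω)

lemma subseq (hX : ConvInProb P X c) {n : ℕ → ℕ} (hn : Tendsto n atTop atTop) :
    ConvInProb P (fun ν => X (n ν)) c :=
  fun U hU => (hX U hU).comp hn

lemma sum {ι : Type*} (s : Finset ι) {X : ι → ℕ → Ω → ℝ} {c : ι → ℝ}
    (h : ∀ i ∈ s, ConvInProb P (X i) (c i)) :
    ConvInProb P (fun ν ω => ∑ i ∈ s, X i ν ω) (∑ i ∈ s, c i) := by
  classical
  induction s using Finset.induction_on with
  | empty => simpa using of_tendsto (P := P) (tendsto_const_nhds (x := (0 : ℝ)) (f := atTop))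
  | insert i s hi ih =>
    simp only [Finset.sum_insert hi]
    exact (h i (by simp)).comp₂ (f := fun x y => x + y)
      (ih fun j hj => h j (Finset.mem_insert_of_mem hj)) continuous_add.continuousAt

end ConvInProb

lemma convInProb_iff_dist {E : Type*} [PseudoMetricSpace E] {X : ℕ → Ω → E} {c : E} :
    ConvInProb P X c ↔ ∀ δ > 0, Tendsto (fun ν => P {ω | δ ≤ dist (X ν ω) c}) atTop (𝓝 0) := by
  constructor
  · intro h δ hδ
    simpa using h _ (Metric.ball_mem_nhds c hδ)
  · intro h U hU
    obtain ⟨δ, hδ, hU⟩ := Metric.mem_nhds_iff.1 hU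
    exact tendsto_measure_zero_of_subset (h δ hδ) (Eventually.of_forall fun ν ω hω => by
      by_contra hcon
      exact hω (hU (by simpa using hcon)))

lemma convInProb_iff_tendstoInMeasure {E : Type*} [PseudoMetricSpace E] {X : ℕ → Ω → E} {c : E} :
    ConvInProb P X c ↔ TendstoInMeasure P X atTop fun _ => c := by
  rw [convInProb_iff_dist, tendstoInMeasure_iff_dist]

lemma tendstoInProb_iff_convInProb {m m' : Type*} [Finite m] [Finite m']
    {S : ℕ → Ω → Matrix m m' ℝ} {S₀ : Matrix m m' ℝ} :
    TendstoInProb P S S₀ ↔ ConvInProb P S S₀ := by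
  constructor
  · intro h
    exact ConvInProb.pi (E := fun _ : m => m' → ℝ) fun i => ConvInProb.pi fun j =>
      convInProb_iff_tendstoInMeasure.2 (h i j)
  · intro h i j
    exact convInProb_iff_tendstoInMeasure.1
      ((ConvInProb.apply (E := fun _ : m => m' → ℝ) h i).apply j)

/-- Convergence to zero in probability of the product of a null sequence and a sequence of fixed
law. -/
lemma ConvInProb.mul_of_map_eq {E : Type*} [MeasurableSpace E] [IsFiniteMeasure P]
    {R : ℕ → Ω → ℝ} (hR : ConvInProb P R 0) {G : ℕ → Ω → E} (hG : ∀ ν, Measurable (G ν))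
    {Γ : Measure E} [IsFiniteMeasure Γ] (hmap : ∀ᶠ ν in atTop, P.map (G ν) = Γ)
    {f : E → ℝ} (hf : Measurable f) : ConvInProb P (fun ν ω => R ν ω * f (G ν ω)) 0 := by
  rw [convInProb_iff_dist]
  intro δ hδ
  rw [ENNReal.tendsto_nhds_zero]
  intro η hη
  -- One fixed finite law is tight, so a single truncation level `K` serves almost all `ν` at once.
  have htail : Tendsto (fun K : ℕ => Γ {x | (K : ℝ) ≤ |f x|}) atTop (𝓝 0) := by
    have := tendsto_measure_iInter_atTop (μ := Γ) (s := fun K : ℕ => {x | (K : ℝ) ≤ |f x|})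
      (fun K => (measurableSet_le measurable_const hf.abs).nullMeasurableSet)
      (fun K K' h x (hx : (K' : ℝ) ≤ |f x|) => show (K : ℝ) ≤ |f x| from
        (Nat.cast_le.2 h).trans hx) ⟨0, measure_ne_top _ _⟩
    have he : ⋂ K : ℕ, {x | (K : ℝ) ≤ |f x|} = ∅ := by
      ext x
      simp only [Set.mem_iInter, Set.mem_ofPred_eq, Set.mem_empty_iff_false, iff_false, not_forall,
        not_le]
      exact exists_nat_gt _
    rwa [he, measure_empty] at this
  obtain ⟨K, hK, hK0⟩ := ((htail.eventually (gt_mem_nhds (ENNReal.half_pos hη.ne'))).and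
    (eventually_gt_atTop 0)).exists
  have hK0' : (0 : ℝ) < K := by exact_mod_cast hK0
  have h1 := (convInProb_iff_dist.1 hR (δ / K) (by positivity)).eventually
    (gt_mem_nhds (ENNReal.half_pos hη.ne'))
  filter_upwards [h1, hmap] with ν h1 hmap
  calc P {ω | δ ≤ dist (R ν ω * f (G ν ω)) 0}
      ≤ P ({ω | δ / K ≤ dist (R ν ω) 0} ∪ G ν ⁻¹' {x | (K : ℝ) ≤ |f x|}) := by
        refine measure_mono fun ω hω => ?_
        by_contra hcon
        simp only [Real.dist_eq, sub_zero, Set.mem_union, Set.mem_ofPred_eq, Set.mem_preimage,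
          not_or, not_le, abs_mul] at hcon hω
        have : |R ν ω| * |f (G ν ω)| < δ / K * K :=
          mul_lt_mul'' hcon.1 hcon.2 (abs_nonneg _) (abs_nonneg _)
        rw [div_mul_cancel₀ _ hK0'.ne'] at this
        linarith
    _ ≤ η / 2 + η / 2 := by
        refine (measure_union_le _ _).trans (add_le_add h1.le ?_)
        rw [← Measure.map_apply (hG ν) (measurableSet_le measurable_const hf.abs), hmap]
        exact hK.le
    _ = η := ENNReal.add_halves η

/-- Convergence in probability only depends on the laws. -/
lemma ConvInProb.of_map_eq {Ω' : Type*} [MeasurableSpace Ω'] {P' : Measure Ω'}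
    {S : ℕ → Type*} [∀ ν, MeasurableSpace (S ν)] {E : Type*} [PseudoMetricSpace E]
    [MeasurableSpace E] [OpensMeasurableSpace E] {f : ∀ ν, S ν → E} (hf : ∀ ν, Measurable (f ν))
    {X : ∀ ν, Ω → S ν} {X' : ∀ ν, Ω' → S ν} (hX : ∀ ν, Measurable (X ν))
    (hX' : ∀ ν, Measurable (X' ν)) (h : ∀ ν, P.map (X ν) = P'.map (X' ν)) {c : E}
    (hc : ConvInProb P (fun ν ω => f ν (X ν ω)) c) :
    ConvInProb P' (fun ν ω => f ν (X' ν ω)) c := by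
  rw [convInProb_iff_dist] at hc ⊢
  intro δ hδ
  convert hc δ hδ using 2 with ν
  have hm : MeasurableSet {s : S ν | δ ≤ dist (f ν s) c} := by
    have : {s : S ν | δ ≤ dist (f ν s) c} = f ν ⁻¹' (Metric.ball c δ)ᶜ := by
      ext s; simp
    rw [this]
    exact hf ν Metric.isOpen_ball.measurableSet.compl
  have h1 := Measure.map_apply (μ := P) (hX ν) hm
  have h2 := Measure.map_apply (μ := P') (hX' ν) hm
  rw [← h ν, h1] at h2
  exact h2.symm

end ConvInProb

/-! ### Frequencies of events -/

section Frequency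

lemma natCard_subtype_eq_sum_indicator {Ω : Type*} {B : ℕ} (A : ℕ → Set Ω) (ω : Ω) :
    (Nat.card {b : Fin B // ω ∈ A b} : ℝ) = ∑ b ∈ Finset.range B, (A b).indicator 1 ω := by
  classical
  rw [← Fin.sum_univ_eq_sum_range (fun b => (A b).indicator (1 : Ω → ℝ) ω), Nat.card_eq_fintype_card,
    Fintype.card_subtype]
  simp [Set.indicator_apply]

variable {Ω : Type*} [MeasurableSpace Ω] {P : Measure Ω}

/-- The two frequencies differ by at most the frequency of the symmetric differences, whose
expectation is at most `η` whatever `B` is; Markov's inequality concludes. No independence of the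
events is needed, so an error common to all replicates is allowed. -/
lemma measure_freq_diff_le {A A' : ℕ → Set Ω} (hA : ∀ b, MeasurableSet (A b))
    (hA' : ∀ b, MeasurableSet (A' b)) {η : ENNReal} (hη : ∀ b, P (symmDiff (A b) (A' b)) ≤ η)
    {B : ℕ} (hB : 0 < B) {δ : ℝ} (hδ : 0 < δ) :
    P {ω | δ ≤ |(Nat.card {b : Fin B // ω ∈ A b} : ℝ) / B -
      (Nat.card {b : Fin B // ω ∈ A' b} : ℝ) / B|} ≤ η / ENNReal.ofReal δ := by
  have hB' : (0 : ℝ) < B := by exact_mod_cast hB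
  set f : Ω → ENNReal := fun ω => ∑ b ∈ Finset.range B, (symmDiff (A b) (A' b)).indicator 1 ω
  have hfm : ∀ b, MeasurableSet (symmDiff (A b) (A' b)) := fun b => (hA b).symmDiff (hA' b)
  have hf : Measurable f := Finset.measurable_sum _ fun b _ => measurable_one.indicator (hfm b)
  have hfi : ∫⁻ ω, f ω ∂P ≤ B * η := by
    rw [lintegral_finsetSum _ fun b _ => measurable_one.indicator (hfm b)]
    calc ∑ b ∈ Finset.range B, ∫⁻ ω, (symmDiff (A b) (A' b)).indicator 1 ω ∂P
        ≤ ∑ b ∈ Finset.range B, η := by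
          refine Finset.sum_le_sum fun b _ => ?_
          rw [lintegral_indicator_one (hfm b)]
          exact hη b
      _ = B * η := by simp
  have hmk := mul_meas_ge_le_lintegral (μ := P) hf (ENNReal.ofReal (B * δ))
  have hsub : {ω | δ ≤ |(Nat.card {b : Fin B // ω ∈ A b} : ℝ) / B -
      (Nat.card {b : Fin B // ω ∈ A' b} : ℝ) / B|} ⊆ {ω | ENNReal.ofReal (B * δ) ≤ f ω} := by
    intro ω hω
    simp only [Set.mem_ofPred_eq, natCard_subtype_eq_sum_indicator] at hω ⊢
    have hfω : f ω = ENNReal.ofReal (∑ b ∈ Finset.range B,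
        (symmDiff (A b) (A' b)).indicator (1 : Ω → ℝ) ω) := by
      have h0 : ∀ b ∈ Finset.range B, 0 ≤ (symmDiff (A b) (A' b)).indicator (1 : Ω → ℝ) ω :=
        fun b _ => Set.indicator_nonneg (fun _ _ => zero_le_one) ω
      rw [ENNReal.ofReal_sum_of_nonneg h0]
      refine Finset.sum_congr rfl fun b _ => ?_
      by_cases h : ω ∈ symmDiff (A b) (A' b) <;> simp [h]
    rw [hfω]
    refine ENNReal.ofReal_le_ofReal ?_
    rw [← sub_div, abs_div, abs_of_pos hB', le_div_iff₀ hB', ← Finset.sum_sub_distrib] at hω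
    rw [mul_comm]
    refine hω.trans ((Finset.abs_sum_le_sum_abs _ _).trans (Finset.sum_le_sum fun b _ => ?_))
    by_cases h : ω ∈ A b <;> by_cases h' : ω ∈ A' b <;> simp [h, h', Set.mem_symmDiff]
  rw [ENNReal.le_div_iff_mul_le (Or.inl (by simpa using hδ)) (Or.inl ENNReal.ofReal_ne_top)]
  have h1 : ENNReal.ofReal (B * δ) * P {ω | ENNReal.ofReal (B * δ) ≤ f ω} ≤ B * η := hmk.trans hfi
  rw [ENNReal.ofReal_mul hB'.le, ENNReal.ofReal_natCast, mul_assoc] at h1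
  have h2 := (ENNReal.mul_le_mul_iff_right (by exact_mod_cast hB.ne')
    (ENNReal.natCast_ne_top B)).1 h1
  calc _ ≤ P {ω | ENNReal.ofReal (B * δ) ≤ f ω} * ENNReal.ofReal δ := by gcongr
    _ ≤ η := by rw [mul_comm]; convert h2 using 3; rw [ENNReal.ofReal_mul hB'.le, ENNReal.ofReal_natCast]

variable [IsProbabilityMeasure P]

/-- Chebyshev bound for the relative frequency of pairwise independent events with common
probability. -/
lemma measure_freq_sub_le {A : ℕ → Set Ω} (hA : ∀ b, MeasurableSet (A b)) {p : ℝ}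
    (hp : ∀ b, P.real (A b) = p)
    (hind : Pairwise fun b b' => IndepFun ((A b).indicator (1 : Ω → ℝ))
      ((A b').indicator (1 : Ω → ℝ)) P)
    {B : ℕ} (hB : 0 < B) {δ : ℝ} (hδ : 0 < δ) :
    P {ω | δ ≤ |(Nat.card {b : Fin B // ω ∈ A b} : ℝ) / B - p|} ≤
      ENNReal.ofReal (1 / (B * δ ^ 2)) := by
  have hB' : (0 : ℝ) < B := by exact_mod_cast hB
  set X : ℕ → Ω → ℝ := fun b => (A b).indicator 1
  have hX2 : ∀ b, MemLp (X b) 2 P := fun b => memLp_indicator_const 2 (hA b) 1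
    (Or.inr (measure_ne_top _ _))
  have hXi : ∀ b, ∫ ω, X b ω ∂P = p := fun b => by
    rw [← hp b]; exact integral_indicator_one (hA b)
  have hS : MemLp (∑ b ∈ Finset.range B, X b) 2 P := memLp_finsetSum' _ fun b _ => hX2 b
  have hE : ∫ ω, (∑ b ∈ Finset.range B, X b) ω ∂P = B * p := by
    simp only [Finset.sum_apply]
    rw [integral_finsetSum _ fun b _ => (hX2 b).integrable (by norm_num)]
    simp [hXi]
  have hV : Var[∑ b ∈ Finset.range B, X b; P] ≤ B := by
    rw [IndepFun.variance_sum (fun b _ => hX2 b) (fun b _ b' _ h => hind h)]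
    calc ∑ b ∈ Finset.range B, Var[X b; P] ≤ ∑ b ∈ Finset.range B, (1 : ℝ) := by
          refine Finset.sum_le_sum fun b _ => ?_
          refine (variance_le_expectation_sq (hX2 b).aestronglyMeasurable).trans ?_
          have : (X b) ^ 2 = X b := by
            ext ω; by_cases h : ω ∈ A b <;> simp [X, h]
          rw [this, hXi, ← hp b]
          exact measureReal_le_one
      _ = B := by simp
  have hch := meas_ge_le_variance_div_sq hS (c := B * δ) (by positivity)
  rw [hE] at hch
  refine le_trans (measure_mono fun ω hω => ?_) (hch.trans (ENNReal.ofReal_le_ofReal ?_))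
  · simp only [Set.mem_ofPred_eq, natCard_subtype_eq_sum_indicator, Finset.sum_apply] at hω ⊢
    have h1 : |∑ b ∈ Finset.range B, X b ω - B * p| =
        B * |(∑ b ∈ Finset.range B, X b ω) / B - p| := by
      rw [← abs_of_pos hB', ← abs_mul, abs_of_pos hB']
      congr 1
      field_simp
    rw [h1]
    exact mul_le_mul_of_nonneg_left hω hB'.le
  · rw [div_le_div_iff₀ (by positivity) (by positivity)]
    have : Var[∑ b ∈ Finset.range B, X b; P] * (B * δ ^ 2) ≤ B * (B * δ ^ 2) := by gcongr
    nlinarith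

/-- Weak law of large numbers for the relative frequencies of perturbations of independent
events. -/
lemma convInProb_freq {E : Type*} [MeasurableSpace E] {Γ : Measure E} {B : ℕ → ℕ}
    (hB : Tendsto B atTop atTop) {Y : ℕ → ℕ → Ω → E} (hYm : ∀ ν b, Measurable (Y ν b))
    (hYind : ∀ ν, iIndepFun (Y ν) P) (hYlaw : ∀ᶠ ν in atTop, ∀ b, P.map (Y ν b) = Γ)
    {S : Set E} (hS : MeasurableSet S) {A : ℕ → ℕ → Set Ω} (hA : ∀ ν b, MeasurableSet (A ν b))
    {η : ℕ → ENNReal} (hη : Tendsto η atTop (𝓝 0))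
    (hAη : ∀ᶠ ν in atTop, ∀ b, P (symmDiff (A ν b) (Y ν b ⁻¹' S)) ≤ η ν) :
    ConvInProb P (fun ν ω => (Nat.card {b : Fin (B ν) // ω ∈ A ν b} : ℝ) / B ν) (Γ.real S) := by
  rw [convInProb_iff_dist]
  intro δ hδ
  have hδ2 : 0 < δ / 2 := by positivity
  have hBr : Tendsto (fun ν => (B ν : ℝ)) atTop atTop := tendsto_natCast_atTop_atTop.comp hB
  have h1 : Tendsto (fun ν => ENNReal.ofReal (1 / (B ν * (δ / 2) ^ 2)) +
      η ν / ENNReal.ofReal (δ / 2)) atTop (𝓝 0) := by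
    have e1 : Tendsto (fun ν => ENNReal.ofReal (1 / (B ν * (δ / 2) ^ 2))) atTop (𝓝 0) := by
      rw [← ENNReal.ofReal_zero]
      refine ENNReal.tendsto_ofReal ?_
      simp_rw [one_div]
      exact tendsto_inv_atTop_zero.comp (hBr.atTop_mul_const (by positivity))
    have e2 : Tendsto (fun ν => η ν / ENNReal.ofReal (δ / 2)) atTop (𝓝 0) := by
      simpa using ENNReal.Tendsto.div_const hη (Or.inr (by simpa using hδ))
    simpa using e1.add e2
  refine tendsto_of_tendsto_of_tendsto_of_le_of_le' tendsto_const_nhds h1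
    (Eventually.of_forall fun _ => zero_le) ?_
  filter_upwards [hYlaw, hAη, hB.eventually_gt_atTop 0] with ν hlaw hAν hBν
  have hm : ∀ b, MeasurableSet (Y ν b ⁻¹' S) := fun b => hYm ν b hS
  have hp : ∀ b, P.real (Y ν b ⁻¹' S) = Γ.real S := fun b => by
    rw [← hlaw b, measureReal_def, measureReal_def, Measure.map_apply (hYm ν b) hS]
  have hind : Pairwise fun b b' => IndepFun ((Y ν b ⁻¹' S).indicator (1 : Ω → ℝ))
      ((Y ν b' ⁻¹' S).indicator (1 : Ω → ℝ)) P := fun b b' hbb => by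
    exact ((hYind ν).indepFun hbb).comp (φ := S.indicator (1 : E → ℝ))
      (ψ := S.indicator (1 : E → ℝ)) (measurable_one.indicator hS) (measurable_one.indicator hS)
  refine le_trans (measure_mono ?_) ((measure_union_le _ _).trans
    (add_le_add (measure_freq_sub_le hm hp hind hBν hδ2)
      (measure_freq_diff_le (hA ν) hm hAν hBν hδ2)))
  intro ω hω
  by_contra hcon
  simp only [Set.mem_union, Set.mem_ofPred_eq, not_or, not_le, Real.dist_eq] at hcon hω
  have := abs_sub_le ((Nat.card {b : Fin (B ν) // ω ∈ A ν b} : ℝ) / B ν)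
    ((Nat.card {b : Fin (B ν) // ω ∈ Y ν b ⁻¹' S} : ℝ) / B ν) (Γ.real S)
  linarith [hcon.1, hcon.2]

end Frequency

end QFMCT

end

noncomputable section

namespace QFMCT

/-! ### Empirical quantiles and adapted local levels -/

section Quantiles

variable {B L : ℕ}

lemma natCard_subtype_div_mono {p p' : Fin B → Prop} (h : ∀ b, p b → p' b) :
    (Nat.card {b // p b} : ℝ) / (B : ℝ) ≤ (Nat.card {b // p' b} : ℝ) / (B : ℝ) := by
  classical
  have : Nat.card {b // p b} ≤ Nat.card {b // p' b} :=
    Nat.card_le_card_of_injective (Subtype.map id h) (Subtype.map_injective _ Function.injective_id)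
  gcongr

/-- Quantifying over finite index sets turns the set of admissible `t` into a finite union of closed
half-lines, which is how the infimum defining a quantile is seen to be attained. -/
lemma le_freq_iff_exists_finset (hB : 0 < B) {x : Fin B → ℝ} {p t : ℝ} :
    p ≤ (Nat.card {b : Fin B // x b ≤ t} : ℝ) / B ↔
      ∃ A : Finset (Fin B), p ≤ (A.card : ℝ) / B ∧ ∀ b ∈ A, x b ≤ t := by
  classical
  have hc : ∀ t, Nat.card {b : Fin B // x b ≤ t} = (Finset.univ.filter fun b => x b ≤ t).card :=
    fun t => by rw [Nat.card_eq_fintype_card, Fintype.card_subtype]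
  rw [hc]
  constructor
  · intro h
    exact ⟨_, h, fun b hb => by simpa using hb⟩
  · rintro ⟨A, hA, hAt⟩
    refine hA.trans ?_
    have : A.card ≤ (Finset.univ.filter fun b => x b ≤ t).card :=
      Finset.card_le_card fun b hb => by simpa using hAt b hb
    gcongr

/-- The generalized inverse is adjoint to the empirical distribution function because its infimum is
attained: `p ≤ 1` makes the set nonempty, `0 < p` bounds it below, and it is closed. -/
lemma empQuantile_le_iff (hB : 0 < B) (x : Fin B → ℝ) {p : ℝ} (hp : 0 < p) (hp1 : p ≤ 1) {t : ℝ} :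
    empQuantile x p ≤ t ↔ p ≤ (Nat.card {b : Fin B // x b ≤ t} : ℝ) / B := by
  classical
  have hB' : (0 : ℝ) < B := by exact_mod_cast hB
  have : Nonempty (Fin B) := ⟨⟨0, hB⟩⟩
  set S : Set ℝ := {t | p ≤ (Nat.card {b : Fin B // x b ≤ t} : ℝ) / (B : ℝ)} with hS
  have hmono : ∀ {t t'}, t ≤ t' → t ∈ S → t' ∈ S := fun h ht =>
    le_trans (show p ≤ _ from ht) (natCard_subtype_div_mono fun b hb => hb.trans h)
  have hne : S.Nonempty := by
    obtain ⟨b₀, hb₀⟩ := Finite.exists_max x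
    refine ⟨x b₀, ?_⟩
    rw [hS, Set.mem_ofPred_eq, le_freq_iff_exists_finset hB]
    exact ⟨Finset.univ, by simpa [hB'.ne'] using hp1, fun b _ => hb₀ b⟩
  have hbdd : BddBelow S := by
    obtain ⟨b₀, hb₀⟩ := Finite.exists_min x
    refine ⟨x b₀, fun t ht => ?_⟩
    rw [hS, Set.mem_ofPred_eq, le_freq_iff_exists_finset hB] at ht
    obtain ⟨A, hA, hAt⟩ := ht
    rcases A.eq_empty_or_nonempty with rfl | ⟨b, hb⟩
    · simp at hA; linarith
    · exact (hb₀ b).trans (hAt b hb)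
  have hcl : IsClosed S := by
    have : S = ⋃ A ∈ {A : Finset (Fin B) | p ≤ (A.card : ℝ) / B}, ⋂ b ∈ A, Set.Ici (x b) := by
      ext t
      rw [hS, Set.mem_ofPred_eq, le_freq_iff_exists_finset hB]
      simp
    rw [this]
    exact (Set.toFinite _).isClosed_biUnion fun A _ => isClosed_biInter fun b _ => isClosed_Ici
  constructor
  · intro h
    exact hmono h (hcl.csInf_mem hne hbdd)
  · intro h
    exact csInf_le hbdd h

lemma lt_empQuantile_iff (hB : 0 < B) (x : Fin B → ℝ) {p : ℝ} (hp : 0 < p) (hp1 : p ≤ 1) {t : ℝ} :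
    t < empQuantile x p ↔ (Nat.card {b : Fin B // x b ≤ t} : ℝ) / B < p := by
  rw [← not_le, empQuantile_le_iff hB x hp hp1, not_le]

lemma empQuantile_mono (hB : 0 < B) (x : Fin B → ℝ) {p p' : ℝ} (hp : 0 < p) (hp1 : p' ≤ 1)
    (h : p ≤ p') : empQuantile x p ≤ empQuantile x p' := by
  rw [empQuantile_le_iff hB x hp (h.trans hp1)]
  exact h.trans ((empQuantile_le_iff hB x (hp.trans_le h) hp1).1 le_rfl)

lemma empFWER_le_of_lt (q : Fin B → Fin L → ℝ) {γ : ℝ} {v : Fin L → ℝ}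
    (h : ∀ ℓ, v ℓ ≤ empQuantile (fun b => q b ℓ) (1 - γ)) :
    empFWER q γ ≤ (Nat.card {b : Fin B // ∃ ℓ, v ℓ < q b ℓ} : ℝ) / B :=
  natCard_subtype_div_mono fun _ ⟨ℓ, hℓ⟩ => ⟨ℓ, (h ℓ).trans_lt hℓ⟩

lemma le_empFWER_of_le (q : Fin B → Fin L → ℝ) {γ : ℝ} {u : Fin L → ℝ}
    (h : ∀ ℓ, empQuantile (fun b => q b ℓ) (1 - γ) ≤ u ℓ) :
    (Nat.card {b : Fin B // ∃ ℓ, u ℓ < q b ℓ} : ℝ) / B ≤ empFWER q γ :=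
  natCard_subtype_div_mono fun _ ⟨ℓ, hℓ⟩ => ⟨ℓ, (h ℓ).trans_lt hℓ⟩

lemma empFWER_mono (hB : 0 < B) (q : Fin B → Fin L → ℝ) {γ γ' : ℝ} (h0 : 0 ≤ γ) (h1 : γ' < 1)
    (h : γ ≤ γ') : empFWER q γ ≤ empFWER q γ' :=
  empFWER_le_of_lt q fun ℓ => empQuantile_mono hB _ (by linarith) (by linarith) (by linarith)

/-- At level `0` the quantiles are sample maxima, so nothing exceeds them. Hence `0` is always an
admissible level and the supremum in `localLevel` is a maximum over a nonempty finite set. -/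
lemma empFWER_zero (hB : 0 < B) (q : Fin B → Fin L → ℝ) : empFWER q 0 = 0 := by
  have hB' : (0 : ℝ) < B := by exact_mod_cast hB
  have hempty : ∀ b : Fin B, ¬ ∃ ℓ, empQuantile (fun b' => q b' ℓ) (1 - 0) < q b ℓ := by
    rintro b ⟨ℓ, hℓ⟩
    have h := (empQuantile_le_iff hB (fun b' => q b' ℓ) (p := 1 - 0) (by norm_num)
      (by norm_num)).1 le_rfl
    rw [le_freq_iff_exists_finset hB] at h
    obtain ⟨A, hA, hAt⟩ := h
    rw [le_div_iff₀ hB', sub_zero, one_mul] at hA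
    have hAu : A = Finset.univ := by
      rw [← Finset.card_eq_iff_eq_univ, Fintype.card_fin]
      have := A.card_le_univ
      rw [Fintype.card_fin] at this
      exact le_antisymm this (by exact_mod_cast hA)
    exact absurd (hAt b (hAu ▸ Finset.mem_univ b)) (not_le.2 hℓ)
  have : IsEmpty {b : Fin B // ∃ ℓ, empQuantile (fun b' => q b' ℓ) (1 - 0) < q b ℓ} :=
    ⟨fun b => hempty b.1 b.2⟩
  rw [empFWER, Nat.card_of_isEmpty, Nat.cast_zero, zero_div]

lemma finite_levels (q : Fin B → Fin L → ℝ) (α : ℝ) :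
    {γ : ℝ | ∃ k : Fin B, γ = (k : ℝ) / (B : ℝ) ∧ empFWER q γ ≤ α}.Finite :=
  (Set.finite_range fun k : Fin B => (k : ℝ) / (B : ℝ)).subset
    fun _ ⟨k, hk, _⟩ => ⟨k, hk.symm⟩

lemma localLevel_mem (hB : 0 < B) (q : Fin B → Fin L → ℝ) {α : ℝ} (hα : 0 ≤ α) :
    ∃ k : Fin B, localLevel q α = (k : ℝ) / (B : ℝ) ∧ empFWER q (localLevel q α) ≤ α := by
  have hne : {γ : ℝ | ∃ k : Fin B, γ = (k : ℝ) / (B : ℝ) ∧ empFWER q γ ≤ α}.Nonempty :=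
    ⟨0, ⟨0, hB⟩, by simp, by rwa [empFWER_zero hB]⟩
  exact hne.csSup_mem (finite_levels q α)

lemma le_localLevel (q : Fin B → Fin L → ℝ) {α : ℝ} (k : Fin B)
    (hk : empFWER q ((k : ℝ) / B) ≤ α) : (k : ℝ) / B ≤ localLevel q α :=
  le_csSup (finite_levels q α).bddAbove ⟨k, rfl, hk⟩

lemma localLevel_nonneg (q : Fin B → Fin L → ℝ) (α : ℝ) : 0 ≤ localLevel q α :=
  Real.sSup_nonneg fun _ ⟨_, hk, _⟩ => hk ▸ by positivity

lemma localLevel_lt_one (hB : 0 < B) (q : Fin B → Fin L → ℝ) {α : ℝ} (hα : 0 ≤ α) :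
    localLevel q α < 1 := by
  obtain ⟨k, hk, -⟩ := localLevel_mem hB q hα
  have hB' : (0 : ℝ) < B := by exact_mod_cast hB
  rw [hk, div_lt_one hB']
  exact_mod_cast k.2

/-- A bound for the critical values from finitely many relative frequencies. -/
lemma lt_criticalValue (hB : 0 < B) (q : Fin B → Fin L → ℝ) {α : ℝ} (hα : 0 ≤ α) {γ : ℝ}
    (hγ0 : 0 < γ) (hγ1 : γ < 1) {u lo : Fin L → ℝ}
    (h1 : ∀ ℓ, 1 - γ ≤ (Nat.card {b : Fin B // q b ℓ ≤ u ℓ} : ℝ) / B)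
    (h2 : α < (Nat.card {b : Fin B // ∃ ℓ, u ℓ < q b ℓ} : ℝ) / B)
    (h3 : ∀ ℓ, (Nat.card {b : Fin B // q b ℓ ≤ lo ℓ} : ℝ) / B < 1 - γ) (ℓ : Fin L) :
    lo ℓ < criticalValue q α ℓ := by
  obtain ⟨k, hk, hkα⟩ := localLevel_mem hB q hα
  have hl1 := localLevel_lt_one hB q hα
  have hl0 := localLevel_nonneg q α
  -- Were the adapted level at least `γ`, every quantile would lie below `u` and the empirical error
  -- rate would exceed `α` by `h2`.
  have hlt : localLevel q α < γ := by
    by_contra! hcon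
    have := le_empFWER_of_le q (γ := localLevel q α) (u := u) fun ℓ =>
      (empQuantile_mono hB _ (by linarith) (by linarith) (by linarith)).trans
        ((empQuantile_le_iff hB _ (p := 1 - γ) (by linarith) (by linarith)).2 (h1 ℓ))
    linarith
  exact ((lt_empQuantile_iff hB _ (by linarith) (by linarith)).2 (h3 ℓ)).trans_le
    (empQuantile_mono hB _ (by linarith) (by linarith) (by linarith))

/-- A bound for the critical values from finitely many relative frequencies. -/
lemma criticalValue_le (hB : 0 < B) (q : Fin B → Fin L → ℝ) {α : ℝ} (hα : 0 ≤ α) {γ γ' : ℝ}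
    (hγ0 : 0 < γ) (hγ1 : γ' < 1) (hBγ : 1 / (B : ℝ) ≤ γ' - γ) {v hi : Fin L → ℝ}
    (h1 : ∀ ℓ, (Nat.card {b : Fin B // q b ℓ ≤ v ℓ} : ℝ) / B < 1 - γ')
    (h2 : (Nat.card {b : Fin B // ∃ ℓ, v ℓ < q b ℓ} : ℝ) / B ≤ α)
    (h3 : ∀ ℓ, 1 - γ ≤ (Nat.card {b : Fin B // q b ℓ ≤ hi ℓ} : ℝ) / B) (ℓ : Fin L) :
    criticalValue q α ℓ ≤ hi ℓ := by
  have hB' : (0 : ℝ) < B := by exact_mod_cast hB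
  have hBpos : 0 < 1 / (B : ℝ) := by positivity
  -- Only multiples of `1 / B` compete for the adapted level. Rounding `γ` up to the grid stays at
  -- most `γ'`, since the gap is at least `1 / B`.
  set k : ℕ := ⌈γ * B⌉₊
  have hk1 : γ ≤ (k : ℝ) / B := by
    rw [le_div_iff₀ hB']; exact Nat.le_ceil _
  have hk2 : (k : ℝ) / B ≤ γ' := by
    have h := (Nat.ceil_lt_add_one (a := γ * B) (by positivity)).le
    calc (k : ℝ) / B ≤ (γ * B + 1) / B := by gcongr
      _ = γ + 1 / B := by field_simp
      _ ≤ γ' := by linarith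
  have hkB : k < B := by
    have : (k : ℝ) / B < 1 := by linarith
    rw [div_lt_one hB'] at this
    exact_mod_cast this
  have hle : γ ≤ localLevel q α := by
    refine hk1.trans (le_localLevel q ⟨k, hkB⟩ ?_)
    refine (empFWER_mono hB q (by positivity) hγ1 hk2).trans (le_trans ?_ h2)
    exact empFWER_le_of_lt q fun ℓ =>
      ((lt_empQuantile_iff hB _ (by linarith) (by linarith)).2 (h1 ℓ)).le
  have hl1 := localLevel_lt_one hB q hα
  exact (empQuantile_mono hB _ (by linarith) (by linarith) (by linarith)).trans
    ((empQuantile_le_iff hB _ (p := 1 - γ) (by linarith) (by linarith)).2 (h3 ℓ))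

end Quantiles

/-! ### Measurability -/

section Measurability

variable {B L : ℕ} {S : Type*} [MeasurableSpace S]

lemma measurable_natCard_div {A : S → Fin B → Prop} (hA : ∀ b, MeasurableSet {s | A s b}) :
    Measurable fun s => (Nat.card {b : Fin B // A s b} : ℝ) / B := by
  classical
  have : (fun s => (Nat.card {b : Fin B // A s b} : ℝ) / B) =
      fun s => (∑ b : Fin B, {s | A s b}.indicator (1 : S → ℝ) s) / B := by
    ext s
    rw [Nat.card_eq_fintype_card, Fintype.card_subtype]
    simp [Set.indicator_apply]
  rw [this]
  exact (Finset.measurable_sum _ fun b _ => measurable_one.indicator (hA b)).div_const _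

lemma measurable_empQuantile (hB : 0 < B) {x : S → Fin B → ℝ} (hx : ∀ b, Measurable fun s => x s b)
    {p : S → ℝ} (hp : Measurable p) (hp0 : ∀ s, 0 < p s) (hp1 : ∀ s, p s ≤ 1) :
    Measurable fun s => empQuantile (x s) (p s) := by
  refine measurable_of_Iic fun t => ?_
  have : (fun s => empQuantile (x s) (p s)) ⁻¹' Set.Iic t =
      {s | p s ≤ (Nat.card {b : Fin B // x s b ≤ t} : ℝ) / B} := by
    ext s
    exact empQuantile_le_iff hB (x s) (hp0 s) (hp1 s)
  rw [this]
  exact measurableSet_le hp (measurable_natCard_div fun b => measurableSet_le (hx b) measurable_const)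

lemma measurable_empFWER (hB : 0 < B) {q : S → Fin B → Fin L → ℝ}
    (hq : ∀ b ℓ, Measurable fun s => q s b ℓ) {γ : ℝ} (h0 : 0 ≤ γ) (h1 : γ < 1) :
    Measurable fun s => empFWER (q s) γ := by
  refine measurable_natCard_div fun b => ?_
  simp only [Set.ofPred_exists]
  refine MeasurableSet.iUnion fun ℓ => measurableSet_lt ?_ (hq b ℓ)
  exact measurable_empQuantile hB (fun b' => hq b' ℓ) measurable_const (fun _ => by linarith)
    (fun _ => by linarith)

lemma measurable_localLevel (hB : 0 < B) {q : S → Fin B → Fin L → ℝ}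
    (hq : ∀ b ℓ, Measurable fun s => q s b ℓ) {α : ℝ} (hα : 0 ≤ α) :
    Measurable fun s => localLevel (q s) α := by
  refine measurable_of_Iic fun t => ?_
  -- The supremum is attained on a finite grid, so bounding it from above amounts to finitely many
  -- implications.
  have : (fun s => localLevel (q s) α) ⁻¹' Set.Iic t =
      ⋂ k : Fin B, {s | empFWER (q s) ((k : ℝ) / B) ≤ α → (k : ℝ) / B ≤ t} := by
    ext s
    simp only [Set.mem_preimage, Set.mem_Iic, Set.mem_iInter, Set.mem_ofPred_eq]
    constructor
    · exact fun h k hk => (le_localLevel (q s) k hk).trans h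
    · intro h
      obtain ⟨k, hk, hkα⟩ := localLevel_mem hB (q s) hα
      rw [hk] at hkα ⊢
      exact h k hkα
  rw [this]
  have hB' : (0 : ℝ) < B := by exact_mod_cast hB
  refine MeasurableSet.iInter fun k => ?_
  have hk1 : (k : ℝ) / B < 1 := by
    rw [div_lt_one hB']; exact_mod_cast k.2
  exact (measurableSet_le (measurable_empFWER hB hq (by positivity) hk1) measurable_const).imp
    (MeasurableSet.const _)

lemma measurable_criticalValue {q : S → Fin B → Fin L → ℝ}
    (hq : ∀ b ℓ, Measurable fun s => q s b ℓ) {α : ℝ} (hα : 0 ≤ α) (ℓ : Fin L) :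
    Measurable fun s => criticalValue (q s) α ℓ := by
  -- Without replicates the characterization of quantiles is unavailable, but the array of
  -- replicates is then unique and the map is constant.
  rcases B.eq_zero_or_pos with rfl | hB
  · have : (fun s => criticalValue (q s) α ℓ) = fun _ => criticalValue Fin.elim0 α ℓ := by
      ext s
      rw [Subsingleton.elim (q s) Fin.elim0]
    rw [this]
    exact measurable_const
  · refine measurable_empQuantile hB (fun b => hq b ℓ)
      (measurable_const.sub (measurable_localLevel hB hq hα)) (fun s => ?_) (fun s => ?_)
    · linarith [localLevel_lt_one hB (q s) hα]
    · linarith [localLevel_nonneg (q s) α]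

end Measurability

end QFMCT

end

noncomputable section

namespace QFMCT

/-! ### Critical values of the limit law -/

lemma continuous_cdf_of_measure_singleton {μ : Measure ℝ} [IsProbabilityMeasure μ]
    (h : ∀ x, μ {x} = 0) : Continuous (cdf μ) := by
  rw [continuous_iff_continuousAt]
  intro x
  rw [continuousAt_iff_continuous_left'_right']
  have h1 := (cdf μ).measure_singleton x
  rw [measure_cdf, h x, eq_comm, ENNReal.ofReal_eq_zero] at h1
  have h2 := (cdf μ).mono.leftLim_le (le_refl x)
  have h3 : Function.leftLim (cdf μ) x = cdf μ x := le_antisymm h2 (by linarith)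
  refine ⟨?_, ((cdf μ).right_continuous x).mono Set.Ioi_subset_Ici_self⟩
  have := (cdf μ).mono.tendsto_leftLim x
  rwa [h3] at this

/-- Finitely many nonnegative random variables with continuous distribution functions, whose
maxima charge all nonempty open intervals of thresholds. -/
structure IsRegularLimit {E : Type*} [MeasurableSpace E] (Γ : Measure E) {L : ℕ}
    (Y : Fin L → E → ℝ) : Prop where
  measurable : ∀ ℓ, Measurable (Y ℓ)
  nonneg : ∀ ℓ g, 0 ≤ Y ℓ g
  measure_eq : ∀ ℓ t, Γ {g | Y ℓ g = t} = 0
  measure_pos : ∀ T : Finset (Fin L), T.Nonempty → ∀ u u' : Fin L → ℝ, (∀ ℓ, 0 ≤ u ℓ) →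
    (∀ ℓ, u ℓ < u' ℓ) → 0 < Γ {g | (∃ ℓ ∈ T, u ℓ < Y ℓ g) ∧ ∀ ℓ ∈ T, Y ℓ g ≤ u' ℓ}

namespace IsRegularLimit

variable {E : Type*} [MeasurableSpace E] {Γ : Measure E} {L : ℕ} {Y : Fin L → E → ℝ}

lemma measurableSet_exists_lt (hY : IsRegularLimit Γ Y) (T : Finset (Fin L)) (u : Fin L → ℝ) :
    MeasurableSet {g | ∃ ℓ ∈ T, u ℓ < Y ℓ g} := by
  have : {g | ∃ ℓ ∈ T, u ℓ < Y ℓ g} = ⋃ ℓ ∈ T, {g | u ℓ < Y ℓ g} := by ext; simp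
  rw [this]
  exact T.measurableSet_biUnion fun ℓ _ => measurableSet_lt measurable_const (hY.measurable ℓ)

variable [IsProbabilityMeasure Γ]

lemma real_exists_lt_strictAnti (hY : IsRegularLimit Γ Y) {T : Finset (Fin L)} (hT : T.Nonempty)
    {u u' : Fin L → ℝ} (h0 : ∀ ℓ, 0 ≤ u ℓ) (h : ∀ ℓ, u ℓ < u' ℓ) :
    Γ.real {g | ∃ ℓ ∈ T, u' ℓ < Y ℓ g} < Γ.real {g | ∃ ℓ ∈ T, u ℓ < Y ℓ g} := by
  have hpos := hY.measure_pos T hT u u' h0 h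
  set A := {g | ∃ ℓ ∈ T, u' ℓ < Y ℓ g}
  set A' := {g | (∃ ℓ ∈ T, u ℓ < Y ℓ g) ∧ ∀ ℓ ∈ T, Y ℓ g ≤ u' ℓ}
  have hd : Disjoint A' A := by
    rw [Set.disjoint_left]
    rintro g ⟨-, hg⟩ ⟨ℓ, hℓ, hg'⟩
    exact absurd (hg ℓ hℓ) (not_le.2 hg')
  have hle : Γ.real (A' ∪ A) ≤ Γ.real {g | ∃ ℓ ∈ T, u ℓ < Y ℓ g} := by
    refine measureReal_mono ?_
    rintro g (⟨hg, -⟩ | ⟨ℓ, hℓ, hg⟩)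
    · exact hg
    · exact ⟨ℓ, hℓ, (h ℓ).trans hg⟩
  rw [measureReal_union hd (hY.measurableSet_exists_lt T u')] at hle
  have : 0 < Γ.real A' := ENNReal.toReal_pos hpos.ne' (measure_ne_top _ _)
  linarith

lemma real_exists_lt_singleton (hY : IsRegularLimit Γ Y) (ℓ : Fin L) (u : Fin L → ℝ) :
    Γ.real {g | ∃ ℓ' ∈ ({ℓ} : Finset (Fin L)), u ℓ' < Y ℓ' g} =
      1 - Γ.real {g | Y ℓ g ≤ u ℓ} := by
  rw [← probReal_compl_eq_one_sub (measurableSet_le (hY.measurable ℓ) measurable_const)]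
  congr 1
  ext g
  simp

lemma real_le_strictMono (hY : IsRegularLimit Γ Y) (ℓ : Fin L) {s t : ℝ} (hs : 0 ≤ s)
    (hst : s < t) : Γ.real {g | Y ℓ g ≤ s} < Γ.real {g | Y ℓ g ≤ t} := by
  have h := hY.real_exists_lt_strictAnti (Finset.singleton_nonempty ℓ) (u := fun _ => s)
    (u' := fun _ => t) (fun _ => hs) (fun _ => hst)
  rw [hY.real_exists_lt_singleton, hY.real_exists_lt_singleton] at h
  linarith

lemma continuous_real_le (hY : IsRegularLimit Γ Y) (ℓ : Fin L) :
    Continuous fun t => Γ.real {g | Y ℓ g ≤ t} := by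
  have := Measure.isProbabilityMeasure_map (μ := Γ) (hY.measurable ℓ).aemeasurable
  have h : (fun t => Γ.real {g | Y ℓ g ≤ t}) = cdf (Γ.map (Y ℓ)) := by
    ext t
    rw [cdf_eq_real, map_measureReal_apply (hY.measurable ℓ) measurableSet_Iic]
    rfl
  rw [h]
  refine continuous_cdf_of_measure_singleton fun x => ?_
  rw [Measure.map_apply (hY.measurable ℓ) (measurableSet_singleton x)]
  exact hY.measure_eq ℓ x

lemma real_le_zero (hY : IsRegularLimit Γ Y) (ℓ : Fin L) : Γ.real {g | Y ℓ g ≤ 0} = 0 := by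
  rw [measureReal_eq_zero_iff, ← hY.measure_eq ℓ 0]
  congr 1
  ext g
  exact ⟨fun h => le_antisymm h (hY.nonneg ℓ g), fun h => le_of_eq h⟩

lemma tendsto_real_le (hY : IsRegularLimit Γ Y) (ℓ : Fin L) :
    Tendsto (fun t => Γ.real {g | Y ℓ g ≤ t}) atTop (𝓝 1) := by
  have := Measure.isProbabilityMeasure_map (μ := Γ) (hY.measurable ℓ).aemeasurable
  have h : (fun t => Γ.real {g | Y ℓ g ≤ t}) = cdf (Γ.map (Y ℓ)) := by
    ext t
    rw [cdf_eq_real, map_measureReal_apply (hY.measurable ℓ) measurableSet_Iic]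
    rfl
  rw [h]
  exact tendsto_cdf_atTop _

lemma exists_real_le_eq (hY : IsRegularLimit Γ Y) (ℓ : Fin L) {p : ℝ} (hp : p ∈ Set.Ioo (0 : ℝ) 1) :
    ∃ c, 0 < c ∧ Γ.real {g | Y ℓ g ≤ c} = p := by
  obtain ⟨t, ht⟩ := ((hY.tendsto_real_le ℓ).eventually (lt_mem_nhds hp.2)).exists
  obtain ⟨c, hc⟩ := mem_range_of_exists_le_of_exists_ge (hY.continuous_real_le ℓ)
    ⟨0, by rw [hY.real_le_zero]; exact hp.1.le⟩ ⟨t, ht.le⟩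
  refine ⟨c, ?_, hc⟩
  by_contra! hcon
  have : Γ.real {g | Y ℓ g ≤ c} ≤ Γ.real {g | Y ℓ g ≤ 0} :=
    measureReal_mono fun g hg => le_trans hg hcon
  rw [hY.real_le_zero] at this
  simp only at hc
  linarith [hp.1]

/-- The distribution function vanishes on the negative half-line and increases strictly only from
zero on, hence the sign condition on `t`. -/
lemma real_le_le_iff (hY : IsRegularLimit Γ Y) (ℓ : Fin L) {s t : ℝ} (ht : 0 ≤ t) :
    Γ.real {g | Y ℓ g ≤ s} ≤ Γ.real {g | Y ℓ g ≤ t} ↔ s ≤ t := by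
  constructor
  · intro h
    by_contra! hcon
    exact absurd h (not_le.2 (hY.real_le_strictMono ℓ ht hcon))
  · exact fun h => measureReal_mono fun g hg => le_trans hg h

/-- Component-wise quantiles at a common level for which some component exceeds its quantile with
probability `α`. -/
lemma exists_critical (hY : IsRegularLimit Γ Y) (hL : 1 ≤ L) {α : ℝ} (hα : α ∈ Set.Ioo (0 : ℝ) 1) :
    ∃ c : Fin L → ℝ, ∃ γ ∈ Set.Ioo (0 : ℝ) 1, (∀ ℓ, 0 < c ℓ) ∧
      (∀ ℓ, Γ.real {g | Y ℓ g ≤ c ℓ} = 1 - γ) ∧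
      Γ.real {g | ∃ ℓ ∈ (Finset.univ : Finset (Fin L)), c ℓ < Y ℓ g} = α := by
  have hne : (Finset.univ : Finset (Fin L)).Nonempty := ⟨⟨0, hL⟩, Finset.mem_univ _⟩
  set F : Fin L → ℝ → ℝ := fun ℓ t => Γ.real {g | Y ℓ g ≤ t}
  -- Maximum of the probability transforms: `V g ≤ s` says that every component is at most its own
  -- `s`-quantile, so one scalar distribution function describes all choices of a common level.
  set V : E → ℝ := fun g => Finset.univ.sup' hne fun ℓ => F ℓ (Y ℓ g)
  have hVm : Measurable V := by
    have : V = Finset.univ.sup' hne fun ℓ g => F ℓ (Y ℓ g) := by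
      ext g; simp [V, Finset.sup'_apply]
    rw [this]
    exact Finset.measurable_sup' hne fun ℓ _ =>
      (hY.continuous_real_le ℓ).measurable.comp (hY.measurable ℓ)
  have hV : ∀ g s, V g ≤ s ↔ ∀ ℓ, F ℓ (Y ℓ g) ≤ s := fun g s => by simp [V, Finset.sup'_le_iff]
  have := Measure.isProbabilityMeasure_map (μ := Γ) hVm.aemeasurable
  have hcdf : ∀ s, cdf (Γ.map V) s = Γ.real {g | ∀ ℓ, F ℓ (Y ℓ g) ≤ s} := fun s => by
    rw [cdf_eq_real, map_measureReal_apply hVm measurableSet_Iic]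
    congr 1
    ext g
    exact hV g s
  have hcont : Continuous (cdf (Γ.map V)) := by
    refine continuous_cdf_of_measure_singleton fun s => ?_
    rw [Measure.map_apply hVm (measurableSet_singleton s)]
    -- An atom of `V` at `s` would come from some component; as its distribution function is
    -- injective on nonnegative values, the event lies in one level set of `Y ℓ`, which is null.
    refine measure_mono_null (t := ⋃ ℓ, {g | F ℓ (Y ℓ g) = s}) ?_ (measure_iUnion_null fun ℓ => ?_)
    · intro g hg
      obtain ⟨ℓ, -, hℓ⟩ := Finset.exists_mem_eq_sup' hne fun ℓ => F ℓ (Y ℓ g)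
      exact Set.mem_iUnion.2 ⟨ℓ, hℓ.symm.trans hg⟩
    · rcases Set.eq_empty_or_nonempty {g | F ℓ (Y ℓ g) = s} with he | ⟨g₀, hg₀⟩
      · rw [he, measure_empty]
      · refine measure_mono_null (fun g hg => ?_) (hY.measure_eq ℓ (Y ℓ g₀))
        have hgg : F ℓ (Y ℓ g) = F ℓ (Y ℓ g₀) := Eq.trans hg (Eq.symm hg₀)
        exact le_antisymm ((hY.real_le_le_iff ℓ (hY.nonneg ℓ g₀)).1 hgg.le)
          ((hY.real_le_le_iff ℓ (hY.nonneg ℓ g)).1 hgg.ge)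
  have hFnn : ∀ ℓ t, 0 ≤ F ℓ t := fun _ _ => measureReal_nonneg
  have h1 : cdf (Γ.map V) 1 = 1 := by
    rw [hcdf]
    have : {g | ∀ ℓ, F ℓ (Y ℓ g) ≤ 1} = Set.univ := by
      ext g; simpa using fun ℓ => measureReal_le_one
    rw [this, probReal_univ]
  have h0 : cdf (Γ.map V) 0 = 0 := by
    rw [hcdf, measureReal_eq_zero_iff]
    refine measure_mono_null (fun g hg => ?_) (hY.measure_eq ⟨0, hL⟩ 0)
    have h := hg ⟨0, hL⟩
    rw [← hY.real_le_zero ⟨0, hL⟩, hY.real_le_le_iff _ le_rfl] at h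
    exact le_antisymm h (hY.nonneg _ g)
  -- Intermediate value theorem for the continuous distribution function of `V`.
  obtain ⟨s, hs⟩ := mem_range_of_exists_le_of_exists_ge hcont (c := 1 - α)
    ⟨0, by rw [h0]; linarith [hα.2]⟩ ⟨1, by rw [h1]; linarith [hα.1]⟩
  have hs0 : 0 < s := by
    by_contra! hcon
    have := monotone_cdf (Γ.map V) hcon
    rw [h0] at this
    linarith [hα.2]
  have hs1 : s < 1 := by
    by_contra! hcon
    have := monotone_cdf (Γ.map V) hcon
    rw [h1] at this
    linarith [hα.1]
  choose c hc0 hc using fun ℓ => hY.exists_real_le_eq ℓ (p := s) ⟨hs0, hs1⟩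
  refine ⟨c, 1 - s, ⟨by linarith, by linarith⟩, hc0, fun ℓ => by rw [hc]; ring, ?_⟩
  have hset : {g | ∃ ℓ ∈ (Finset.univ : Finset (Fin L)), c ℓ < Y ℓ g} =
      {g | ∀ ℓ, F ℓ (Y ℓ g) ≤ s}ᶜ := by
    ext g
    simp only [Finset.mem_univ, true_and, Set.mem_ofPred_eq, Set.mem_compl_iff, not_forall, not_le]
    refine exists_congr fun ℓ => ?_
    rw [← hc ℓ, ← not_le, ← not_le, hY.real_le_le_iff ℓ (hc0 ℓ).le]
  have hm : MeasurableSet {g | ∀ ℓ, F ℓ (Y ℓ g) ≤ s} := by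
    have : {g | ∀ ℓ, F ℓ (Y ℓ g) ≤ s} = V ⁻¹' Set.Iic s := by
      ext g; exact (hV g s).symm
    rw [this]
    exact hVm measurableSet_Iic
  rw [hset, probReal_compl_eq_one_sub hm, ← hcdf, hs]
  ring

variable {c : Fin L → ℝ} {γ α : ℝ}

/-- Moving the thresholds slightly below `c` turns the conditions of `lt_criticalValue` into strict
inequalities between limit probabilities, so that they hold for the frequencies with probability
tending to one. -/
lemma exists_lower_levels (hY : IsRegularLimit Γ Y) (hL : 1 ≤ L) (hγ : γ ∈ Set.Ioo (0 : ℝ) 1)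
    (hc0 : ∀ ℓ, 0 < c ℓ) (hc : ∀ ℓ, Γ.real {g | Y ℓ g ≤ c ℓ} = 1 - γ)
    (hα : Γ.real {g | ∃ ℓ ∈ (Finset.univ : Finset (Fin L)), c ℓ < Y ℓ g} = α) {η : ℝ} (hη : 0 < η) :
    ∃ γ₁ ∈ Set.Ioo (0 : ℝ) 1, ∃ u lo : Fin L → ℝ, (∀ ℓ, c ℓ - η ≤ lo ℓ) ∧
      (∀ ℓ, 1 - γ₁ < Γ.real {g | Y ℓ g ≤ u ℓ}) ∧
      (α < Γ.real {g | ∃ ℓ ∈ (Finset.univ : Finset (Fin L)), u ℓ < Y ℓ g}) ∧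
      ∀ ℓ, Γ.real {g | Y ℓ g ≤ lo ℓ} < 1 - γ₁ := by
  have hne : (Finset.univ : Finset (Fin L)).Nonempty := ⟨⟨0, hL⟩, Finset.mem_univ _⟩
  -- The maximum with `c ℓ / 2` keeps the threshold positive, inside the range where the limit
  -- distribution functions increase strictly.
  set lo : Fin L → ℝ := fun ℓ => max (c ℓ - η) (c ℓ / 2)
  have hlo0 : ∀ ℓ, 0 < lo ℓ := fun ℓ => lt_max_of_lt_right (half_pos (hc0 ℓ))
  have hloc : ∀ ℓ, lo ℓ < c ℓ := fun ℓ => max_lt (by linarith) (by linarith [hc0 ℓ])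
  have hlt : ∀ ℓ, Γ.real {g | Y ℓ g ≤ lo ℓ} < 1 - γ := fun ℓ => by
    rw [← hc ℓ]; exact hY.real_le_strictMono ℓ (hlo0 ℓ).le (hloc ℓ)
  have hev : ∀ᶠ x in 𝓝[>] γ, x < 1 ∧ ∀ ℓ, Γ.real {g | Y ℓ g ≤ lo ℓ} < 1 - x := by
    refine nhdsWithin_le_nhds ((gt_mem_nhds hγ.2).and (eventually_all.2 fun ℓ => ?_))
    exact (continuous_const.sub continuous_id).continuousAt.eventually (lt_mem_nhds (hlt ℓ))
  obtain ⟨γ₁, ⟨h1, hlo⟩, hγγ⟩ := (hev.and self_mem_nhdsWithin).exists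
  have hγγ' : γ < γ₁ := hγγ
  have hu : ∀ ℓ, ∃ u, lo ℓ < u ∧ u < c ℓ ∧ 1 - γ₁ < Γ.real {g | Y ℓ g ≤ u} := fun ℓ => by
    have e1 : ∀ᶠ u in 𝓝[<] c ℓ, lo ℓ < u ∧ 1 - γ₁ < Γ.real {g | Y ℓ g ≤ u} := by
      refine nhdsWithin_le_nhds ((lt_mem_nhds (hloc ℓ)).and ?_)
      exact (hY.continuous_real_le ℓ).continuousAt.eventually
        (lt_mem_nhds (by simp only [hc ℓ]; linarith))
    obtain ⟨u, ⟨hu1, hu2⟩, hu3⟩ := (e1.and self_mem_nhdsWithin).exists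
    exact ⟨u, hu1, hu3, hu2⟩
  choose u hu1 hu2 hu3 using hu
  refine ⟨γ₁, ⟨hγ.1.trans hγγ', h1⟩, u, lo, fun ℓ => le_max_left _ _, hu3, ?_, hlo⟩
  rw [← hα]
  exact hY.real_exists_lt_strictAnti hne (fun ℓ => ((hlo0 ℓ).trans (hu1 ℓ)).le) hu2

/-- Counterpart for `criticalValue_le`, with thresholds above `c`. Two levels are needed because a
grid point of spacing `1 / B` has to fit between them. -/
lemma exists_upper_levels (hY : IsRegularLimit Γ Y) (hL : 1 ≤ L) (hγ : γ ∈ Set.Ioo (0 : ℝ) 1)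
    (hc0 : ∀ ℓ, 0 < c ℓ) (hc : ∀ ℓ, Γ.real {g | Y ℓ g ≤ c ℓ} = 1 - γ)
    (hα : Γ.real {g | ∃ ℓ ∈ (Finset.univ : Finset (Fin L)), c ℓ < Y ℓ g} = α) {η : ℝ} (hη : 0 < η) :
    ∃ γ₁ γ₂ : ℝ, 0 < γ₁ ∧ γ₁ < γ₂ ∧ γ₂ < 1 ∧ ∃ v hi : Fin L → ℝ, (∀ ℓ, hi ℓ ≤ c ℓ + η) ∧
      (∀ ℓ, Γ.real {g | Y ℓ g ≤ v ℓ} < 1 - γ₂) ∧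
      (Γ.real {g | ∃ ℓ ∈ (Finset.univ : Finset (Fin L)), v ℓ < Y ℓ g} < α) ∧
      ∀ ℓ, 1 - γ₁ < Γ.real {g | Y ℓ g ≤ hi ℓ} := by
  have hne : (Finset.univ : Finset (Fin L)).Nonempty := ⟨⟨0, hL⟩, Finset.mem_univ _⟩
  have hlt : ∀ ℓ, 1 - γ < Γ.real {g | Y ℓ g ≤ c ℓ + η} := fun ℓ => by
    rw [← hc ℓ]; exact hY.real_le_strictMono ℓ (hc0 ℓ).le (by linarith)
  have hev : ∀ᶠ x in 𝓝[<] γ, 0 < x ∧ ∀ ℓ, 1 - x < Γ.real {g | Y ℓ g ≤ c ℓ + η} := by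
    refine nhdsWithin_le_nhds ((lt_mem_nhds hγ.1).and (eventually_all.2 fun ℓ => ?_))
    exact (continuous_const.sub continuous_id).continuousAt.eventually (gt_mem_nhds (hlt ℓ))
  obtain ⟨γ₁, ⟨h1, hhi⟩, hγγ⟩ := (hev.and self_mem_nhdsWithin).exists
  have hγγ' : γ₁ < γ := hγγ
  -- The midpoint lies below `γ`, which leaves room for `v` above `c`, and above `γ₁`, which leaves
  -- room for a grid point.
  have hv : ∀ ℓ, ∃ v, c ℓ < v ∧ Γ.real {g | Y ℓ g ≤ v} < 1 - (γ₁ + γ) / 2 := fun ℓ => by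
    have e1 : ∀ᶠ v in 𝓝[>] c ℓ, Γ.real {g | Y ℓ g ≤ v} < 1 - (γ₁ + γ) / 2 :=
      nhdsWithin_le_nhds ((hY.continuous_real_le ℓ).continuousAt.eventually
        (gt_mem_nhds (by simp only [hc ℓ]; linarith)))
    obtain ⟨v, hv2, hv3⟩ := (e1.and self_mem_nhdsWithin).exists
    exact ⟨v, hv3, hv2⟩
  choose v hv1 hv2 using hv
  refine ⟨γ₁, (γ₁ + γ) / 2, h1, by linarith, by linarith [hγ.2], v, fun ℓ => c ℓ + η,
    fun ℓ => le_rfl, hv2, ?_, hhi⟩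
  rw [← hα]
  exact hY.real_exists_lt_strictAnti hne (fun ℓ => (hc0 ℓ).le) hv1

/-- Convergence of the critical values, given convergence of relative frequencies. -/
lemma convInProb_criticalValue (hY : IsRegularLimit Γ Y) (hL : 1 ≤ L)
    (hγ : γ ∈ Set.Ioo (0 : ℝ) 1) (hα0 : 0 ≤ α)
    (hc0 : ∀ ℓ, 0 < c ℓ) (hc : ∀ ℓ, Γ.real {g | Y ℓ g ≤ c ℓ} = 1 - γ)
    (hα : Γ.real {g | ∃ ℓ ∈ (Finset.univ : Finset (Fin L)), c ℓ < Y ℓ g} = α)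
    {Ω : Type*} [MeasurableSpace Ω] {P : Measure Ω} {B : ℕ → ℕ} (hB : Tendsto B atTop atTop)
    {q : ℕ → ℕ → Ω → Fin L → ℝ}
    (hq : ∀ (T : Finset (Fin L)) (u : Fin L → ℝ), ConvInProb P
      (fun ν ω => (Nat.card {b : Fin (B ν) // ∃ ℓ ∈ T, u ℓ < q ν b ω ℓ} : ℝ) / B ν)
      (Γ.real {g | ∃ ℓ ∈ T, u ℓ < Y ℓ g})) (ℓ : Fin L) :
    ConvInProb P (fun ν ω => criticalValue (fun b : Fin (B ν) => q ν b ω) α ℓ) (c ℓ) := by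
  have hcard : ∀ {B : ℕ} (hB : 0 < B) (x : Fin B → ℝ) (t : ℝ),
      (Nat.card {b : Fin B // x b ≤ t} : ℝ) / B = 1 - (Nat.card {b : Fin B // t < x b} : ℝ) / B := by
    intro B hB x t
    classical
    have hB' : (B : ℝ) ≠ 0 := by exact_mod_cast hB.ne'
    have h := Finset.card_filter_add_card_filter_not (s := (Finset.univ : Finset (Fin B)))
      (fun b => x b ≤ t)
    simp only [not_le, Finset.card_univ, Fintype.card_fin] at h
    rw [Nat.card_eq_fintype_card, Nat.card_eq_fintype_card, Fintype.card_subtype,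
      Fintype.card_subtype, eq_sub_iff_add_eq, ← add_div, ← Nat.cast_add, h, div_self hB']
  have hle : ∀ (ℓ : Fin L) (u : Fin L → ℝ), ConvInProb P
      (fun ν ω => (Nat.card {b : Fin (B ν) // q ν b ω ℓ ≤ u ℓ} : ℝ) / B ν)
      (Γ.real {g | Y ℓ g ≤ u ℓ}) := fun ℓ u => by
    have h1 := hq {ℓ} u
    rw [hY.real_exists_lt_singleton] at h1
    have h2 := h1.comp (f := fun x => 1 - x) (by fun_prop)
    rw [sub_sub_cancel] at h2
    refine h2.congr ((hB.eventually_gt_atTop 0).mono fun ν hν ω => ?_)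
    rw [hcard hν]
    simp
  have hall : ∀ u : Fin L → ℝ, ConvInProb P
      (fun ν ω => (Nat.card {b : Fin (B ν) // ∃ ℓ, u ℓ < q ν b ω ℓ} : ℝ) / B ν)
      (Γ.real {g | ∃ ℓ ∈ (Finset.univ : Finset (Fin L)), u ℓ < Y ℓ g}) := fun u => by
    simpa using hq Finset.univ u
  rw [convInProb_iff_dist]
  intro η hη
  obtain ⟨a₁, ha₁, u, lo, hloc, h1, h2, h3⟩ :=
    hY.exists_lower_levels hL hγ hc0 hc hα (half_pos hη)
  obtain ⟨b₁, b₂, hb0, hbb, hb1, v, hi, hhic, k1, k2, k3⟩ :=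
    hY.exists_upper_levels hL hγ hc0 hc hα (half_pos hη)
  have t1 := tendsto_measure_zero_iUnion fun ℓ => hle ℓ u _ (lt_mem_nhds (h1 ℓ))
  have t2 := hall u _ (lt_mem_nhds h2)
  have t3 := tendsto_measure_zero_iUnion fun ℓ => hle ℓ lo _ (gt_mem_nhds (h3 ℓ))
  have s1 := tendsto_measure_zero_iUnion fun ℓ => hle ℓ v _ (gt_mem_nhds (k1 ℓ))
  have s2 := hall v _ (gt_mem_nhds k2)
  have s3 := tendsto_measure_zero_iUnion fun ℓ => hle ℓ hi _ (lt_mem_nhds (k3 ℓ))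
  have hBγ : ∀ᶠ ν in atTop, 1 / (B ν : ℝ) ≤ b₂ - b₁ := by
    have : Tendsto (fun ν => 1 / (B ν : ℝ)) atTop (𝓝 0) := by
      simp_rw [one_div]
      exact tendsto_inv_atTop_zero.comp (tendsto_natCast_atTop_atTop.comp hB)
    exact this.eventually (ge_mem_nhds (by linarith))
  -- Off six kinds of exceptional events, each of vanishing probability, all frequencies lie on the
  -- correct side and the two deterministic bounds apply.
  refine tendsto_measure_zero_of_subset (tendsto_measure_zero_union (tendsto_measure_zero_union
    (tendsto_measure_zero_union t1 t2) t3) (tendsto_measure_zero_union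
    (tendsto_measure_zero_union s1 s2) s3)) ?_
  filter_upwards [hB.eventually_gt_atTop 0, hBγ] with ν hBν hBγν ω hω
  by_contra hcon
  simp only [Set.mem_union, Set.mem_iUnion, Set.mem_ofPred_eq, not_or, not_exists, not_not] at hcon
  obtain ⟨⟨⟨c1, c2⟩, c3⟩, ⟨⟨d1, d2⟩, d3⟩⟩ := hcon
  have r1 := lt_criticalValue hBν (fun b : Fin (B ν) => q ν b ω) hα0 ha₁.1 ha₁.2
    (fun ℓ => (c1 ℓ).le) c2 c3 ℓ
  have r2 := criticalValue_le hBν (fun b : Fin (B ν) => q ν b ω) hα0 hb0 hb1 hBγν d1 d2.le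
    (fun ℓ => (d3 ℓ).le) ℓ
  have hω' : η ≤ |criticalValue (fun b : Fin (B ν) => q ν b ω) α ℓ - c ℓ| := hω
  have : |criticalValue (fun b : Fin (B ν) => q ν b ω) α ℓ - c ℓ| ≤ η / 2 :=
    abs_le.2 ⟨by linarith [hloc ℓ], by linarith [hhic ℓ]⟩
  linarith

end IsRegularLimit

end QFMCT

end

noncomputable section

namespace QFMCT

/-! ### Quadratic forms in standard normal vectors -/

section GaussianForms

variable {p : Type*} [Fintype p]

/-- The law of a vector of independent standard normal variables. -/
def stdNormal (p : Type*) [Fintype p] : Measure (p → ℝ) := Measure.pi fun _ => gaussianReal 0 1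

instance : IsProbabilityMeasure (stdNormal p) := by
  unfold stdNormal; infer_instance

instance isOpenPosMeasure_gaussianReal : (gaussianReal 0 1).IsOpenPosMeasure :=
  (gaussianReal_absolutelyContinuous' 0 one_ne_zero).isOpenPosMeasure

instance : (stdNormal p).IsOpenPosMeasure := by
  unfold stdNormal; infer_instance

/-- A positive semidefinite matrix with zero trace is zero. -/
lemma exists_diag_pos_of_posSemidef {K : Matrix p p ℝ} (hK : K.PosSemidef) (hK0 : K ≠ 0) :
    ∃ j, 0 < K j j := by
  classical
  by_contra! hcon
  have h0 : ∀ j, K j j = 0 := fun j => le_antisymm (hcon j) hK.diag_nonneg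
  exact hK0 (hK.trace_eq_zero_iff.1 (by simp [Matrix.trace, h0]))

lemma measurable_form (K : Matrix p p ℝ) : Measurable fun g : p → ℝ => g ⬝ᵥ K *ᵥ g := by
  simp only [dotProduct, mulVec]
  fun_prop

lemma continuous_form (K : Matrix p p ℝ) : Continuous fun g : p → ℝ => g ⬝ᵥ K *ᵥ g := by
  simp only [dotProduct, mulVec]
  fun_prop

/-- Varying one coordinate alone gives a quadratic polynomial with leading coefficient `K j j`; this
is the fibre computation behind the absence of atoms. -/
lemma form_update_eq [DecidableEq p] (K : Matrix p p ℝ) (x : p → ℝ) (j : p) :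
    ∃ b c : ℝ, ∀ t : ℝ, Function.update x j t ⬝ᵥ K *ᵥ Function.update x j t =
      K j j * t ^ 2 + b * t + c := by
  set y : p → ℝ := Function.update x j 0
  have hy : ∀ t, Function.update x j t = y + t • Pi.single j 1 := fun t => by
    ext i
    by_cases hi : i = j
    · subst hi; simp [y]
    · simp [y, hi]
  refine ⟨y ⬝ᵥ K *ᵥ Pi.single j 1 + Pi.single j 1 ⬝ᵥ K *ᵥ y, y ⬝ᵥ K *ᵥ y, fun t => ?_⟩
  rw [hy]
  simp only [mulVec_add, mulVec_smul, dotProduct_add, add_dotProduct, smul_dotProduct,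
    dotProduct_smul, smul_eq_mul]
  have : Pi.single j 1 ⬝ᵥ K *ᵥ Pi.single j 1 = K j j := by simp
  rw [this]
  ring

/-- Integrate over coordinate `j` first: each fibre of the level set is the root set of a polynomial
of degree two, hence finite, and the one-dimensional normal law has no atoms. -/
lemma stdNormal_form_eq {K : Matrix p p ℝ} {j : p} (hj : 0 < K j j) (t : ℝ) :
    stdNormal p {g | g ⬝ᵥ K *ᵥ g = t} = 0 := by
  classical
  have hm : MeasurableSet {g : p → ℝ | g ⬝ᵥ K *ᵥ g = t} :=
    measurableSet_eq_fun (measurable_form K) measurable_const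
  rw [← lintegral_indicator_one hm, stdNormal, lintegral_eq_lmarginal_univ (0 : p → ℝ),
    lmarginal_erase' _ (measurable_one.indicator hm) (Finset.mem_univ j)]
  have : (fun x : p → ℝ => ∫⁻ s, {g : p → ℝ | g ⬝ᵥ K *ᵥ g = t}.indicator 1
      (Function.update x j s) ∂gaussianReal 0 1) = fun _ => (0 : ENNReal) := by
    ext x
    obtain ⟨b, c, h⟩ := form_update_eq K x j
    have hset : (fun s : ℝ => {g : p → ℝ | g ⬝ᵥ K *ᵥ g = t}.indicator (1 : (p → ℝ) → ENNReal)
        (Function.update x j s)) = {s | K j j * s ^ 2 + b * s + c = t}.indicator 1 := by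
      ext s
      by_cases hs : K j j * s ^ 2 + b * s + c = t <;> simp [h, hs]
    have hfin : {s : ℝ | K j j * s ^ 2 + b * s + c = t}.Finite := by
      set q : Polynomial ℝ := Polynomial.C (K j j) * Polynomial.X ^ 2 + Polynomial.C b *
        Polynomial.X + Polynomial.C (c - t)
      have hq : q ≠ 0 := fun hq => by
        have := Polynomial.natDegree_quadratic (R := ℝ) (a := K j j) (b := b) (c := c - t) hj.ne'
        change q.natDegree = 2 at this
        rw [hq] at this
        simp at this
      refine (Polynomial.finite_setOfPred_isRoot hq).subset fun s hs => ?_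
      have hs' : K j j * s ^ 2 + b * s + c = t := hs
      simp only [q, Polynomial.IsRoot.def, Set.mem_ofPred_eq, Polynomial.eval_add,
        Polynomial.eval_mul, Polynomial.eval_C, Polynomial.eval_pow, Polynomial.eval_X]
      linarith
    have := nullSingletonClass_gaussianReal (μ := 0) (v := 1) one_ne_zero
    rw [hset, lintegral_indicator_one hfin.measurableSet]
    exact hfin.measure_zero _
  rw [this]
  simp [lmarginal]

/-- Atoms are excluded by `stdNormal_form_eq`. For the charging condition, the event contains an
open set, which has positive normal mass as soon as it contains one point; such a point is found on
a ray. -/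
lemma isRegularLimit_form {L : ℕ} {K : Fin L → Matrix p p ℝ} (hK : ∀ ℓ, (K ℓ).PosSemidef)
    (hK0 : ∀ ℓ, K ℓ ≠ 0) : IsRegularLimit (stdNormal p) fun ℓ g => g ⬝ᵥ K ℓ *ᵥ g where
  measurable ℓ := measurable_form (K ℓ)
  nonneg ℓ g := by simpa using (hK ℓ).dotProduct_mulVec_nonneg g
  measure_eq ℓ t := by
    obtain ⟨j, hj⟩ := exists_diag_pos_of_posSemidef (hK ℓ) (hK0 ℓ)
    exact stdNormal_form_eq hj t
  measure_pos T hT u u' hu huu := by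
    classical
    have hnn : ∀ ℓ (g : p → ℝ), 0 ≤ g ⬝ᵥ K ℓ *ᵥ g := fun ℓ g => by
      simpa using (hK ℓ).dotProduct_mulVec_nonneg g
    set U : Set (p → ℝ) := {g | (∃ ℓ ∈ T, u ℓ < g ⬝ᵥ K ℓ *ᵥ g) ∧ ∀ ℓ ∈ T, g ⬝ᵥ K ℓ *ᵥ g < u' ℓ}
      with hU
    have hopen : IsOpen U := by
      have : U = (⋃ ℓ ∈ T, {g : p → ℝ | u ℓ < g ⬝ᵥ K ℓ *ᵥ g}) ∩
          ⋂ ℓ ∈ T, {g : p → ℝ | g ⬝ᵥ K ℓ *ᵥ g < u' ℓ} := by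
        ext g; simp [hU]
      rw [this]
      exact (isOpen_biUnion fun ℓ _ => isOpen_lt continuous_const (continuous_form _)).inter
        (isOpen_biInter_finset fun ℓ _ => isOpen_lt (continuous_form _) continuous_const)
    have hne : U.Nonempty := by
      obtain ⟨ℓ₀, hℓ₀⟩ := hT
      obtain ⟨j, hj⟩ := exists_diag_pos_of_posSemidef (hK ℓ₀) (hK0 ℓ₀)
      set z : p → ℝ := Pi.single j 1
      have hz0 : 0 < z ⬝ᵥ K ℓ₀ *ᵥ z := by simpa [z] using hj
      set T' := T.filter fun ℓ => 0 < z ⬝ᵥ K ℓ *ᵥ z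
      -- At `√s • z` every form equals `s` times its value at `z`. Take the index whose form first
      -- reaches its upper threshold as `s` grows, and stop where that form is midway between its
      -- two thresholds; all other forms are then still below theirs.
      obtain ⟨ℓ₁, hℓ₁, hmin⟩ := T'.exists_min_image (fun ℓ => u' ℓ / (z ⬝ᵥ K ℓ *ᵥ z))
        ⟨ℓ₀, Finset.mem_filter.2 ⟨hℓ₀, hz0⟩⟩
      obtain ⟨h1T, h1⟩ := Finset.mem_filter.1 hℓ₁
      set s : ℝ := (u ℓ₁ + u' ℓ₁) / 2 / (z ⬝ᵥ K ℓ₁ *ᵥ z)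
      have hs0 : 0 ≤ s := by
        have := hu ℓ₁; have := huu ℓ₁
        exact div_nonneg (by linarith) h1.le
      have hval : ∀ ℓ, (√s • z) ⬝ᵥ K ℓ *ᵥ (√s • z) = s * (z ⬝ᵥ K ℓ *ᵥ z) := fun ℓ => by
        rw [mulVec_smul, dotProduct_smul, smul_dotProduct, smul_eq_mul, smul_eq_mul, ← mul_assoc,
          Real.mul_self_sqrt hs0]
      have hs1 : s * (z ⬝ᵥ K ℓ₁ *ᵥ z) = (u ℓ₁ + u' ℓ₁) / 2 := div_mul_cancel₀ _ h1.ne'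
      have hs2 : s < u' ℓ₁ / (z ⬝ᵥ K ℓ₁ *ᵥ z) := by
        have := huu ℓ₁
        exact div_lt_div_of_pos_right (by linarith) h1
      refine ⟨√s • z, ⟨ℓ₁, h1T, ?_⟩, fun ℓ hℓ => ?_⟩
      · rw [hval, hs1]; linarith [huu ℓ₁]
      · rw [hval]
        rcases (hnn ℓ z).eq_or_lt with h | h
        · rw [← h, mul_zero]; exact (hu ℓ).trans_lt (huu ℓ)
        · rw [← lt_div_iff₀ h]
          exact hs2.trans_le (hmin ℓ (Finset.mem_filter.2 ⟨hℓ, h⟩))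
    refine (hopen.measure_pos (stdNormal p) hne).trans_le (measure_mono ?_)
    rintro g ⟨hg1, hg2⟩
    exact ⟨hg1, fun ℓ hℓ => (hg2 ℓ hℓ).le⟩

end GaussianForms

end QFMCT

end

noncomputable section

namespace QFMCT

/-! ### Characteristic functions of sums with dominated summands -/

section CharFun

lemma norm_prod_sub_prod_le {ι : Type*} (s : Finset ι) {z w : ι → ℂ} (hz : ∀ i, ‖z i‖ ≤ 1)
    (hw : ∀ i, ‖w i‖ ≤ 1) : ‖∏ i ∈ s, z i - ∏ i ∈ s, w i‖ ≤ ∑ i ∈ s, ‖z i - w i‖ := by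
  classical
  induction s using Finset.induction_on with
  | empty => simp
  | insert i s hi ih =>
    rw [Finset.prod_insert hi, Finset.prod_insert hi, Finset.sum_insert hi]
    have h1 : ‖∏ i ∈ s, w i‖ ≤ 1 := by
      rw [norm_prod]; exact Finset.prod_le_one (fun _ _ => norm_nonneg _) fun i _ => hw i
    calc ‖z i * ∏ i ∈ s, z i - w i * ∏ i ∈ s, w i‖
        = ‖(z i - w i) * ∏ i ∈ s, w i + z i * (∏ i ∈ s, z i - ∏ i ∈ s, w i)‖ := by ring_nf
      _ ≤ ‖z i - w i‖ * ‖∏ i ∈ s, w i‖ + ‖z i‖ * ‖∏ i ∈ s, z i - ∏ i ∈ s, w i‖ := by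
        refine (norm_add_le _ _).trans ?_
        rw [norm_mul, norm_mul]
      _ ≤ ‖z i - w i‖ * 1 + 1 * ∑ i ∈ s, ‖z i - w i‖ := by
        gcongr
        exact hz i
      _ = _ := by ring

/-- Taylor's bound is used for `|x| ≤ 1` and the triangle inequality beyond. The minimum with `x ^
2` keeps the error integrable when only second moments exist; the constant `4` is not sharp. -/
lemma norm_exp_mul_I_sub_le (x : ℝ) :
    ‖Complex.exp (x * Complex.I) - (1 + x * Complex.I - x ^ 2 / 2)‖ ≤
      4 * min (x ^ 2) (|x| ^ 3) := by
  rcases le_or_gt |x| 1 with hx | hx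
  · have h := Complex.exp_bound (x := x * Complex.I) (n := 3) (by simpa using hx) (by norm_num)
    have he : ∑ m ∈ Finset.range 3, ((x : ℂ) * Complex.I) ^ m / (m.factorial : ℂ) =
        1 + x * Complex.I - x ^ 2 / 2 := by
      simp [Finset.sum_range_succ, mul_pow]
      ring
    rw [he] at h
    have hmin : min (x ^ 2) (|x| ^ 3) = |x| ^ 3 := by
      rw [min_eq_right]
      rw [← sq_abs]
      exact pow_le_pow_of_le_one (abs_nonneg _) hx (by norm_num)
    rw [hmin]
    refine h.trans ?_
    have : ‖(x : ℂ) * Complex.I‖ = |x| := by simp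
    rw [this]
    have h3 : 0 ≤ |x| ^ 3 := by positivity
    norm_num [Nat.factorial]
    nlinarith
  · have hmin : min (x ^ 2) (|x| ^ 3) = x ^ 2 := by
      rw [min_eq_left]
      rw [← sq_abs]
      exact pow_le_pow_right₀ hx.le (by norm_num)
    rw [hmin]
    have h1 : ‖Complex.exp (x * Complex.I)‖ = 1 := Complex.norm_exp_ofReal_mul_I x
    have h2 : ‖(1 : ℂ) + x * Complex.I - x ^ 2 / 2‖ ≤ 1 + |x| + x ^ 2 / 2 := by
      refine (norm_sub_le _ _).trans (add_le_add ((norm_add_le _ _).trans ?_) ?_)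
      · simp
      · simp
    refine (norm_sub_le _ _).trans ?_
    rw [h1]
    have h3 : x ^ 2 = |x| ^ 2 := (sq_abs x).symm
    nlinarith

/-- The dominating function in the second order expansion of characteristic functions. -/
def truncSq (s x : ℝ) : ℝ := min (x ^ 2) (|s| * |x| ^ 3)

lemma truncSq_nonneg (s x : ℝ) : 0 ≤ truncSq s x := le_min (sq_nonneg _) (by positivity)

lemma truncSq_mono (s : ℝ) {x y : ℝ} (h : |x| ≤ |y|) : truncSq s x ≤ truncSq s y :=
  min_le_min (sq_le_sq.2 h) (by gcongr)

lemma measurable_truncSq (s : ℝ) : Measurable (truncSq s) := by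
  unfold truncSq; fun_prop

variable {Ω : Type*} [MeasurableSpace Ω] {P : Measure Ω}

lemma integrable_truncSq {U : Ω → ℝ} (hU2 : MemLp U 2 P) (s : ℝ) :
    Integrable (fun ω => truncSq s (U ω)) P := by
  refine hU2.integrable_sq.mono'
    ((measurable_truncSq s).comp_aemeasurable hU2.aestronglyMeasurable.aemeasurable).aestronglyMeasurable
    (Eventually.of_forall fun ω => ?_)
  rw [Real.norm_eq_abs, abs_of_nonneg (truncSq_nonneg _ _)]
  exact min_le_left _ _

/-- Dominated convergence with majorant `U ^ 2`. This plays the role of Lindeberg's condition. -/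
lemma tendsto_integral_truncSq {U : Ω → ℝ} (hU2 : MemLp U 2 P) {s : ℕ → ℝ}
    (hs : Tendsto s atTop (𝓝 0)) :
    Tendsto (fun ν => ∫ ω, truncSq (s ν) (U ω) ∂P) atTop (𝓝 0) := by
  have h := tendsto_integral_of_dominated_convergence (μ := P)
    (F := fun ν ω => truncSq (s ν) (U ω)) (f := fun _ => 0) (fun ω => U ω ^ 2)
    (fun ν => (integrable_truncSq hU2 (s ν)).aestronglyMeasurable) hU2.integrable_sq
    (fun ν => Eventually.of_forall fun ω => by
      rw [Real.norm_eq_abs, abs_of_nonneg (truncSq_nonneg _ _)]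
      exact min_le_left _ _)
    (Eventually.of_forall fun ω => by
      refine squeeze_zero (fun ν => truncSq_nonneg _ _) (fun ν => min_le_right _ _) ?_
      simpa using hs.abs.mul_const (|U ω| ^ 3))
  simpa using h

variable [IsProbabilityMeasure P]

/-- Integrating the pointwise expansion at `s * U`, the linear term drops out by centring, and the
error equals `s ^ 2` times `truncSq`: the factor `s ^ 2` is what the number of summands will
balance. -/
lemma norm_charFun_sub_le {U : Ω → ℝ} (hU2 : MemLp U 2 P) (h0 : ∫ ω, U ω ∂P = 0) (s : ℝ) :
    ‖charFun (P.map U) s - (1 - s ^ 2 * ((∫ ω, U ω ^ 2 ∂P : ℝ) : ℂ) / 2)‖ ≤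
      4 * s ^ 2 * ∫ ω, truncSq s (U ω) ∂P := by
  have hUm := hU2.aestronglyMeasurable.aemeasurable
  have hU1 : Integrable U P := hU2.integrable (by norm_num)
  have hexp : Integrable (fun ω => Complex.exp (((s * U ω : ℝ) : ℂ) * Complex.I)) P := by
    refine Integrable.of_bound (C := 1) ?_ (Eventually.of_forall fun ω => ?_)
    · exact Measurable.comp_aemeasurable (g := fun x : ℝ => Complex.exp (((s * x : ℝ) : ℂ) *
        Complex.I)) (by fun_prop) hUm |>.aestronglyMeasurable
    · rw [Complex.norm_exp_ofReal_mul_I]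
  have hlin : Integrable (fun ω => (1 : ℂ) + ((s * U ω : ℝ) : ℂ) * Complex.I -
      ((s * U ω : ℝ) : ℂ) ^ 2 / 2) P := by
    refine ((integrable_const _).add ((hU1.const_mul s).ofReal.mul_const _)).sub ?_
    have := ((hU2.integrable_sq.const_mul (s ^ 2)).ofReal (𝕜 := ℂ)).div_const 2
    refine this.congr (Eventually.of_forall fun ω => ?_)
    simp [mul_pow]
  have hi : ∫ ω, ((1 : ℂ) + ((s * U ω : ℝ) : ℂ) * Complex.I -
      ((s * U ω : ℝ) : ℂ) ^ 2 / 2) ∂P = 1 - s ^ 2 * ((∫ ω, U ω ^ 2 ∂P : ℝ) : ℂ) / 2 := by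
    have e1 : ∫ ω, ((s * U ω : ℝ) : ℂ) * Complex.I ∂P = 0 := by
      rw [integral_mul_const, integral_complex_ofReal, integral_const_mul, h0]
      simp
    have e2 : ∫ ω, ((s * U ω : ℝ) : ℂ) ^ 2 / 2 ∂P = s ^ 2 * ((∫ ω, U ω ^ 2 ∂P : ℝ) : ℂ) / 2 := by
      have : (fun ω => ((s * U ω : ℝ) : ℂ) ^ 2 / 2) = fun ω => (((s ^ 2 * U ω ^ 2 : ℝ)) : ℂ) / 2 := by
        ext ω; simp [mul_pow]
      rw [this, integral_div, integral_complex_ofReal, integral_const_mul]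
      simp
    have i2 : Integrable (fun ω => ((s * U ω : ℝ) : ℂ) ^ 2 / 2) P := by
      have := ((hU2.integrable_sq.const_mul (s ^ 2)).ofReal (𝕜 := ℂ)).div_const 2
      refine this.congr (Eventually.of_forall fun ω => ?_)
      simp [mul_pow]
    have i1 : Integrable (fun ω => ((s * U ω : ℝ) : ℂ) * Complex.I) P :=
      (hU1.const_mul s).ofReal.mul_const _
    have i3 : Integrable (fun ω => (1 : ℂ) + ((s * U ω : ℝ) : ℂ) * Complex.I) P :=
      (integrable_const _).add i1
    rw [integral_sub i3 i2, integral_add (integrable_const _) i1, e1, e2]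
    simp
  have hcf : charFun (P.map U) s = ∫ ω, Complex.exp (((s * U ω : ℝ) : ℂ) * Complex.I) ∂P := by
    rw [charFun_apply_real, integral_map hUm (by fun_prop)]
    simp
  rw [hcf, ← hi, ← integral_sub hexp hlin]
  refine (norm_integral_le_integral_norm _).trans ?_
  rw [← integral_const_mul]
  refine integral_mono (hexp.sub hlin).norm ((integrable_truncSq hU2 s).const_mul _) fun ω => ?_
  have h := norm_exp_mul_I_sub_le (s * U ω)
  refine h.trans (le_of_eq ?_)
  simp only [truncSq]
  rw [mul_assoc, mul_min_of_nonneg _ _ (sq_nonneg s), mul_pow, abs_mul, mul_pow]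
  congr 2
  rw [← sq_abs s]
  ring

/-- A central limit theorem for summands with common variance but possibly different laws: their
truncated second moments are dominated uniformly in `k` by finitely many fixed variables `W j`. Each
factor is compared with a normal one, and `m` errors of size `s ^ 2 * o(1)` add up to a null
sequence. -/
lemma tendsto_prod_charFun {ι : Type*} [Fintype ι] {U : ℕ → Ω → ℝ} {W : ι → Ω → ℝ} {v : ℝ}
    (hU2 : ∀ k, MemLp (U k) 2 P) (h0 : ∀ k, ∫ ω, U k ω ∂P = 0) (hv : ∀ k, ∫ ω, U k ω ^ 2 ∂P = v)
    (hW2 : ∀ j, MemLp (W j) 2 P)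
    (hUW : ∀ k s, ∫ ω, truncSq s (U k ω) ∂P ≤ ∑ j, ∫ ω, truncSq s (W j ω) ∂P)
    {m : ℕ → ℕ} {s : ℕ → ℝ} {τ : ℝ} (hs : Tendsto s atTop (𝓝 0))
    (hms : Tendsto (fun ν => (m ν : ℝ) * s ν ^ 2) atTop (𝓝 τ)) :
    Tendsto (fun ν => ∏ k ∈ Finset.range (m ν), charFun (P.map (U k)) (s ν)) atTop
      (𝓝 (Complex.exp (-(τ * v / 2 : ℝ)))) := by
  have hv0 : 0 ≤ v := by rw [← hv 0]; exact integral_nonneg fun ω => sq_nonneg _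
  set ρ : ℕ → ℝ := fun ν => ∑ j, ∫ ω, truncSq (s ν) (W j ω) ∂P
  have hρ : Tendsto ρ atTop (𝓝 0) := by
    simpa using tendsto_finsetSum Finset.univ fun j _ => tendsto_integral_truncSq (hW2 j) hs
  set w : ℕ → ℂ := fun ν => Complex.exp (-(s ν ^ 2 * v / 2 : ℝ))
  have hw1 : ∀ ν, ‖w ν‖ ≤ 1 := fun ν => by
    simp only [w]
    rw [← Complex.ofReal_neg, ← Complex.ofReal_exp, Complex.norm_real, Real.norm_eq_abs,
      Real.abs_exp, Real.exp_le_one_iff]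
    have : 0 ≤ s ν ^ 2 * v / 2 := by positivity
    linarith
  have hprod : ∀ ν, ∏ k ∈ Finset.range (m ν), w ν =
      Complex.exp (-((m ν : ℝ) * s ν ^ 2 * v / 2 : ℝ)) := fun ν => by
    rw [Finset.prod_const, Finset.card_range, ← Complex.exp_nat_mul]
    congr 1
    push_cast
    ring
  have hlim : Tendsto (fun ν => ∏ k ∈ Finset.range (m ν), w ν) atTop
      (𝓝 (Complex.exp (-(τ * v / 2 : ℝ)))) := by
    simp_rw [hprod]
    refine (Complex.continuous_exp.tendsto _).comp ?_
    exact ((Complex.continuous_ofReal.tendsto _).comp ((hms.mul_const v).div_const 2)).neg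
  -- The quadratic estimate for `exp x - 1 - x` requires `|x| ≤ 1`.
  have hsmall : ∀ᶠ ν in atTop, s ν ^ 2 * v / 2 ≤ 1 := by
    have : Tendsto (fun ν => s ν ^ 2 * v / 2) atTop (𝓝 0) := by
      simpa using ((hs.pow 2).mul_const v).div_const 2
    exact this.eventually (ge_mem_nhds zero_lt_one)
  have hbound : ∀ᶠ ν in atTop, ‖∏ k ∈ Finset.range (m ν), charFun (P.map (U k)) (s ν) -
      ∏ k ∈ Finset.range (m ν), w ν‖ ≤
      4 * ((m ν : ℝ) * s ν ^ 2) * ρ ν + (m ν : ℝ) * s ν ^ 2 * (s ν ^ 2 * v ^ 2 / 4) := by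
    filter_upwards [hsmall] with ν hν
    have hp : ∀ k, IsProbabilityMeasure (P.map (U k)) := fun k =>
      Measure.isProbabilityMeasure_map (hU2 k).aestronglyMeasurable.aemeasurable
    refine (norm_prod_sub_prod_le _ (fun k => norm_charFun_le_one _) fun _ => hw1 ν).trans ?_
    have hterm : ∀ k, ‖charFun (P.map (U k)) (s ν) - w ν‖ ≤
        4 * s ν ^ 2 * ρ ν + (s ν ^ 2 * v / 2) ^ 2 := fun k => by
      have h1 := norm_charFun_sub_le (hU2 k) (h0 k) (s ν)
      rw [hv k] at h1
      have h2 : ‖(1 - s ν ^ 2 * v / 2 : ℂ) - w ν‖ ≤ (s ν ^ 2 * v / 2) ^ 2 := by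
        have hx : 0 ≤ s ν ^ 2 * v / 2 := by positivity
        have h3 := Real.abs_exp_sub_one_sub_id_le (x := -(s ν ^ 2 * v / 2))
          (by rw [abs_neg, abs_of_nonneg hx]; exact hν)
        rw [neg_sq] at h3
        have h4 : (1 - s ν ^ 2 * v / 2 : ℂ) - w ν =
            ((-(Real.exp (-(s ν ^ 2 * v / 2)) - 1 - -(s ν ^ 2 * v / 2)) : ℝ) : ℂ) := by
          simp only [w]
          push_cast
          ring
        rw [h4, Complex.norm_real, Real.norm_eq_abs, abs_neg]
        exact h3
      calc _ ≤ _ := norm_sub_le_norm_sub_add_norm_sub _ (1 - s ν ^ 2 * v / 2 : ℂ) _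
        _ ≤ _ := add_le_add (h1.trans ?_) h2
      exact mul_le_mul_of_nonneg_left (hUW k (s ν)) (by positivity)
    refine (Finset.sum_le_sum fun k _ => hterm k).trans (le_of_eq ?_)
    rw [Finset.sum_const, Finset.card_range, nsmul_eq_mul]
    ring
  have hzero : Tendsto (fun ν => 4 * ((m ν : ℝ) * s ν ^ 2) * ρ ν +
      (m ν : ℝ) * s ν ^ 2 * (s ν ^ 2 * v ^ 2 / 4)) atTop (𝓝 0) := by
    have h := ((hms.const_mul 4).mul hρ).add
      (hms.mul (((hs.pow 2).mul_const (v ^ 2)).div_const 4))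
    simpa using h
  have hdiff := squeeze_zero_norm' hbound hzero
  simpa using hdiff.add hlim

end CharFun

end QFMCT

end

noncomputable section

namespace QFMCT

/-! ### Asymptotic normality of the group means -/

section CLT

/-- Moving `D` to the other side of the inner product reduces this to the standard normal
characteristic function at `Dᵀ *ᵥ t`. -/
lemma charFun_map_toLp_mulVec {p q : Type*} [Fintype p] [Fintype q] (D : Matrix q p ℝ)
    (t : EuclideanSpace ℝ q) :
    charFun ((stdNormal p).map fun g => (WithLp.toLp 2 (D *ᵥ g) : EuclideanSpace ℝ q)) t =
      Complex.exp (-(t.ofLp ⬝ᵥ (D * Dᵀ) *ᵥ t.ofLp / 2 : ℝ)) := by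
  have hm : Measurable fun g : p → ℝ => (WithLp.toLp 2 (D *ᵥ g) : EuclideanSpace ℝ q) := by
    refine (WithLp.measurable_toLp 2 _).comp ?_
    exact (Continuous.matrix_mulVec continuous_const continuous_id).measurable
  have h := charFun_stdGaussian (E := EuclideanSpace ℝ p) (WithLp.toLp 2 (Dᵀ *ᵥ t.ofLp))
  rw [← map_pi_eq_stdGaussian, charFun_apply, integral_map (by fun_prop) (by fun_prop)] at h
  rw [charFun_apply, integral_map hm.aemeasurable (by fun_prop)]
  have hin : ∀ g : p → ℝ, inner ℝ (WithLp.toLp 2 (D *ᵥ g) : EuclideanSpace ℝ q) t =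
      inner ℝ (WithLp.toLp 2 g : EuclideanSpace ℝ p) (WithLp.toLp 2 (Dᵀ *ᵥ t.ofLp)) := fun g => by
    simp only [EuclideanSpace.inner_eq_star_dotProduct, star_trivial]
    rw [dotProduct_mulVec, mulVec_transpose]
  simp_rw [hin]
  rw [stdNormal, h, ← Complex.ofReal_pow, EuclideanSpace.real_norm_sq_eq]
  congr 1
  have : ∑ i, (WithLp.toLp 2 (Dᵀ *ᵥ t.ofLp) : EuclideanSpace ℝ p) i ^ 2 =
      t.ofLp ⬝ᵥ (D * Dᵀ) *ᵥ t.ofLp := by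
    rw [← mulVec_mulVec, dotProduct_mulVec, ← mulVec_transpose]
    simp [dotProduct, sq]
  rw [this]
  push_cast
  ring

lemma sqrt_smul_pooledMean_sub_eq {Ω : Type*} {a d : ℕ}
    {ε : Fin a → ℕ → Ω → EuclideanSpace ℝ (Fin d)} (μ : Fin a → EuclideanSpace ℝ (Fin d)) {n : Fin a → ℕ}
    {i : Fin a} (hn : n i ≠ 0) (ω : Ω) (j : Fin d) (N : ℝ) :
    (N • (pooledMean (observations μ ε n ω) - stack μ)) (i, j) =
      ∑ k : Fin (n i), N / n i * ε i k ω j := by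
  have hn' : (n i : ℝ) ≠ 0 := by exact_mod_cast hn
  simp only [Pi.smul_apply, Pi.sub_apply, pooledMean, stack, observations, smul_eq_mul,
    PiLp.add_apply, Finset.sum_add_distrib, Finset.sum_const, Finset.card_univ, Fintype.card_fin,
    nsmul_eq_mul]
  rw [← Finset.mul_sum]
  field_simp
  ring

variable {Ω : Type*} [MeasurableSpace Ω] {P : Measure Ω} {a d : ℕ}
  {ε : Fin a → ℕ → Ω → EuclideanSpace ℝ (Fin d)} {Sig : Fin a → Matrix (Fin d) (Fin d) ℝ}

lemma IsErrorModel.integrable_mul (hε : IsErrorModel P ε Sig) (i : Fin a) (k : ℕ) (j j' : Fin d) :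
    Integrable (fun ω => ε i k ω j * ε i k ω j') P :=
  (hε.memLp i k j).integrable_mul (hε.memLp i k j')

lemma IsErrorModel.memLp_sum (hε : IsErrorModel P ε Sig) (i : Fin a) (k : ℕ) (t : Fin d → ℝ) :
    MemLp (fun ω => ∑ j, t j * ε i k ω j) 2 P :=
  memLp_finsetSum _ fun j _ => (hε.memLp i k j).const_mul (t j)

lemma measurable_coord (hε : IsErrorModel P ε Sig) (i : Fin a) (k : ℕ) (j : Fin d) :
    Measurable fun ω => ε i k ω j :=
  (measurable_pi_apply j).comp ((WithLp.measurable_ofLp 2 _).comp (hε.measurable i k))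

lemma measurable_observations (hε : IsErrorModel P ε Sig) (μ : Fin a → EuclideanSpace ℝ (Fin d))
    (n : Fin a → ℕ) : Measurable (observations μ ε n) :=
  measurable_pi_lambda _ fun i => measurable_pi_lambda _ fun k =>
    (hε.measurable i k).const_add (μ i)

lemma measurable_pooledMean {n : Fin a → ℕ} :
    Measurable (pooledMean : Sample d n → Fin a × Fin d → ℝ) := by
  refine measurable_pi_lambda _ fun q => ?_
  unfold pooledMean
  refine (Finset.measurable_sum _ fun k _ => ?_).div_const _
  fun_prop

/-- A linear form is at most the sum of its absolute coefficients times the largest coordinate.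
Linear forms of the errors may change law with the subject while single coordinates do not, so the
domination has to be expressed through coordinates. -/
lemma truncSq_sum_le {d : ℕ} (s : ℝ) (t x : Fin d → ℝ) :
    truncSq s (∑ j, t j * x j) ≤ ∑ j, truncSq s ((∑ j', |t j'|) * x j) := by
  rcases isEmpty_or_nonempty (Fin d) with h | h
  · simp [truncSq]
  · obtain ⟨j₀, hj₀⟩ := Finite.exists_max fun j => |x j|
    have h1 : |∑ j, t j * x j| ≤ |(∑ j', |t j'|) * x j₀| := by
      rw [abs_mul, abs_of_nonneg (Finset.sum_nonneg fun j _ => abs_nonneg (t j)), Finset.sum_mul]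
      refine (Finset.abs_sum_le_sum_abs _ _).trans (Finset.sum_le_sum fun j _ => ?_)
      rw [abs_mul]
      exact mul_le_mul_of_nonneg_left (hj₀ j) (abs_nonneg _)
    exact (truncSq_mono s h1).trans (Finset.single_le_sum
      (f := fun j => truncSq s ((∑ j', |t j'|) * x j)) (fun j _ => truncSq_nonneg _ _)
      (Finset.mem_univ j₀))

lemma IsErrorModel.integral_truncSq_le (hε : IsErrorModel P ε Sig) (i : Fin a) (k : ℕ)
    (t : Fin d → ℝ) (s : ℝ) :
    ∫ ω, truncSq s (∑ j, t j * ε i k ω j) ∂P ≤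
      ∑ j, ∫ ω, truncSq s ((∑ j', |t j'|) * ε i 0 ω j) ∂P := by
  have hid : ∀ j, ∫ ω, truncSq s ((∑ j', |t j'|) * ε i 0 ω j) ∂P =
      ∫ ω, truncSq s ((∑ j', |t j'|) * ε i k ω j) ∂P := fun j =>
    ((hε.identDistrib i j 0 k).comp (u := fun x => truncSq s ((∑ j', |t j'|) * x))
      ((measurable_truncSq s).comp (measurable_const_mul _))).integral_eq
  have hint : ∀ j, Integrable (fun ω => truncSq s ((∑ j', |t j'|) * ε i k ω j)) P := fun j =>
    integrable_truncSq ((hε.memLp i k j).const_mul _) s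
  simp_rw [hid]
  rw [← integral_finsetSum _ fun j _ => hint j]
  exact integral_mono (integrable_truncSq (hε.memLp_sum i k t) s)
    (integrable_finsetSum _ fun j _ => hint j) fun ω => truncSq_sum_le s t _

/-- The standardized group means of the data. -/
def scaledMean (μ : Fin a → EuclideanSpace ℝ (Fin d)) (ε : Fin a → ℕ → Ω → EuclideanSpace ℝ (Fin d))
    (n : Fin a → ℕ) (ω : Ω) : Fin a × Fin d → ℝ :=
  √(totalSize n : ℝ) • (pooledMean (observations μ ε n ω) - stack μ)

lemma measurable_scaledMean (hε : IsErrorModel P ε Sig) (μ : Fin a → EuclideanSpace ℝ (Fin d))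
    (n : Fin a → ℕ) : Measurable (scaledMean μ ε n) :=
  ((measurable_pooledMean.comp (measurable_observations hε μ n)).sub_const (stack μ)).const_smul
    (√(totalSize n : ℝ))

/-- Projecting on `t` yields a sum, over all subjects of all groups, of independent real variables,
and the characteristic function factorizes. -/
lemma charFun_scaledMean (hε : IsErrorModel P ε Sig) (μ : Fin a → EuclideanSpace ℝ (Fin d))
    {n : Fin a → ℕ} (hn : ∀ i, n i ≠ 0) (t : EuclideanSpace ℝ (Fin a × Fin d)) :
    charFun (P.map fun ω => (WithLp.toLp 2 (scaledMean μ ε n ω) :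
      EuclideanSpace ℝ (Fin a × Fin d))) t =
    ∏ i, ∏ k ∈ Finset.range (n i), charFun (P.map fun ω => ∑ j, t (i, j) * ε i k ω j)
      (√(totalSize n : ℝ) / n i) := by
  set U : (Σ i, Fin (n i)) → Ω → ℝ := fun q ω => ∑ j, t (q.1, j) * ε q.1 q.2 ω j
  have hUm : ∀ q, Measurable (U q) := fun q =>
    Finset.measurable_sum _ fun j _ => (measurable_coord hε q.1 q.2 j).const_mul _
  set V : (Σ i, Fin (n i)) → Ω → ℝ := fun q ω => √(totalSize n : ℝ) / n q.1 * U q ω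
  have hVm : ∀ q, Measurable (V q) := fun q => (hUm q).const_mul _
  have hVind : iIndepFun V P := by
    have hinj : Function.Injective fun q : (Σ i, Fin (n i)) => ((q.1, (q.2 : ℕ)) : Fin a × ℕ) := by
      rintro ⟨i, k⟩ ⟨i', k'⟩ h
      simp only [Prod.mk.injEq] at h
      obtain ⟨rfl, h⟩ := h
      exact congrArg _ (Fin.ext h)
    refine (hε.indep.precomp hinj).comp
      (fun q (x : EuclideanSpace ℝ (Fin d)) => √(totalSize n : ℝ) / n q.1 * ∑ j, t (q.1, j) * x j)
      fun q => ?_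
    fun_prop
  have h1 : charFun (P.map fun ω => (WithLp.toLp 2 (scaledMean μ ε n ω) :
      EuclideanSpace ℝ (Fin a × Fin d))) t = charFun (P.map fun ω => ∑ q, V q ω) 1 := by
    have hm := measurable_scaledMean hε μ n
    rw [charFun_apply, charFun_apply_real, integral_map (by fun_prop) (by fun_prop),
      integral_map (Finset.measurable_sum _ fun q _ => hVm q).aemeasurable (by fun_prop)]
    congr 1
    ext ω
    congr 2
    simp only [EuclideanSpace.inner_eq_star_dotProduct, star_trivial, Complex.ofReal_one, one_mul]
    congr 1
    simp only [dotProduct, Fintype.sum_prod_type, Fintype.sum_sigma]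
    refine Finset.sum_congr rfl fun i _ => ?_
    simp only [scaledMean, sqrt_smul_pooledMean_sub_eq μ (hn i), V, U, Finset.mul_sum]
    rw [Finset.sum_comm]
    refine Finset.sum_congr rfl fun j _ => Finset.sum_congr rfl fun k _ => by ring
  rw [h1, hVind.charFun_map_fun_sum_eq_prod fun q => (hVm q).aemeasurable, Finset.prod_apply,
    Fintype.prod_sigma]
  refine Finset.prod_congr rfl fun i _ => ?_
  rw [← Fin.prod_univ_eq_prod_range fun k => charFun (P.map fun ω => ∑ j, t (i, j) * ε i k ω j)
      (√(totalSize n : ℝ) / n i)]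
  refine Finset.prod_congr rfl fun k _ => ?_
  simp only [V]
  rw [charFun_map_mul_comp (hUm ⟨i, k⟩).aemeasurable, mul_one]

variable [IsProbabilityMeasure P]

lemma IsErrorModel.integral_mul (hε : IsErrorModel P ε Sig) (i : Fin a) (k : ℕ) (j j' : Fin d) :
    ∫ ω, ε i k ω j * ε i k ω j' ∂P = Sig i j j' := by
  rw [← hε.cov_eq i k j j', covariance_eq_sub (hε.memLp i k j) (hε.memLp i k j'),
    hε.mean_zero, hε.mean_zero]
  simp

lemma IsErrorModel.integral_sq_sum (hε : IsErrorModel P ε Sig) (i : Fin a) (k : ℕ)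
    (t : Fin d → ℝ) :
    ∫ ω, (∑ j, t j * ε i k ω j) ^ 2 ∂P = t ⬝ᵥ Sig i *ᵥ t := by
  have : ∀ ω, (∑ j, t j * ε i k ω j) ^ 2 =
      ∑ j, ∑ j', t j * t j' * (ε i k ω j * ε i k ω j') := fun ω => by
    rw [sq, Finset.sum_mul_sum]
    refine Finset.sum_congr rfl fun j _ => Finset.sum_congr rfl fun j' _ => by ring
  simp_rw [this]
  rw [integral_finsetSum _ fun j _ => integrable_finsetSum _ fun j' _ =>
    (hε.integrable_mul i k j j').const_mul _]
  simp only [dotProduct, mulVec, Finset.mul_sum]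
  refine Finset.sum_congr rfl fun j _ => ?_
  rw [integral_finsetSum _ fun j' _ => (hε.integrable_mul i k j j').const_mul _]
  refine Finset.sum_congr rfl fun j' _ => ?_
  rw [integral_const_mul, hε.integral_mul]
  ring

lemma IsErrorModel.posSemidef (hε : IsErrorModel P ε Sig) (i : Fin a) : (Sig i).PosSemidef := by
  refine PosSemidef.of_dotProduct_mulVec_nonneg ?_ fun t => ?_
  · ext j j'
    simp only [conjTranspose_apply, star_trivial]
    rw [← hε.integral_mul i 0, ← hε.integral_mul i 0]
    simp_rw [mul_comm]
  · rw [star_trivial, ← hε.integral_sq_sum i 0 t]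
    exact integral_nonneg fun ω => sq_nonneg _

lemma IsErrorModel.integral_sum (hε : IsErrorModel P ε Sig) (i : Fin a) (k : ℕ) (t : Fin d → ℝ) :
    ∫ ω, ∑ j, t j * ε i k ω j ∂P = 0 := by
  rw [integral_finsetSum _ fun j _ => ((hε.memLp i k j).integrable (by norm_num)).const_mul _]
  simp [integral_const_mul, hε.mean_zero]

/-- Group sizes proportional to the total sample size. -/
structure IsProportionalDesign (n : ℕ → Fin a → ℕ) (κ : Fin a → ℝ) : Prop where
  totalSize_tendsto : Tendsto (fun ν => totalSize (n ν)) atTop atTop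
  pos : ∀ i, 0 < κ i
  ratio_tendsto : ∀ i, Tendsto (fun ν => (n ν i : ℝ) / (totalSize (n ν) : ℝ)) atTop (𝓝 (κ i))

namespace IsProportionalDesign

variable {n : ℕ → Fin a → ℕ} {κ : Fin a → ℝ}

lemma size_tendsto (h : IsProportionalDesign n κ) (i : Fin a) :
    Tendsto (fun ν => n ν i) atTop atTop := by
  have h1 : Tendsto (fun ν => (totalSize (n ν) : ℝ)) atTop atTop :=
    tendsto_natCast_atTop_atTop.comp h.totalSize_tendsto
  have h2 := (h.ratio_tendsto i).pos_mul_atTop (h.pos i) h1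
  have h3 : Tendsto (fun ν => (n ν i : ℝ)) atTop atTop := by
    refine h2.congr' ((h1.eventually_gt_atTop 0).mono fun ν hν => ?_)
    exact div_mul_cancel₀ _ hν.ne'
  exact tendsto_natCast_atTop_iff.1 h3

lemma eventually_ne_zero (h : IsProportionalDesign n κ) : ∀ᶠ ν in atTop, ∀ i, n ν i ≠ 0 :=
  eventually_all.2 fun i => ((h.size_tendsto i).eventually_gt_atTop 0).mono fun _ hν => hν.ne'

lemma inv_ratio_tendsto (h : IsProportionalDesign n κ) (i : Fin a) :
    Tendsto (fun ν => (totalSize (n ν) : ℝ) / (n ν i : ℝ)) atTop (𝓝 (κ i)⁻¹) := by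
  refine ((h.ratio_tendsto i).inv₀ (h.pos i).ne').congr fun ν => ?_
  rw [inv_div]

lemma scale_tendsto (h : IsProportionalDesign n κ) (i : Fin a) :
    Tendsto (fun ν => √(totalSize (n ν) : ℝ) / (n ν i : ℝ)) atTop (𝓝 0) := by
  have h1 : Tendsto (fun ν => (n ν i : ℝ)) atTop atTop :=
    tendsto_natCast_atTop_atTop.comp (h.size_tendsto i)
  have h2 := ((h.inv_ratio_tendsto i).mul (tendsto_inv_atTop_zero.comp h1)).sqrt
  rw [mul_zero, Real.sqrt_zero] at h2
  refine h2.congr fun ν => ?_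
  simp only [Function.comp_apply]
  rw [← div_eq_mul_inv, div_div, Real.sqrt_div (Nat.cast_nonneg _),
    Real.sqrt_mul_self (Nat.cast_nonneg _)]

lemma size_mul_scale_sq (h : IsProportionalDesign n κ) (i : Fin a) :
    Tendsto (fun ν => (n ν i : ℝ) * (√(totalSize (n ν) : ℝ) / (n ν i : ℝ)) ^ 2) atTop
      (𝓝 (κ i)⁻¹) := by
  refine (h.inv_ratio_tendsto i).congr' (h.eventually_ne_zero.mono fun ν hν => ?_)
  have : (n ν i : ℝ) ≠ 0 := by exact_mod_cast hν i
  simp only [div_pow, Real.sq_sqrt (Nat.cast_nonneg _)]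
  field_simp

end IsProportionalDesign

lemma dotProduct_limitCov_mulVec (κ : Fin a → ℝ) (t : Fin a × Fin d → ℝ) :
    t ⬝ᵥ limitCov κ Sig *ᵥ t =
      ∑ i, (κ i)⁻¹ * ((fun j => t (i, j)) ⬝ᵥ Sig i *ᵥ fun j => t (i, j)) := by
  simp only [limitCov, directSum, dotProduct, mulVec, Fintype.sum_prod_type, of_apply,
    Matrix.smul_apply, smul_eq_mul, ite_mul, zero_mul]
  refine Finset.sum_congr rfl fun i _ => ?_
  rw [Finset.mul_sum]
  refine Finset.sum_congr rfl fun j _ => ?_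
  rw [Finset.sum_eq_single i]
  · simp only [if_true, Finset.mul_sum]
    refine Finset.sum_congr rfl fun j' _ => by ring
  · intro i' _ hi'
    simp [hi'.symm]
  · simp

/-- Multivariate central limit theorem for the group means. -/
lemma tendstoInDistribution_scaledMean (hε : IsErrorModel P ε Sig)
    (μ : Fin a → EuclideanSpace ℝ (Fin d)) {n : ℕ → Fin a → ℕ} {κ : Fin a → ℝ}
    (hn : IsProportionalDesign n κ) {D : Matrix (Fin a × Fin d) (Fin a × Fin d) ℝ}
    (hD : D * Dᵀ = limitCov κ Sig) :
    TendstoInDistribution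
      (fun ν ω => (WithLp.toLp 2 (scaledMean μ ε (n ν) ω) : EuclideanSpace ℝ (Fin a × Fin d))) atTop
      (fun g => (WithLp.toLp 2 (D *ᵥ g) : EuclideanSpace ℝ (Fin a × Fin d))) (fun _ => P)
      (stdNormal (Fin a × Fin d)) := by
  have hmD : Measurable fun g : Fin a × Fin d → ℝ =>
      (WithLp.toLp 2 (D *ᵥ g) : EuclideanSpace ℝ (Fin a × Fin d)) := by
    refine (WithLp.measurable_toLp 2 _).comp ?_
    exact (Continuous.matrix_mulVec continuous_const continuous_id).measurable
  refine ⟨fun ν => ((WithLp.measurable_toLp 2 _).comp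
    (measurable_scaledMean hε μ (n ν))).aemeasurable, hmD.aemeasurable, ?_⟩
  -- Lévy's continuity theorem; the limit factorizes over the groups because the limit covariance
  -- matrix is block diagonal.
  refine (ProbabilityMeasure.tendsto_iff_tendsto_charFun (E := EuclideanSpace ℝ (Fin a × Fin d))).2
    fun t => ?_
  simp only [ProbabilityMeasure.coe_mk]
  rw [charFun_map_toLp_mulVec, hD, dotProduct_limitCov_mulVec]
  have hlim : Tendsto (fun ν => ∏ i, ∏ k ∈ Finset.range (n ν i),
      charFun (P.map fun ω => ∑ j, t (i, j) * ε i k ω j)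
      (√(totalSize (n ν) : ℝ) / n ν i)) atTop (𝓝 (∏ i, Complex.exp (-((κ i)⁻¹ *
        ((fun j => t (i, j)) ⬝ᵥ Sig i *ᵥ fun j => t (i, j)) / 2 : ℝ)))) := by
    refine tendsto_finsetProd _ fun i _ => ?_
    exact tendsto_prod_charFun (U := fun k ω => ∑ j, t (i, j) * ε i k ω j)
      (W := fun j ω => (∑ j', |t (i, j')|) * ε i 0 ω j)
      (fun k => hε.memLp_sum i k _) (fun k => hε.integral_sum i k _)
      (fun k => hε.integral_sq_sum i k _) (fun j => (hε.memLp i 0 j).const_mul _)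
      (fun k s => hε.integral_truncSq_le i k (fun j => t (i, j)) s) (hn.scale_tendsto i)
      (hn.size_mul_scale_sq i)
  rw [← Complex.exp_sum] at hlim
  have he : ∑ i, (-((κ i)⁻¹ * ((fun j => t (i, j)) ⬝ᵥ Sig i *ᵥ fun j => t (i, j)) / 2 : ℝ) : ℂ) =
      (-((∑ i, (κ i)⁻¹ * ((fun j => t (i, j)) ⬝ᵥ Sig i *ᵥ fun j => t (i, j))) / 2 : ℝ) : ℂ) := by
    rw [Finset.sum_div, Complex.ofReal_sum, Finset.sum_neg_distrib]
  rw [he] at hlim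
  refine hlim.congr' (hn.eventually_ne_zero.mono fun ν hν => ?_)
  exact (charFun_scaledMean hε μ hν t).symm

end CLT

end QFMCT

end

noncomputable section

namespace QFMCT

/-! ### A weak law of large numbers under dominated tails -/

section WeakLaw

/-- The part of `|x|` above the level `K`. -/
def tailPart (K x : ℝ) : ℝ := if K < |x| then |x| else 0

/-- The truncation of `x` at the level `K`. -/
def truncPart (K x : ℝ) : ℝ := if K < |x| then 0 else x

lemma abs_sub_truncPart (K x : ℝ) : |x - truncPart K x| = tailPart K x := by
  unfold truncPart tailPart; split_ifs <;> simp

lemma tailPart_nonneg (K x : ℝ) : 0 ≤ tailPart K x := by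
  unfold tailPart; split_ifs <;> simp

lemma tailPart_le (K x : ℝ) : tailPart K x ≤ |x| := by
  unfold tailPart; split_ifs <;> simp

lemma tailPart_mono (K : ℝ) {x y : ℝ} (h : |x| ≤ |y|) : tailPart K x ≤ tailPart K y := by
  unfold tailPart
  split_ifs with h1 h2 h2
  · exact h
  · exact absurd (h1.trans_le h) h2
  · exact abs_nonneg _
  · exact le_rfl

lemma abs_truncPart_le {K : ℝ} (hK : 0 ≤ K) (x : ℝ) : |truncPart K x| ≤ K := by
  unfold truncPart; split_ifs with h
  · simpa using hK
  · exact not_lt.1 h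

lemma measurable_tailPart (K : ℝ) : Measurable (tailPart K) :=
  Measurable.ite (measurableSet_lt measurable_const measurable_id.abs) measurable_id.abs
    measurable_const

lemma measurable_truncPart (K : ℝ) : Measurable (truncPart K) :=
  Measurable.ite (measurableSet_lt measurable_const measurable_id.abs) measurable_const
    measurable_id

/-- Since `|x * y|` is at most the larger square, tails of products are controlled by tails of
squares of single coordinates, whose laws do not depend on the subject. -/
lemma tailPart_mul_le (K x y : ℝ) : tailPart K (x * y) ≤ tailPart K (x ^ 2) + tailPart K (y ^ 2) := by
  rcases le_total |x| |y| with h | h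
  · have h1 : |x * y| ≤ |y ^ 2| := by
      rw [abs_mul, abs_pow, sq]; gcongr
    linarith [tailPart_mono K h1, tailPart_nonneg K (x ^ 2)]
  · have h1 : |x * y| ≤ |x ^ 2| := by
      rw [abs_mul, abs_pow, sq]; gcongr
    linarith [tailPart_mono K h1, tailPart_nonneg K (y ^ 2)]

variable {Ω : Type*} [MeasurableSpace Ω] {P : Measure Ω}

lemma integrable_tailPart {f : Ω → ℝ} (hf : Integrable f P) (K : ℝ) :
    Integrable (fun ω => tailPart K (f ω)) P := by
  refine hf.abs.mono' ((measurable_tailPart K).comp_aemeasurable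
    hf.aestronglyMeasurable.aemeasurable).aestronglyMeasurable (Eventually.of_forall fun ω => ?_)
  rw [Real.norm_eq_abs, abs_of_nonneg (tailPart_nonneg _ _)]
  exact tailPart_le _ _

lemma tendsto_integral_tailPart {f : Ω → ℝ} (hf : Integrable f P) :
    Tendsto (fun K : ℕ => ∫ ω, tailPart K (f ω) ∂P) atTop (𝓝 0) := by
  have h := tendsto_integral_of_dominated_convergence (μ := P)
    (F := fun (K : ℕ) ω => tailPart K (f ω)) (f := fun _ => 0) (fun ω => |f ω|)
    (fun K => (integrable_tailPart hf K).aestronglyMeasurable) hf.abs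
    (fun K => Eventually.of_forall fun ω => by
      rw [Real.norm_eq_abs, abs_of_nonneg (tailPart_nonneg _ _)]
      exact tailPart_le _ _)
    (Eventually.of_forall fun ω => by
      refine tendsto_const_nhds.congr' ?_
      filter_upwards [(tendsto_natCast_atTop_atTop (R := ℝ)).eventually_ge_atTop |f ω|] with K hK
      rw [tailPart, if_neg (not_lt.2 hK)])
  simpa using h

variable [IsProbabilityMeasure P]

/-- Truncation at `K`: Chebyshev's inequality handles the truncated average and Markov's inequality
the discarded part. The deviation `δ` is split into `δ / 2` for the first, `δ / 4` for the second
and `δ / 4` for the bias of truncation. -/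
lemma measure_abs_average_sub_le {Y : ℕ → Ω → ℝ} {m : ℝ} (hYm : ∀ k, Measurable (Y k))
    (hi : ∀ k, Integrable (Y k) P) (hm : ∀ k, ∫ ω, Y k ω ∂P = m)
    (hind : Pairwise fun k k' => IndepFun (Y k) (Y k') P) {K η δ : ℝ} (hK : 0 ≤ K)
    (hη : ∀ k, ∫ ω, tailPart K (Y k ω) ∂P ≤ η) (hδ : 0 < δ) (hηδ : η ≤ δ / 4) {n : ℕ}
    (hn : 0 < n) :
    P {ω | δ ≤ |(∑ k ∈ Finset.range n, Y k ω) / n - m|} ≤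
      ENNReal.ofReal (4 * K ^ 2 / (n * δ ^ 2)) + ENNReal.ofReal (4 * η / δ) := by
  have hn' : (0 : ℝ) < n := by exact_mod_cast hn
  set T : ℕ → Ω → ℝ := fun k ω => truncPart K (Y k ω)
  have hTm : ∀ k, Measurable (T k) := fun k => (measurable_truncPart K).comp (hYm k)
  have hT2 : ∀ k, MemLp (T k) 2 P := fun k =>
    MemLp.of_bound (hTm k).aestronglyMeasurable K
      (Eventually.of_forall fun ω => abs_truncPart_le hK _)
  have hTi : ∀ k, Integrable (T k) P := fun k => (hT2 k).integrable (by norm_num)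
  have hSm : MemLp (∑ k ∈ Finset.range n, T k) 2 P := memLp_finsetSum' _ fun k _ => hT2 k
  have hE : ∫ ω, (∑ k ∈ Finset.range n, T k) ω ∂P = ∑ k ∈ Finset.range n, ∫ ω, T k ω ∂P := by
    simp only [Finset.sum_apply]
    rw [integral_finsetSum _ fun k _ => hTi k]
  have hEm : |∫ ω, (∑ k ∈ Finset.range n, T k) ω ∂P - n * m| ≤ n * η := by
    have : (n : ℝ) * m = ∑ k ∈ Finset.range n, m := by simp
    rw [hE, this, ← Finset.sum_sub_distrib]
    refine (Finset.abs_sum_le_sum_abs _ _).trans ?_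
    have h1 : ∀ k ∈ Finset.range n, |∫ ω, T k ω ∂P - m| ≤ η := fun k _ => by
      rw [← hm k, ← integral_sub (hTi k) (hi k)]
      refine (abs_integral_le_integral_abs).trans (le_trans (le_of_eq ?_) (hη k))
      congr 1
      ext ω
      rw [abs_sub_comm, abs_sub_truncPart]
    refine (Finset.sum_le_sum h1).trans (by simp)
  have hV : Var[∑ k ∈ Finset.range n, T k; P] ≤ n * K ^ 2 := by
    have hindT : Pairwise fun k k' => IndepFun (T k) (T k') P := fun k k' h =>
      (hind h).comp (measurable_truncPart K) (measurable_truncPart K)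
    rw [IndepFun.variance_sum (fun k _ => hT2 k) (fun k _ k' _ h => hindT h)]
    calc ∑ k ∈ Finset.range n, Var[T k; P] ≤ ∑ k ∈ Finset.range n, K ^ 2 := by
          refine Finset.sum_le_sum fun k _ => ?_
          refine (variance_le_expectation_sq (hTm k).aestronglyMeasurable).trans ?_
          have : ∫ ω, (T k ^ 2) ω ∂P ≤ ∫ ω, K ^ 2 ∂P :=
            integral_mono (hT2 k).integrable_sq (integrable_const _) fun ω => by
              simp only [Pi.pow_apply]
              exact sq_le_sq' (abs_le.1 (abs_truncPart_le hK _)).1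
                (abs_le.1 (abs_truncPart_le hK _)).2
          simpa using this
      _ = n * K ^ 2 := by simp
  have hch := meas_ge_le_variance_div_sq hSm (c := n * (δ / 2)) (by positivity)
  set Z : Ω → ℝ := fun ω => ∑ k ∈ Finset.range n, tailPart K (Y k ω)
  have hZi : Integrable Z P := integrable_finsetSum _ fun k _ => integrable_tailPart (hi k) K
  have hZE : ∫ ω, Z ω ∂P ≤ n * η := by
    rw [integral_finsetSum _ fun k _ => integrable_tailPart (hi k) K]
    exact (Finset.sum_le_sum fun k _ => hη k).trans (by simp)
  have hmk : P {ω | n * (δ / 4) ≤ Z ω} ≤ ENNReal.ofReal (4 * η / δ) := by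
    have h1 := mul_meas_ge_le_integral_of_nonneg (μ := P)
      (Eventually.of_forall fun ω => Finset.sum_nonneg fun k _ => tailPart_nonneg K (Y k ω)) hZi
      (n * (δ / 4))
    rw [← ofReal_measureReal]
    refine ENNReal.ofReal_le_ofReal ?_
    rw [le_div_iff₀ hδ]
    have h2 : (n : ℝ) * (P.real {ω | n * (δ / 4) ≤ Z ω} * δ) ≤ n * (4 * η) := by
      linarith [h1.trans hZE]
    exact le_of_mul_le_mul_left h2 hn'
  calc P {ω | δ ≤ |(∑ k ∈ Finset.range n, Y k ω) / n - m|}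
      ≤ P ({ω | n * (δ / 2) ≤ |(∑ k ∈ Finset.range n, T k) ω -
          ∫ ω, (∑ k ∈ Finset.range n, T k) ω ∂P|} ∪ {ω | n * (δ / 4) ≤ Z ω}) := by
        refine measure_mono fun ω hω => ?_
        by_contra hcon
        simp only [Set.mem_union, Set.mem_ofPred_eq, not_or, not_le] at hcon hω
        have h1 : n * δ ≤ |∑ k ∈ Finset.range n, Y k ω - n * m| := by
          have : |∑ k ∈ Finset.range n, Y k ω - n * m| =
              n * |(∑ k ∈ Finset.range n, Y k ω) / n - m| := by
            rw [← abs_of_pos hn', ← abs_mul, abs_of_pos hn']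
            congr 1
            field_simp
          rw [this]
          exact mul_le_mul_of_nonneg_left hω hn'.le
        have h2 : |∑ k ∈ Finset.range n, Y k ω - (∑ k ∈ Finset.range n, T k) ω| ≤ Z ω := by
          rw [Finset.sum_apply, ← Finset.sum_sub_distrib]
          refine (Finset.abs_sum_le_sum_abs _ _).trans (le_of_eq ?_)
          exact Finset.sum_congr rfl fun k _ => abs_sub_truncPart _ _
        have h3 := abs_sub_le (∑ k ∈ Finset.range n, Y k ω) ((∑ k ∈ Finset.range n, T k) ω) (n * m)
        have h4 := abs_sub_le ((∑ k ∈ Finset.range n, T k) ω)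
          (∫ ω, (∑ k ∈ Finset.range n, T k) ω ∂P) (n * m)
        have h5 : n * η ≤ n * (δ / 4) := mul_le_mul_of_nonneg_left hηδ hn'.le
        linarith [hcon.1, hcon.2]
    _ ≤ _ := by
        refine (measure_union_le _ _).trans (add_le_add (hch.trans ?_) hmk)
        refine ENNReal.ofReal_le_ofReal ?_
        rw [div_le_div_iff₀ (by positivity) (by positivity)]
        have : Var[∑ k ∈ Finset.range n, T k; P] * (n * δ ^ 2) ≤ n * K ^ 2 * (n * δ ^ 2) := by
          gcongr
        nlinarith

/-- The truncation level is fixed first, making bias and tail small uniformly in `k`; the variance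
term then vanishes as the sample grows. -/
lemma convInProb_average {Y : ℕ → Ω → ℝ} {m : ℝ} (hYm : ∀ k, Measurable (Y k))
    (hi : ∀ k, Integrable (Y k) P) (hm : ∀ k, ∫ ω, Y k ω ∂P = m)
    (hind : Pairwise fun k k' => IndepFun (Y k) (Y k') P) {η : ℕ → ℝ} (hη : Tendsto η atTop (𝓝 0))
    (htail : ∀ k (K : ℕ), ∫ ω, tailPart K (Y k ω) ∂P ≤ η K) :
    ConvInProb P (fun (n : ℕ) ω => (∑ k ∈ Finset.range n, Y k ω) / n) m := by
  rw [convInProb_iff_dist]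
  intro δ hδ
  rw [ENNReal.tendsto_nhds_zero]
  intro ρ hρ
  have hρ2 : 0 < ρ / 2 := ENNReal.half_pos hρ.ne'
  have hη2 : Tendsto (fun K => ENNReal.ofReal (4 * η K / δ)) atTop (𝓝 0) := by
    rw [← ENNReal.ofReal_zero]
    refine ENNReal.tendsto_ofReal ?_
    simpa using (hη.const_mul 4).div_const δ
  obtain ⟨K, hK1, hK2⟩ := ((hη.eventually (ge_mem_nhds (show (0 : ℝ) < δ / 4 by positivity))).and
    (hη2.eventually (ge_mem_nhds hρ2))).exists
  have hn : Tendsto (fun n : ℕ => ENNReal.ofReal (4 * (K : ℝ) ^ 2 / (n * δ ^ 2))) atTop (𝓝 0) := by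
    rw [← ENNReal.ofReal_zero]
    refine ENNReal.tendsto_ofReal (tendsto_const_nhds.div_atTop ?_)
    exact (tendsto_natCast_atTop_atTop (R := ℝ)).atTop_mul_const (by positivity)
  filter_upwards [hn.eventually (ge_mem_nhds hρ2), eventually_gt_atTop 0] with n hn1 hn0
  calc _ ≤ _ := measure_abs_average_sub_le hYm hi hm hind (Nat.cast_nonneg K)
        (fun k => htail k K) hδ hK1 hn0
    _ ≤ ρ / 2 + ρ / 2 := add_le_add hn1 hK2
    _ = ρ := ENNReal.add_halves ρ

lemma convInProb_average_of_identDistrib {Y : ℕ → Ω → ℝ} (hYm : ∀ k, Measurable (Y k))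
    (hi : Integrable (Y 0) P) (hid : ∀ k, IdentDistrib (Y k) (Y 0) P P)
    (hind : Pairwise fun k k' => IndepFun (Y k) (Y k') P) :
    ConvInProb P (fun (n : ℕ) ω => (∑ k ∈ Finset.range n, Y k ω) / n) (∫ ω, Y 0 ω ∂P) :=
  convInProb_average hYm (fun k => (hid k).integrable_iff.2 hi) (fun k => (hid k).integral_eq) hind
    (tendsto_integral_tailPart hi)
    fun k K => ((hid k).comp (measurable_tailPart K)).integral_eq.le

end WeakLaw

/-! ### Empirical covariance matrices -/

section EmpCov

variable {d m : ℕ}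

lemma empCov_apply (y : Fin m → EuclideanSpace ℝ (Fin d)) (hm : m ≠ 0) (j j' : Fin d) :
    empCov y j j' = (m / ((m : ℝ) - 1)) * ((∑ k, y k j * y k j') / m -
      (∑ k, y k j) / m * ((∑ k, y k j') / m)) := by
  have hm' : (m : ℝ) ≠ 0 := by exact_mod_cast hm
  have h : ∑ k, (y k j - (∑ k', y k' j) / (m : ℝ)) * (y k j' - (∑ k', y k' j') / (m : ℝ)) =
      ∑ k, y k j * y k j' - (∑ k, y k j) * (∑ k, y k j') / m := by
    simp only [sub_mul, mul_sub, Finset.sum_sub_distrib, ← Finset.mul_sum, ← Finset.sum_mul,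
      Finset.sum_const, Finset.card_univ, Fintype.card_fin, nsmul_eq_mul]
    field_simp
    ring
  rw [empCov, of_apply, h, div_mul_eq_mul_div]
  congr 1
  field_simp

lemma empCov_add_const (x : EuclideanSpace ℝ (Fin d)) (y : Fin m → EuclideanSpace ℝ (Fin d)) :
    empCov (fun k => x + y k) = empCov y := by
  rcases eq_or_ne m 0 with rfl | hm
  · ext; simp [empCov]
  have hm' : (m : ℝ) ≠ 0 := by exact_mod_cast hm
  have h : ∀ j k, (x + y k) j - (∑ k', (x + y k') j) / (m : ℝ) =
      y k j - (∑ k', y k' j) / (m : ℝ) := fun j k => by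
    simp only [PiLp.add_apply, Finset.sum_add_distrib, Finset.sum_const, Finset.card_univ,
      Fintype.card_fin, nsmul_eq_mul]
    field_simp
    ring
  ext j j'
  simp only [empCov, of_apply, h]

lemma empCov_eq_smul_sum (y : Fin m → EuclideanSpace ℝ (Fin d)) :
    empCov y = ((m : ℝ) - 1)⁻¹ • ∑ k, vecMulVec ((y k).ofLp - (m : ℝ)⁻¹ • ∑ k', (y k').ofLp)
      ((y k).ofLp - (m : ℝ)⁻¹ • ∑ k', (y k').ofLp) := by
  ext j j'
  simp only [empCov, of_apply, Matrix.smul_apply, Matrix.sum_apply, vecMulVec_apply, Pi.sub_apply,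
    Pi.smul_apply, Finset.sum_apply, smul_eq_mul]
  rw [div_eq_inv_mul]
  simp only [div_eq_inv_mul]

lemma posSemidef_empCov (y : Fin m → EuclideanSpace ℝ (Fin d)) : (empCov y).PosSemidef := by
  rw [empCov_eq_smul_sum]
  -- For `m = 0` the scalar factor is negative but the sum is empty; for `m = 1` the factor is `0⁻¹
  -- = 0`, still nonnegative.
  rcases eq_or_ne m 0 with rfl | hm
  · simpa using PosSemidef.zero
  · have : (1 : ℝ) ≤ m := by exact_mod_cast Nat.one_le_iff_ne_zero.2 hm
    refine PosSemidef.smul (posSemidef_sum _ fun k _ => ?_) (by rw [inv_nonneg]; linarith)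
    simpa using posSemidef_vecMulVec_self_star
      ((y k).ofLp - (m : ℝ)⁻¹ • ∑ k', (y k').ofLp)

lemma empCov_linear (S : Matrix (Fin d) (Fin d) ℝ) (y : Fin m → EuclideanSpace ℝ (Fin d)) :
    empCov (fun k => WithLp.toLp 2 (S *ᵥ (y k).ofLp)) = S * empCov y * Sᵀ := by
  rw [empCov_eq_smul_sum, empCov_eq_smul_sum]
  simp only [Matrix.mul_smul, Matrix.smul_mul, Matrix.mul_sum, Matrix.sum_mul]
  congr 1
  refine Finset.sum_congr rfl fun k _ => ?_
  have : S *ᵥ (y k).ofLp - (m : ℝ)⁻¹ • ∑ k', S *ᵥ (y k').ofLp =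
      S *ᵥ ((y k).ofLp - (m : ℝ)⁻¹ • ∑ k', (y k').ofLp) := by
    rw [mulVec_sub, mulVec_smul, mulVec_sum]
  rw [this, mul_vecMulVec, vecMulVec_mul, vecMul_transpose]

lemma continuous_empCov : Continuous (empCov : (Fin m → EuclideanSpace ℝ (Fin d)) → _) := by
  refine continuous_matrix fun j j' => ?_
  simp only [empCov, of_apply]
  fun_prop

variable {Ω : Type*} [MeasurableSpace Ω] {P : Measure Ω}

lemma convInProb_empCov {x : ℕ → Ω → EuclideanSpace ℝ (Fin d)} {V : Matrix (Fin d) (Fin d) ℝ}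
    (h1 : ∀ j, ConvInProb P (fun (m : ℕ) ω => (∑ k ∈ Finset.range m, x k ω j) / m) 0)
    (h2 : ∀ j j', ConvInProb P (fun (m : ℕ) ω => (∑ k ∈ Finset.range m, x k ω j * x k ω j') / m)
      (V j j')) :
    ConvInProb P (fun m ω => empCov fun k : Fin m => x k ω) V := by
  refine ConvInProb.pi (E := fun _ : Fin d => Fin d → ℝ) fun j => ConvInProb.pi fun j' => ?_
  have hr : Tendsto (fun m : ℕ => (m : ℝ) / ((m : ℝ) - 1)) atTop (𝓝 1) := by
    have h := (tendsto_inv_atTop_zero.comp (tendsto_natCast_atTop_atTop (R := ℝ))).const_sub 1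
    have h' := h.inv₀ (by norm_num)
    rw [sub_zero, inv_one] at h'
    refine h'.congr' ((eventually_gt_atTop 0).mono fun m hm => ?_)
    have hm' : (m : ℝ) ≠ 0 := by exact_mod_cast hm.ne'
    simp only [Function.comp_apply]
    rw [← inv_div, sub_div, div_self hm', one_div]
  have h3 := (h1 j).comp₂ (h1 j') (f := fun x y => x * y) (by fun_prop)
  have h4 := (h2 j j').comp₂ h3 (f := fun x y => x - y) (by fun_prop)
  have h5 := (ConvInProb.of_tendsto (P := P) hr).comp₂ h4 (f := fun x y => x * y) (by fun_prop)
  have hc : 1 * (V j j' - 0 * 0) = V j j' := by ring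
  rw [hc] at h5
  refine h5.congr ((eventually_gt_atTop 0).mono fun m hm ω => ?_)
  rw [empCov_apply _ hm.ne', Finset.sum_range, Finset.sum_range, Finset.sum_range]

end EmpCov

/-! ### Consistency of the empirical covariance matrices under the error model. -/

section DataCov

variable {Ω : Type*} [MeasurableSpace Ω] {P : Measure Ω} {a d : ℕ}
  {ε : Fin a → ℕ → Ω → EuclideanSpace ℝ (Fin d)} {Sig : Fin a → Matrix (Fin d) (Fin d) ℝ}

lemma IsErrorModel.indepFun (hε : IsErrorModel P ε Sig) (i : Fin a) {k k' : ℕ} (h : k ≠ k') :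
    IndepFun (ε i k) (ε i k') P :=
  hε.indep.indepFun (i := (i, k)) (j := (i, k')) fun h' => h (Prod.ext_iff.1 h').2

variable [IsProbabilityMeasure P]

/-- Consistency of the empirical covariance matrices of the groups. -/
lemma convInProb_empCov_errors (hε : IsErrorModel P ε Sig) (i : Fin a) :
    ConvInProb P (fun m ω => empCov fun k : Fin m => ε i k ω) (Sig i) := by
  refine convInProb_empCov (fun j => ?_) fun j j' => ?_
  · rw [← hε.mean_zero i 0 j]
    refine convInProb_average_of_identDistrib (fun k => measurable_coord hε i k j)
      ((hε.memLp i 0 j).integrable (by norm_num)) (fun k => hε.identDistrib i j k 0)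
      fun k k' h => ?_
    exact (hε.indepFun i h).comp (φ := fun x : EuclideanSpace ℝ (Fin d) => x j)
      (ψ := fun x : EuclideanSpace ℝ (Fin d) => x j) (by fun_prop) (by fun_prop)
  · have hsq : ∀ (j : Fin d) k (K : ℝ), ∫ ω, tailPart K (ε i k ω j ^ 2) ∂P =
        ∫ ω, tailPart K (ε i 0 ω j ^ 2) ∂P := fun j k K =>
      ((hε.identDistrib i j k 0).comp (u := fun x => tailPart K (x ^ 2))
        ((measurable_tailPart K).comp (by fun_prop))).integral_eq
    refine convInProb_average
      (fun k => (measurable_coord hε i k j).mul (measurable_coord hε i k j'))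
      (fun k => hε.integrable_mul i k j j') (fun k => hε.integral_mul i k j j') ?_
      (η := fun K => ∫ ω, tailPart K (ε i 0 ω j ^ 2) ∂P + ∫ ω, tailPart K (ε i 0 ω j' ^ 2) ∂P)
      ?_ ?_
    · intro k k' h
      exact (hε.indepFun i h).comp (φ := fun x : EuclideanSpace ℝ (Fin d) => x j * x j')
        (ψ := fun x : EuclideanSpace ℝ (Fin d) => x j * x j') (by fun_prop) (by fun_prop)
    · simpa using (tendsto_integral_tailPart (hε.memLp i 0 j).integrable_sq).add
        (tendsto_integral_tailPart (hε.memLp i 0 j').integrable_sq)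
    · intro k K
      have hi : ∀ j, Integrable (fun ω => tailPart K (ε i k ω j ^ 2)) P := fun j =>
        integrable_tailPart (hε.memLp i k j).integrable_sq K
      rw [← hsq j k, ← hsq j' k, ← integral_add (hi j) (hi j')]
      exact integral_mono (integrable_tailPart (hε.integrable_mul i k j j') K)
        ((hi j).add (hi j')) fun ω => tailPart_mul_le _ _ _

end DataCov

end QFMCT

end

noncomputable section

namespace QFMCT

/-! ### A coupling of the bootstrap samples with standard normal noise -/

section Coupling

variable {a d : ℕ}

open scoped MatrixOrder Matrix.Norms.L2Operator in
-- Continuity on the whole cone, singular matrices included, matters because the group covariance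
-- matrices may be degenerate.
lemma continuousOn_sqrt_posSemidef :
    ContinuousOn (fun A : Matrix (Fin d) (Fin d) ℝ => CFC.sqrt A) {A | A.PosSemidef} := by
  have h : ContinuousOn (fun A : Matrix (Fin d) (Fin d) ℝ => cfcₙ NNReal.sqrt A)
      {A | A.PosSemidef} :=
    ContinuousOn.cfcₙ_nnreal_of_mem_nhdsSet (s := Set.univ) _ Filter.univ_mem continuousOn_id
      (fun A (hA : A.PosSemidef) => hA.nonneg) NNReal.continuous_sqrt.continuousOn (by simp)
  exact h

open scoped MatrixOrder in
lemma sqrt_mul_transpose_sqrt {A : Matrix (Fin d) (Fin d) ℝ} (hA : A.PosSemidef) :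
    CFC.sqrt A * (CFC.sqrt A)ᵀ = A := by
  have h : (CFC.sqrt A)ᵀ = CFC.sqrt A := by
    rw [← conjTranspose_eq_transpose_of_trivial]
    exact (CFC.sqrt_nonneg A).posSemidef.isHermitian
  rw [h, CFC.sqrt_mul_sqrt_self A hA.nonneg]

open scoped MatrixOrder in
lemma continuous_sqrt_empCov {m : ℕ} :
    Continuous fun y : Fin m → EuclideanSpace ℝ (Fin d) => CFC.sqrt (empCov y) :=
  continuousOn_sqrt_posSemidef.comp_continuous continuous_empCov posSemidef_empCov

/-- Standard normal noise: independent standard normal vectors for each group and subject. -/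
def noise (a d : ℕ) : Measure (Fin a × ℕ → EuclideanSpace ℝ (Fin d)) :=
  Measure.infinitePi fun _ => stdGaussian (EuclideanSpace ℝ (Fin d))

instance : IsProbabilityMeasure (noise a d) := by unfold noise; infer_instance

/-- Independent replicates of standard normal noise. -/
def noiseSeq (a d : ℕ) : Measure (ℕ → Fin a × ℕ → EuclideanSpace ℝ (Fin d)) :=
  Measure.infinitePi fun _ => noise a d

instance : IsProbabilityMeasure (noiseSeq a d) := by unfold noiseSeq; infer_instance

open scoped MatrixOrder in
/-- The sample obtained from noise vectors by the square roots of the empirical covariance matrices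
of a given sample. -/
def resample {n : Fin a → ℕ} (x : Sample d n) (w : Fin a × ℕ → EuclideanSpace ℝ (Fin d)) :
    Sample d n :=
  fun i k => WithLp.toLp 2 (CFC.sqrt (empCov (x i)) *ᵥ (w (i, k)).ofLp)

lemma continuous_resample {n : Fin a → ℕ} :
    Continuous fun q : Sample d n × (Fin a × ℕ → EuclideanSpace ℝ (Fin d)) =>
      resample q.1 q.2 := by
  refine continuous_pi fun i => continuous_pi fun k => ?_
  refine (PiLp.continuous_toLp 2 _).comp (Continuous.matrix_mulVec ?_ ?_)
  · exact continuous_sqrt_empCov.comp ((continuous_apply i).comp continuous_fst)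
  · exact (PiLp.continuous_ofLp 2 _).comp ((continuous_apply (i, (k : ℕ))).comp continuous_snd)

lemma measurable_resample {n : Fin a → ℕ} :
    Measurable fun q : Sample d n × (Fin a × ℕ → EuclideanSpace ℝ (Fin d)) =>
      resample q.1 q.2 := by
  exact continuous_resample.measurable

open scoped MatrixOrder in
-- A multivariate normal law is the image of the standard one under the square root of its
-- covariance matrix. The finite products arise from one infinite product by currying the index and
-- keeping the first `n i` subjects of each group.
lemma map_resample_noise {n : Fin a → ℕ} (x : Sample d n) :
    (noise a d).map (resample x) = Measure.pi fun i => Measure.pi fun _ : Fin (n i) =>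
      multivariateGaussian 0 (empCov (x i)) := by
  have hf : ∀ i, Measurable fun y : EuclideanSpace ℝ (Fin d) =>
      (0 : EuclideanSpace ℝ (Fin d)) + toEuclideanCLM (𝕜 := ℝ) (CFC.sqrt (empCov (x i))) y := by
    fun_prop
  have hg : ∀ i, Measurable fun (v : ℕ → EuclideanSpace ℝ (Fin d)) (k : Fin (n i)) =>
      (0 : EuclideanSpace ℝ (Fin d)) + toEuclideanCLM (𝕜 := ℝ) (CFC.sqrt (empCov (x i))) (v k) :=
    fun i => measurable_pi_lambda _ fun k => (hf i).comp (measurable_pi_apply (k : ℕ))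
  have h1 : ∀ i, (Measure.infinitePi fun _ : ℕ => stdGaussian (EuclideanSpace ℝ (Fin d))).map
      (fun (v : ℕ → EuclideanSpace ℝ (Fin d)) (k : Fin (n i)) =>
        (0 : EuclideanSpace ℝ (Fin d)) + toEuclideanCLM (𝕜 := ℝ) (CFC.sqrt (empCov (x i))) (v k)) =
      Measure.pi fun _ : Fin (n i) => multivariateGaussian 0 (empCov (x i)) := fun i => by
    rw [← Measure.infinitePi_eq_pi]
    have h2 := Measure.infinitePi_map_pi
      (μ := fun _ : Fin (n i) => stdGaussian (EuclideanSpace ℝ (Fin d))) (fun _ => hf i)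
    rw [← Measure.map_infinitePi_infinitePi_of_inj (Fin.val_injective (n := n i))
      (P := fun _ => stdGaussian (EuclideanSpace ℝ (Fin d))),
      Measure.map_map ?_ (by fun_prop)] at h2
    · exact h2
    · exact measurable_pi_lambda _ fun k => (hf i).comp (measurable_pi_apply k)
  simp_rw [← h1]
  have hp : ∀ i, IsProbabilityMeasure ((Measure.infinitePi fun _ : ℕ =>
      stdGaussian (EuclideanSpace ℝ (Fin d))).map
      (fun (v : ℕ → EuclideanSpace ℝ (Fin d)) (k : Fin (n i)) =>
        (0 : EuclideanSpace ℝ (Fin d)) + toEuclideanCLM (𝕜 := ℝ) (CFC.sqrt (empCov (x i))) (v k))) :=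
    fun i => Measure.isProbabilityMeasure_map (hg i).aemeasurable
  rw [← Measure.infinitePi_eq_pi, ← Measure.infinitePi_map_pi _ hg,
    ← Measure.infinitePi_map_curry fun (_ : Fin a) (_ : ℕ) => stdGaussian (EuclideanSpace ℝ (Fin d)),
    Measure.map_map ?_ (MeasurableEquiv.measurable _)]
  swap
  · exact measurable_pi_lambda _ fun i => (hg i).comp (measurable_pi_apply i)
  congr 1
  ext w i k j
  simp [resample, MeasurableEquiv.curry]

variable {Ω : Type*} [MeasurableSpace Ω] {P : Measure Ω} [IsProbabilityMeasure P]

/-- The sequence of samples resampled from a sequence of noise vectors. -/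
def resampleSeq {n : Fin a → ℕ}
    (q : Sample d n × (ℕ → Fin a × ℕ → EuclideanSpace ℝ (Fin d))) : ℕ → Sample d n :=
  fun b => resample q.1 (q.2 b)

lemma measurable_resampleSeq {n : Fin a → ℕ} :
    Measurable (resampleSeq : Sample d n × (ℕ → Fin a × ℕ → EuclideanSpace ℝ (Fin d)) →
      ℕ → Sample d n) :=
  have h : ∀ b, Measurable fun q : Sample d n × (ℕ → Fin a × ℕ → EuclideanSpace ℝ (Fin d)) =>
      (q.1, q.2 b) := fun b =>
    measurable_fst.prodMk ((measurable_pi_apply b).comp measurable_snd)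
  measurable_pi_lambda _ fun b => by
    have h2 := measurable_resample.comp (h b)
    simp only [resampleSeq]
    exact h2

lemma map_resampleSeq_noiseSeq {n : Fin a → ℕ} (x : Sample d n) :
    (noiseSeq a d).map (fun z => resampleSeq (x, z)) =
      Measure.infinitePi fun _ : ℕ => Measure.pi fun i => Measure.pi fun _ : Fin (n i) =>
        multivariateGaussian 0 (empCov (x i)) := by
  rw [← map_resample_noise]
  exact Measure.infinitePi_map_pi (μ := fun _ : ℕ => noise a d)
    (fun _ => measurable_resample.comp measurable_prodMk_left)

/-- Parametric bootstrap samples have the joint law of resampled independent noise. -/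
lemma IsParametricBootstrap.map_eq {n : Fin a → ℕ} {X : Ω → Sample d n} (hX : Measurable X)
    {Xstar : ℕ → Ω → Sample d n} (h : IsParametricBootstrap P X Xstar) :
    P.map (fun ω b => Xstar b ω) =
      (P.prod (noiseSeq a d)).map fun q => resampleSeq (X q.1, q.2) := by
  have hY : Measurable fun ω b => Xstar b ω := measurable_pi_lambda _ h.measurable
  have hF : Measurable fun (q : Ω × (ℕ → Fin a × ℕ → EuclideanSpace ℝ (Fin d))) =>
      resampleSeq (X q.1, q.2) :=
    measurable_resampleSeq.comp ((hX.comp measurable_fst).prodMk measurable_snd)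
  ext s hs
  rw [← condDistrib_comp_map hX.aemeasurable hY.aemeasurable,
    Measure.bind_apply hs (Kernel.aemeasurable _), Measure.map_apply hF hs,
    Measure.prod_apply (hF hs)]
  have h2 : ∫⁻ x, condDistrib (fun ω b => Xstar b ω) X P x s ∂(P.map X) =
      ∫⁻ x, noiseSeq a d (Prod.mk x ⁻¹' (resampleSeq ⁻¹' s)) ∂(P.map X) := by
    refine lintegral_congr_ae (h.condDistrib_eq.mono fun x hx => ?_)
    simp only [hx, ← map_resampleSeq_noiseSeq]
    exact Measure.map_apply (measurable_resampleSeq.comp measurable_prodMk_left) hs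
  rw [h2, lintegral_map (measurable_measure_prodMk_left (measurable_resampleSeq hs)) hX]
  rfl

lemma integral_stdGaussian_eval (j : Fin d) :
    ∫ x, x j ∂(stdGaussian (EuclideanSpace ℝ (Fin d))) = 0 :=
  integral_strongDual_stdGaussian (EuclideanSpace.proj j)

lemma map_eval_noise (i : Fin a) (k : ℕ) : (noise a d).map
    (fun w : Fin a × ℕ → EuclideanSpace ℝ (Fin d) => w (i, k)) =
    stdGaussian (EuclideanSpace ℝ (Fin d)) :=
  Measure.infinitePi_map_eval (fun _ : Fin a × ℕ => stdGaussian (EuclideanSpace ℝ (Fin d))) (i, k)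

/-- The noise vectors form an error model with unit covariance matrices. -/
lemma isErrorModel_noise : IsErrorModel (noise a d)
    (fun i k (w : Fin a × ℕ → EuclideanSpace ℝ (Fin d)) => w (i, k)) fun _ => 1 := by
  have hmap := map_eval_noise (a := a) (d := d)
  have hm : ∀ i k, Measurable fun w : Fin a × ℕ → EuclideanSpace ℝ (Fin d) => w (i, k) :=
    fun i k => measurable_pi_apply _
  have hj : ∀ j, Measurable fun x : EuclideanSpace ℝ (Fin d) => x j := fun j => by fun_prop
  have hL : ∀ j, MemLp (fun x : EuclideanSpace ℝ (Fin d) => x j) 2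
      (stdGaussian (EuclideanSpace ℝ (Fin d))) := fun j =>
    (IsGaussian.memLp_two_id (μ := stdGaussian (EuclideanSpace ℝ (Fin d)))).continuousLinearMap_comp
      (EuclideanSpace.proj j : EuclideanSpace ℝ (Fin d) →L[ℝ] ℝ)
  refine ⟨hm, ?_, fun i j k k' => ?_, fun i k j => ?_, fun i k j => ?_, fun i k j j' => ?_⟩
  · exact iIndepFun_infinitePi (X := fun _ (x : EuclideanSpace ℝ (Fin d)) => x)
      fun _ => measurable_id
  · have hl : ∀ k, (noise a d).map (fun w => w (i, k) j) =
        (stdGaussian (EuclideanSpace ℝ (Fin d))).map fun x => x j := fun k => by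
      rw [← hmap i k, Measure.map_map (hj j) (hm i k)]
      rfl
    exact ⟨((hj j).comp (hm i k)).aemeasurable, ((hj j).comp (hm i k')).aemeasurable,
      (hl k).trans (hl k').symm⟩
  · have := hL j
    rw [← hmap i k] at this
    exact this.comp_of_map (hm i k).aemeasurable
  · rw [← integral_map (f := fun x : EuclideanSpace ℝ (Fin d) => x j) (hm i k).aemeasurable
      (hj j).aestronglyMeasurable, hmap, integral_stdGaussian_eval]
  · rw [← covariance_eval_multivariateGaussian (μ := 0) PosSemidef.one, multivariateGaussian_zero_one,
      ← hmap i k, covariance_map (hj j).aestronglyMeasurable (hj j').aestronglyMeasurable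
        (hm i k).aemeasurable]
    rfl

lemma charFun_noise_linear (t : Fin d → ℝ) (i : Fin a) (k : ℕ) (s : ℝ) :
    charFun ((noise a d).map fun w => ∑ j, t j * w (i, k) j) s =
      Complex.exp (-(s ^ 2 * ∑ j, t j ^ 2) / 2 : ℝ) := by
  have hm : Measurable fun w : Fin a × ℕ → EuclideanSpace ℝ (Fin d) => w (i, k) :=
    measurable_pi_apply _
  have hl : Measurable fun w : Fin a × ℕ → EuclideanSpace ℝ (Fin d) => ∑ j, t j * w (i, k) j :=
    Finset.measurable_sum _ fun j _ => (measurable_coord isErrorModel_noise i k j).const_mul _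
  have h := charFun_stdGaussian (E := EuclideanSpace ℝ (Fin d)) (WithLp.toLp 2 (s • t))
  rw [← map_eval_noise i k, charFun_apply, integral_map hm.aemeasurable (by fun_prop)] at h
  rw [charFun_apply_real, integral_map hl.aemeasurable (by fun_prop)]
  have he : ∀ w : Fin a × ℕ → EuclideanSpace ℝ (Fin d),
      (s * (∑ j, t j * w (i, k) j : ℝ) : ℂ) =
        (inner ℝ (w (i, k)) (WithLp.toLp 2 (s • t) : EuclideanSpace ℝ (Fin d)) : ℝ) := fun w => by
    rw [EuclideanSpace.inner_eq_star_dotProduct]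
    simp [dotProduct, Finset.mul_sum, mul_assoc]
  simp_rw [he]
  rw [h, ← Complex.ofReal_pow, EuclideanSpace.real_norm_sq_eq]
  congr 1
  simp [mul_pow, Finset.mul_sum]

/-- The normalized group sums of noise vectors. -/
def noiseMean (n : Fin a → ℕ) (w : Fin a × ℕ → EuclideanSpace ℝ (Fin d)) : Fin a × Fin d → ℝ :=
  fun q => (√(n q.1 : ℝ))⁻¹ * ∑ k : Fin (n q.1), w (q.1, k) q.2

lemma measurable_noiseMean (n : Fin a → ℕ) :
    Measurable (noiseMean n : (Fin a × ℕ → EuclideanSpace ℝ (Fin d)) → _) :=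
  measurable_pi_lambda _ fun q => (Finset.measurable_sum Finset.univ
    fun (k : Fin (n q.1)) _ => measurable_coord isErrorModel_noise q.1 (k : ℕ) q.2).const_mul _

lemma totalSize_pos {n : Fin a → ℕ} (i : Fin a) (hn : n i ≠ 0) : 0 < totalSize n :=
  (Nat.pos_of_ne_zero hn).trans_le (Finset.single_le_sum (fun _ _ => Nat.zero_le _)
    (Finset.mem_univ i))

/-- An identity for finite samples, not a limit: the normal law is stable. All `ν` therefore share
one limit vector, and the noise itself serves as the coupling variable. -/
lemma map_noiseMean {n : Fin a → ℕ} (hn : ∀ i, n i ≠ 0) :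
    (noise a d).map (noiseMean n) = stdNormal (Fin a × Fin d) := by
  -- Ratio of the normalizations `√N / n` in `scaledMean` and `1 / √n` in `noiseMean`; the
  -- characteristic function is computed for the former and the diagonal factor is removed
  -- afterwards.
  set e : Fin a × Fin d → ℝ := fun q => √(totalSize n : ℝ) / √(n q.1 : ℝ) with he
  have hn' : ∀ i, (0 : ℝ) < n i := fun i => by exact_mod_cast Nat.pos_of_ne_zero (hn i)
  have hN : ∀ q : Fin a × Fin d, (0 : ℝ) < totalSize n := fun q => by
    exact_mod_cast totalSize_pos q.1 (hn q.1)
  have he0 : ∀ q, e q ≠ 0 := fun q =>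
    (div_pos (Real.sqrt_pos.2 (hN q)) (Real.sqrt_pos.2 (hn' q.1))).ne'
  have hsm := measurable_scaledMean (isErrorModel_noise (a := a) (d := d)) 0 n
  set X := scaledMean (d := d) 0 (fun i k (w : Fin a × ℕ → EuclideanSpace ℝ (Fin d)) => w (i, k)) n
  have hD : Measurable fun g : Fin a × Fin d → ℝ => (WithLp.toLp 2 (diagonal e *ᵥ g) :
      EuclideanSpace ℝ (Fin a × Fin d)) :=
    (WithLp.measurable_toLp 2 _).comp
      (Continuous.matrix_mulVec continuous_const continuous_id).measurable
  have hX : Measurable fun w => (WithLp.toLp 2 (X w) : EuclideanSpace ℝ (Fin a × Fin d)) :=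
    (WithLp.measurable_toLp 2 _).comp hsm
  have hlaw : (noise a d).map (fun w => (WithLp.toLp 2 (X w) : EuclideanSpace ℝ (Fin a × Fin d))) =
      (stdNormal (Fin a × Fin d)).map fun g => WithLp.toLp 2 (diagonal e *ᵥ g) := by
    have := Measure.isProbabilityMeasure_map (μ := noise a d) hX.aemeasurable
    have := Measure.isProbabilityMeasure_map (μ := stdNormal (Fin a × Fin d)) hD.aemeasurable
    refine Measure.ext_of_charFun (E := EuclideanSpace ℝ (Fin a × Fin d)) (funext fun t => ?_)
    rw [charFun_map_toLp_mulVec, charFun_scaledMean isErrorModel_noise 0 hn t]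
    simp only [charFun_noise_linear, Finset.prod_const, Finset.card_range, ← Complex.exp_nat_mul]
    rw [← Complex.exp_sum]
    congr 1
    simp only [diagonal_transpose, diagonal_mul_diagonal, mulVec_diagonal, dotProduct,
      Fintype.sum_prod_type]
    rw [← Complex.ofReal_neg]
    norm_cast
    rw [Finset.sum_div, ← Finset.sum_neg_distrib]
    refine Finset.sum_congr rfl fun i _ => ?_
    rw [neg_div, Finset.mul_sum, Finset.sum_div, Finset.sum_div, mul_neg, Finset.mul_sum]
    congr 1
    refine Finset.sum_congr rfl fun j _ => ?_
    have h4 := (hn' i).ne'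
    simp only [he, div_pow, Real.sq_sqrt (hN (i, j)).le]
    rw [← mul_assoc, mul_comm (t.ofLp (i, j)), mul_assoc, div_mul_div_comm,
      Real.mul_self_sqrt (hN (i, j)).le, Real.mul_self_sqrt (hn' i).le]
    field_simp
  have hE : Measurable fun x : EuclideanSpace ℝ (Fin a × Fin d) => fun q => (e q)⁻¹ * x q := by
    fun_prop
  have h1 := congrArg (Measure.map fun x : EuclideanSpace ℝ (Fin a × Fin d) =>
    fun q => (e q)⁻¹ * x q) hlaw
  rw [Measure.map_map hE hX, Measure.map_map hE hD] at h1
  have h2 : ((fun (x : EuclideanSpace ℝ (Fin a × Fin d)) q => (e q)⁻¹ * x q) ∘ fun w =>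
      (WithLp.toLp 2 (X w) : EuclideanSpace ℝ (Fin a × Fin d))) = noiseMean n := by
    ext w q
    obtain ⟨i, j⟩ := q
    simp only [Function.comp_apply, X, scaledMean, noiseMean]
    rw [sqrt_smul_pooledMean_sub_eq 0 (hn i), ← Finset.mul_sum, he]
    have h3 := Real.sq_sqrt (hn' i).le
    have h4 := (Real.sqrt_pos.2 (hN (i, j))).ne'
    have h5 := (Real.sqrt_pos.2 (hn' i)).ne'
    simp only
    rw [← mul_assoc]
    congr 1
    field_simp
    rw [h3]
    exact div_self (hn' i).ne'
  have h3 : ((fun (x : EuclideanSpace ℝ (Fin a × Fin d)) q => (e q)⁻¹ * x q) ∘ fun g =>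
      (WithLp.toLp 2 (diagonal e *ᵥ g) : EuclideanSpace ℝ (Fin a × Fin d))) = id := by
    ext g q
    simp [mulVec_diagonal, he0]
  rw [h2, h3, Measure.map_id] at h1
  exact h1

end Coupling

end QFMCT

end

noncomputable section

namespace QFMCT

/-! ### Standardized quadratic forms -/

section WeightMatrix

variable {a d m : ℕ}

lemma continuous_form_mul {p : Type*} (C : Matrix (Fin m) p ℝ) :
    Continuous fun q : Matrix p p ℝ × Matrix (Fin m) (Fin m) ℝ => Cᵀ * q.2 * C :=
  (continuous_const.matrix_mul continuous_snd).matrix_mul continuous_const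

variable {p : Type*} [Fintype p]

lemma posSemidef_form {C : Matrix (Fin m) p ℝ} {W : Matrix (Fin m) (Fin m) ℝ} (hW : W.PosSemidef) : (Cᵀ * W * C).PosSemidef := by
  simpa using hW.conjTranspose_mul_mul_same C

/-- The matrix of the standardized quadratic form as a function of `C`, `S` and the value of the
weight function. -/
def weightMatrix [DecidableEq p] (C : Matrix (Fin m) p ℝ) (S : Matrix p p ℝ)
    (W : Matrix (Fin m) (Fin m) ℝ) : Matrix p p ℝ :=
  ((√(2 * ((Cᵀ * W * C * S) ^ 2).trace))⁻¹ * if 0 < ((Cᵀ * W * C * S) ^ 2).trace then 1 else 0) •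
    (Cᵀ * W * C)

lemma quadForm_mulVec (N : ℕ) (M : WeightFunction a d) (C : Matrix (Fin m) (Fin a × Fin d) ℝ)
    (S : Matrix (Fin a × Fin d) (Fin a × Fin d) ℝ) (v : Fin a × Fin d → ℝ) :
    quadForm N M C S (C *ᵥ v) =
      (√(N : ℝ) • v) ⬝ᵥ weightMatrix C S (M m C S) *ᵥ (√(N : ℝ) • v) := by
  have h : v ⬝ᵥ (Cᵀ * M m C S * C) *ᵥ v = (C *ᵥ v) ⬝ᵥ (M m C S *ᵥ (C *ᵥ v)) := by
    rw [← mulVec_mulVec, ← mulVec_mulVec, dotProduct_mulVec v Cᵀ, vecMul_transpose]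
  have hq : quadForm N M C S (C *ᵥ v) = N * ((C *ᵥ v) ⬝ᵥ (M m C S *ᵥ (C *ᵥ v)) /
      √(2 * ((Cᵀ * M m C S * C * S) ^ 2).trace)) *
      if 0 < ((Cᵀ * M m C S * C * S) ^ 2).trace then 1 else 0 := rfl
  rw [hq]
  simp only [weightMatrix, smul_mulVec, mulVec_smul, dotProduct_smul, smul_dotProduct,
    smul_eq_mul, h]
  have hs := Real.mul_self_sqrt (Nat.cast_nonneg (α := ℝ) N)
  generalize √(N : ℝ) = s at hs ⊢
  rw [← hs]
  ring

variable [DecidableEq p] {C : Matrix (Fin m) p ℝ} {S : Matrix p p ℝ} {W : Matrix (Fin m) (Fin m) ℝ}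

lemma continuous_trace_sq :
    Continuous fun q : Matrix p p ℝ × Matrix (Fin m) (Fin m) ℝ =>
      ((Cᵀ * q.2 * C * q.1) ^ 2).trace := by
  have h := (continuous_form_mul C).matrix_mul continuous_fst
  simp only [sq]
  exact (h.matrix_mul h).matrix_trace

/-- Where the trace is positive, the indicator is constant nearby and the square root in the
denominator stays away from zero. -/
lemma continuousAt_weightMatrix (h : 0 < ((Cᵀ * W * C * S) ^ 2).trace) :
    ContinuousAt (fun q : Matrix p p ℝ × Matrix (Fin m) (Fin m) ℝ => weightMatrix C q.1 q.2)
      (S, W) := by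
  have h1 := continuous_trace_sq (C := C)
  have h4 := (h1.const_mul 2).sqrt.continuousAt (x := (S, W))
  have h5 : ContinuousAt (fun q : Matrix p p ℝ × Matrix (Fin m) (Fin m) ℝ =>
      (√(2 * ((Cᵀ * q.2 * C * q.1) ^ 2).trace))⁻¹) (S, W) :=
    h4.inv₀ (Real.sqrt_pos.2 (mul_pos two_pos h)).ne'
  have h3 := h5.smul (continuous_form_mul C).continuousAt
  have h6 : {q : Matrix p p ℝ × Matrix (Fin m) (Fin m) ℝ | 0 < ((Cᵀ * q.2 * C * q.1) ^ 2).trace} ∈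
      𝓝 (S, W) := (isOpen_lt continuous_const h1).mem_nhds (by simpa only [Set.mem_ofPred_eq] using h)
  refine h3.congr (mem_of_superset h6 fun q hq => ?_)
  rw [Set.mem_ofPred_eq] at hq
  simp only [Set.mem_ofPred_eq, weightMatrix, if_pos hq, mul_one, Pi.smul_apply']

lemma posSemidef_weightMatrix (hW : W.PosSemidef) : (weightMatrix C S W).PosSemidef := by
  refine (posSemidef_form hW).smul (mul_nonneg (inv_nonneg.2 (Real.sqrt_nonneg _)) ?_)
  split_ifs <;> norm_num

variable {D : Matrix p p ℝ}

/-- With `H = Cᵀ * W * C` positive semidefinite, `Dᵀ * H * D = 0` forces `H * D = 0`, hence `H * S =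
H * D * Dᵀ = 0`, whose only possible eigenvalue is zero. -/
lemma form_ne_zero_of_hasEigenvalue (hW : W.PosSemidef) (hD : D * Dᵀ = S) {lam : ℝ}
    (hlam : lam ≠ 0) (h : Module.End.HasEigenvalue (Matrix.toLin' (Cᵀ * W * C * S)) lam) :
    Dᵀ * (Cᵀ * W * C) * D ≠ 0 := by
  intro h0
  have hH := posSemidef_form (C := C) hW
  have h1 : Cᵀ * W * C * D = 0 := by
    refine Matrix.ext_of_mulVec_single fun j => ?_
    rw [zero_mulVec, ← mulVec_mulVec]
    refine (hH.dotProduct_mulVec_zero_iff _).1 ?_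
    have h2 : ∀ y, D *ᵥ Pi.single j 1 ⬝ᵥ y = Pi.single j 1 ⬝ᵥ Dᵀ *ᵥ y := fun y => by
      rw [dotProduct_mulVec, vecMul_transpose]
    rw [star_trivial, h2, mulVec_mulVec, mulVec_mulVec, h0, zero_mulVec,
      dotProduct_zero]
  rw [← hD, ← Matrix.mul_assoc, h1, Matrix.zero_mul, map_zero] at h
  obtain ⟨v, hv⟩ := h.exists_hasEigenvector
  have := hv.apply_eq_smul
  rw [LinearMap.zero_apply] at this
  exact (smul_ne_zero hlam hv.2) this.symm

/-- By cyclicity of the trace, the trace of `(H * S) ^ 2` is the squared Frobenius norm of the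
symmetric matrix `Dᵀ * H * D`. -/
lemma trace_sq_pos (hW : W.PosSemidef) (hD : D * Dᵀ = S) (h : Dᵀ * (Cᵀ * W * C) * D ≠ 0) :
    0 < ((Cᵀ * W * C * S) ^ 2).trace := by
  set H := Cᵀ * W * C
  have hH : Hᵀ = H := by
    have := (posSemidef_form (C := C) hW).isHermitian
    rwa [IsHermitian, conjTranspose_eq_transpose_of_trivial] at this
  have h1 : ((H * S) ^ 2).trace = ((Dᵀ * H * D)ᴴ * (Dᵀ * H * D)).trace := by
    rw [conjTranspose_eq_transpose_of_trivial, transpose_mul, transpose_mul, transpose_transpose, hH,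
      ← hD, sq]
    calc (H * (D * Dᵀ) * (H * (D * Dᵀ))).trace = ((H * D * (Dᵀ * H * D)) * Dᵀ).trace := by
          simp only [Matrix.mul_assoc]
      _ = _ := by
          rw [trace_mul_comm]
          simp only [Matrix.mul_assoc]
  rw [h1]
  refine lt_of_le_of_ne (posSemidef_conjTranspose_mul_self _).trace_nonneg fun h0 => h ?_
  exact trace_conjTranspose_mul_self_eq_zero_iff.1 h0.symm

lemma weightMatrix_ne_zero (hW : W.PosSemidef) (hD : D * Dᵀ = S)
    (h : Dᵀ * (Cᵀ * W * C) * D ≠ 0) : Dᵀ * weightMatrix C S W * D ≠ 0 := by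
  have ht := trace_sq_pos hW hD h
  rw [weightMatrix, Matrix.mul_smul, Matrix.smul_mul, if_pos ht, mul_one]
  exact smul_ne_zero (inv_ne_zero (Real.sqrt_pos.2 (by positivity)).ne') h

end WeightMatrix

/-! ### Measurability of the statistics -/

section Measurability

variable {Z : Type*} [MeasurableSpace Z] {a d L : ℕ} {r : Fin L → ℕ}

lemma measurable_mul_apply {l m k : Type*} [Fintype m] {A : Z → Matrix l m ℝ} {B : Z → Matrix m k ℝ}
    (hA : ∀ i j, Measurable fun z => A z i j) (hB : ∀ i j, Measurable fun z => B z i j) (i : l)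
    (j : k) : Measurable fun z => (A z * B z) i j := by
  simp only [Matrix.mul_apply]
  exact Finset.measurable_sum _ fun s _ => (hA i s).mul (hB s j)

lemma measurable_quadForm (N : ℕ) {m : ℕ} {M : WeightFunction a d}
    {C : Matrix (Fin m) (Fin a × Fin d) ℝ}
    (hM : ∀ s t, Measurable fun S : Fin a × Fin d → Fin a × Fin d → ℝ => M m C (Matrix.of S) s t)
    {S : Z → Matrix (Fin a × Fin d) (Fin a × Fin d) ℝ} (hS : ∀ p q, Measurable fun z => S z p q)
    {y : Z → Fin m → ℝ} (hy : ∀ s, Measurable fun z => y z s) :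
    Measurable fun z => quadForm N M C (S z) (y z) := by
  have hM' : ∀ s t, Measurable fun z => M m C (S z) s t := fun s t =>
    (hM s t).comp (measurable_pi_lambda _ fun p => measurable_pi_lambda _ fun q => hS p q)
  have hH : ∀ i j, Measurable fun z => (Cᵀ * M m C (S z) * C * S z) i j :=
    measurable_mul_apply (measurable_mul_apply (measurable_mul_apply (fun _ _ => measurable_const)
      hM') fun _ _ => measurable_const) hS
  have ht : Measurable fun z => formTrace M C (S z) := by
    simp only [formTrace, sq, trace, diag_apply]
    exact Finset.measurable_sum _ fun i _ => measurable_mul_apply hH hH i i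
  have hn : Measurable fun z => y z ⬝ᵥ (M m C (S z) *ᵥ y z) := by
    simp only [dotProduct, mulVec]
    exact Finset.measurable_sum _ fun s _ => (hy s).mul
      (Finset.measurable_sum _ fun t _ => (hM' s t).mul (hy t))
  exact ((hn.div (ht.const_mul 2).sqrt).const_mul _).mul
    (Measurable.ite (measurableSet_lt measurable_const ht) measurable_const measurable_const)

lemma measurable_mulVec_apply {m : Type*} {p : Type*} [Fintype p] (C : Matrix m p ℝ) {v : Z → p → ℝ}
    (hv : Measurable v) (s : m) : Measurable fun z => (C *ᵥ v z) s := by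
  simp only [mulVec, dotProduct]
  exact Finset.measurable_sum _ fun t _ => ((measurable_pi_apply t).comp hv).const_mul _

lemma measurable_pooledCov_apply {n : Fin a → ℕ} (p q : Fin a × Fin d) :
    Measurable fun x : Sample d n => pooledCov x p q := by
  simp only [pooledCov, directSum, of_apply, Matrix.smul_apply, smul_eq_mul]
  split_ifs
  · refine Measurable.const_mul ?_ _
    have : Continuous fun y : Fin (n p.1) → EuclideanSpace ℝ (Fin d) => empCov y p.2 q.2 :=
      continuous_empCov.matrix_elem _ _
    exact this.measurable.comp (measurable_pi_apply p.1)
  · exact measurable_const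

lemma measurable_bootStat {M : WeightFunction a d} {C : Matrix (Σ ℓ, Fin (r ℓ)) (Fin a × Fin d) ℝ}
    {ℓ : Fin L}
    (hM : ∀ s t, Measurable fun S : Fin a × Fin d → Fin a × Fin d → ℝ =>
      M (r ℓ) (blockMat C ℓ) (Matrix.of S) s t) {n : Fin a → ℕ} :
    Measurable fun x : Sample d n => bootStat M C x ℓ :=
  measurable_quadForm _ hM measurable_pooledCov_apply
    (measurable_mulVec_apply _ measurable_pooledMean)

lemma measurable_testStat {M : WeightFunction a d} {C : Matrix (Σ ℓ, Fin (r ℓ)) (Fin a × Fin d) ℝ}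
    {β : (Σ ℓ, Fin (r ℓ)) → ℝ} {ℓ : Fin L}
    (hM : ∀ s t, Measurable fun S : Fin a × Fin d → Fin a × Fin d → ℝ =>
      M (r ℓ) (blockMat C ℓ) (Matrix.of S) s t) {n : Fin a → ℕ}
    {S : Z → Matrix (Fin a × Fin d) (Fin a × Fin d) ℝ} (hS : ∀ p q, Measurable fun z => S z p q)
    {x : Z → Sample d n} (hx : Measurable x) :
    Measurable fun z => testStat M C β (S z) (x z) ℓ :=
  measurable_quadForm _ hM hS fun s =>
    (measurable_mulVec_apply _ (measurable_pooledMean.comp hx) s).sub_const _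

end Measurability

end QFMCT

end

noncomputable section

namespace QFMCT

/-! ### Consistency of the resampled moments -/

section Transfer

variable {Ω Ω' E F : Type*} [MeasurableSpace Ω] [MeasurableSpace Ω'] [TopologicalSpace E]
  [TopologicalSpace F] {P : Measure Ω} {P' : Measure Ω'} {X : ℕ → Ω → E} {c : E}

lemma ConvInProb.comp_measurePreserving (hX : ConvInProb P X c) {f : Ω' → Ω}
    (hf : MeasurePreserving f P' P) : ConvInProb P' (fun ν ω => X ν (f ω)) c := fun U hU => by
  refine tendsto_of_tendsto_of_tendsto_of_le_of_le tendsto_const_nhds (hX U hU)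
    (fun _ => zero_le) fun ν => ?_
  -- This inequality holds for arbitrary sets, so the events need not be measurable.
  have := Measure.le_map_apply hf.aemeasurable {ω | X ν ω ∉ U}
  rwa [hf.map_eq] at this

lemma ConvInProb.comp_continuousOn (hX : ConvInProb P X c) {f : E → F} {s : Set E}
    (hf : ContinuousOn f s) (hc : c ∈ s) (hs : ∀ ν ω, X ν ω ∈ s) :
    ConvInProb P (fun ν ω => f (X ν ω)) (f c) := fun U hU => by
  obtain ⟨V, hV, hVU⟩ := mem_nhdsWithin_iff_exists_mem_nhds_inter.1 (hf c hc hU)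
  exact tendsto_measure_zero_of_subset (hX V hV) (Eventually.of_forall fun ν ω hω hV' =>
    hω (hVU ⟨hV', hs ν ω⟩))

end Transfer

/-! ### Block diagonal roots and the moments of resampled data. -/

section DirectSum

variable {a d : ℕ}

lemma directSum_mulVec_apply (S : Fin a → Matrix (Fin d) (Fin d) ℝ) (v : Fin a × Fin d → ℝ)
    (q : Fin a × Fin d) : (directSum S *ᵥ v) q = (S q.1 *ᵥ fun j => v (q.1, j)) q.2 := by
  simp only [directSum, mulVec, dotProduct, of_apply, Fintype.sum_prod_type, ite_mul, zero_mul]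
  rw [Finset.sum_eq_single q.1 (fun i _ hi => by simp [hi.symm]) (by simp)]
  simp

lemma directSum_mul_transpose (S : Fin a → Matrix (Fin d) (Fin d) ℝ) :
    directSum S * (directSum S)ᵀ = directSum fun i => S i * (S i)ᵀ := by
  ext ⟨i, j⟩ ⟨i', j'⟩
  simp only [directSum, Matrix.mul_apply, transpose_apply, of_apply, Fintype.sum_prod_type,
    ite_mul, zero_mul]
  rw [Finset.sum_eq_single i (fun k _ hk => by simp [hk.symm]) (by simp)]
  by_cases h : i = i'
  · subst h; simp
  · simp [h, Ne.symm h]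

lemma continuous_directSum :
    Continuous (directSum : (Fin a → Matrix (Fin d) (Fin d) ℝ) → _) := by
  refine continuous_matrix fun p q => ?_
  simp only [directSum, of_apply]
  split_ifs
  · exact (continuous_apply p.1).matrix_elem _ _
  · exact continuous_const

open scoped MatrixOrder in
/-- Direct sum of multiples of square roots of covariance matrices. -/
def covRoot (c : Fin a → ℝ) (V : Fin a → Matrix (Fin d) (Fin d) ℝ) :
    Matrix (Fin a × Fin d) (Fin a × Fin d) ℝ :=
  directSum fun i => √(c i) • CFC.sqrt (V i)

lemma covRoot_mul_transpose {c : Fin a → ℝ} (hc : ∀ i, 0 ≤ c i)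
    {V : Fin a → Matrix (Fin d) (Fin d) ℝ} (hV : ∀ i, (V i).PosSemidef) :
    covRoot c V * (covRoot c V)ᵀ = directSum fun i => c i • V i := by
  rw [covRoot, directSum_mul_transpose]
  congr 1
  ext1 i
  rw [transpose_smul, smul_mul_smul_comm, Real.mul_self_sqrt (hc i), sqrt_mul_transpose_sqrt (hV i)]

/-- The factor `√N / n` splits as `√(N / n)`, absorbed in the root, times `1 / √n`, absorbed in the
noise. -/
lemma sqrt_smul_pooledMean_resample {n : Fin a → ℕ} (x : Sample d n)
    (w : Fin a × ℕ → EuclideanSpace ℝ (Fin d)) :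
    √(totalSize n : ℝ) • pooledMean (resample x w) =
      covRoot (fun i => (totalSize n : ℝ) / n i) (fun i => empCov (x i)) *ᵥ noiseMean n w := by
  ext ⟨i, j⟩
  rw [covRoot, directSum_mulVec_apply]
  simp only [Pi.smul_apply, pooledMean, resample, smul_eq_mul, Matrix.smul_apply, noiseMean, mulVec,
    dotProduct, Finset.mul_sum, Finset.sum_div]
  rw [Finset.sum_comm]
  refine Finset.sum_congr rfl fun j' _ => Finset.sum_congr rfl fun k _ => ?_
  rw [Real.sqrt_div (Nat.cast_nonneg _)]
  have h : ((n i : ℝ))⁻¹ = (√(n i : ℝ))⁻¹ * (√(n i : ℝ))⁻¹ := by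
    rw [← mul_inv, Real.mul_self_sqrt (Nat.cast_nonneg _)]
  rw [div_eq_mul_inv, div_eq_mul_inv, h]
  ring

open scoped MatrixOrder in
lemma pooledCov_resample {n : Fin a → ℕ} (x : Sample d n)
    (w : Fin a × ℕ → EuclideanSpace ℝ (Fin d)) :
    pooledCov (resample x w) = directSum fun i => ((totalSize n : ℝ) / n i) •
      (CFC.sqrt (empCov (x i)) * (empCov fun k : Fin (n i) => w (i, k)) *
        (CFC.sqrt (empCov (x i)))ᵀ) := by
  rw [pooledCov]
  congr 1
  ext1 i
  rw [← empCov_linear]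
  rfl

end DirectSum

/-! ### Consistency of the bootstrap covariance matrices and their roots on the product space. -/

section Consistency

variable {Ω : Type*} [MeasurableSpace Ω] {P : Measure Ω} [IsProbabilityMeasure P] {a d : ℕ}
  {ε : Fin a → ℕ → Ω → EuclideanSpace ℝ (Fin d)} {Sig : Fin a → Matrix (Fin d) (Fin d) ℝ}
  {n : ℕ → Fin a → ℕ} {κ : Fin a → ℝ}

lemma convInProb_empCov_observations (hε : IsErrorModel P ε Sig) (hn : IsProportionalDesign n κ)
    (μ : Fin a → EuclideanSpace ℝ (Fin d)) (i : Fin a) :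
    ConvInProb P (fun ν ω => empCov (observations μ ε (n ν) ω i)) (Sig i) := by
  refine ((convInProb_empCov_errors hε i).subseq (hn.size_tendsto i)).congr
    (Eventually.of_forall fun ν ω => ?_)
  exact (empCov_add_const (μ i) fun k : Fin (n ν i) => ε i k ω).symm

open scoped MatrixOrder in
lemma convInProb_sqrt_empCov_observations (hε : IsErrorModel P ε Sig)
    (hn : IsProportionalDesign n κ) (μ : Fin a → EuclideanSpace ℝ (Fin d)) (i : Fin a) :
    ConvInProb (P.prod (noise a d))
      (fun ν q => CFC.sqrt (empCov (observations μ ε (n ν) q.1 i))) (CFC.sqrt (Sig i)) :=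
  ((convInProb_empCov_observations hε hn μ i).comp_continuousOn continuousOn_sqrt_posSemidef
    (hε.posSemidef i) fun _ _ => posSemidef_empCov _).comp_measurePreserving measurePreserving_fst

lemma convInProb_covRoot (hε : IsErrorModel P ε Sig) (hn : IsProportionalDesign n κ)
    (μ : Fin a → EuclideanSpace ℝ (Fin d)) :
    ConvInProb (P.prod (noise a d)) (fun ν q =>
      covRoot (fun i => (totalSize (n ν) : ℝ) / n ν i)
        (fun i => empCov (observations μ ε (n ν) q.1 i))) (covRoot (fun i => (κ i)⁻¹) Sig) := by
  refine (ConvInProb.pi fun i => ?_).comp continuous_directSum.continuousAt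
  exact (ConvInProb.of_tendsto (hn.inv_ratio_tendsto i).sqrt).comp₂
    (convInProb_sqrt_empCov_observations hε hn μ i) (f := fun s A => s • A)
    continuous_smul.continuousAt

/-- The noise is itself an error model with unit covariance, so the same weak law gives empirical
noise covariances tending to `1`; conjugation by the consistent roots restores `Sig i`. -/
lemma convInProb_pooledCov_resample (hε : IsErrorModel P ε Sig) (hn : IsProportionalDesign n κ)
    (μ : Fin a → EuclideanSpace ℝ (Fin d)) :
    ConvInProb (P.prod (noise a d)) (fun ν q =>
      pooledCov (resample (observations μ ε (n ν) q.1) q.2)) (limitCov κ Sig) := by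
  simp only [pooledCov_resample]
  refine (ConvInProb.pi fun i => ?_).comp continuous_directSum.continuousAt
  have hw : ConvInProb (P.prod (noise a d)) (fun ν q => empCov fun k : Fin (n ν i) => q.2 (i, k)) 1 :=
    ((convInProb_empCov_errors isErrorModel_noise i).subseq
      (hn.size_tendsto i)).comp_measurePreserving measurePreserving_snd
  have h := (convInProb_sqrt_empCov_observations hε hn μ i).comp₂ hw (f := fun A B => A * B * Aᵀ)
    (by fun_prop)
  have h2 := (ConvInProb.of_tendsto (hn.inv_ratio_tendsto i)).comp₂ h (f := fun s A => s • A)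
    continuous_smul.continuousAt
  rwa [mul_one, sqrt_mul_transpose_sqrt (hε.posSemidef i)] at h2

end Consistency

end QFMCT

end

noncomputable section

namespace QFMCT

/-! ### Asymptotics of the bootstrap statistics -/

section Events

variable {Ω E : Type*} [MeasurableSpace Ω] [MeasurableSpace E] {P : Measure Ω} {Γ : Measure E}
  [IsProbabilityMeasure Γ] {L : ℕ} {Y : Fin L → E → ℝ}

lemma IsRegularLimit.exists_measure_near_le (hY : IsRegularLimit Γ Y) (ℓ : Fin L) (u : ℝ)
    {η : ENNReal} (hη : 0 < η) : ∃ δ > 0, Γ {g | dist (Y ℓ g) u ≤ δ} ≤ η := by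
  have := Measure.isProbabilityMeasure_map (μ := Γ) (hY.measurable ℓ).aemeasurable
  have h := tendsto_measure_cthickening_of_isClosed (μ := Γ.map (Y ℓ)) (s := {u})
    ⟨1, one_pos, measure_ne_top _ _⟩ isClosed_singleton
  rw [Measure.map_apply (hY.measurable ℓ) (measurableSet_singleton u)] at h
  have h0 : Γ (Y ℓ ⁻¹' {u}) = 0 := hY.measure_eq ℓ u
  rw [h0] at h
  obtain ⟨δ, hδ, h⟩ := ((h.mono_left nhdsWithin_le_nhds).eventually (gt_mem_nhds hη)).and
    (self_mem_nhdsWithin (a := (0 : ℝ)) (s := Set.Ioi 0)) |>.exists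
  refine ⟨δ, h, ?_⟩
  rw [Metric.cthickening_singleton _ (le_of_lt h), Measure.map_apply (hY.measurable ℓ)
    Metric.isClosed_closedBall.measurableSet] at hδ
  exact hδ.le

/-- Exceedance events of asymptotically equivalent statistics are asymptotically equivalent. -/
lemma IsRegularLimit.tendsto_measure_symmDiff (hY : IsRegularLimit Γ Y) {X : ℕ → Ω → Fin L → ℝ}
    {G : ℕ → Ω → E} (hG : ∀ ν, Measurable (G ν)) (hmap : ∀ᶠ ν in atTop, P.map (G ν) = Γ)
    (hX : ∀ ℓ, ConvInProb P (fun ν ω => X ν ω ℓ - Y ℓ (G ν ω)) 0) (T : Finset (Fin L))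
    (u : Fin L → ℝ) :
    Tendsto (fun ν => P (symmDiff {ω | ∃ ℓ ∈ T, u ℓ < X ν ω ℓ}
      (G ν ⁻¹' {g | ∃ ℓ ∈ T, u ℓ < Y ℓ g}))) atTop (𝓝 0) := by
  have h1 : ∀ ℓ, Tendsto (fun ν => P (symmDiff {ω | u ℓ < X ν ω ℓ}
      {ω | u ℓ < Y ℓ (G ν ω)})) atTop (𝓝 0) := fun ℓ => by
    rw [ENNReal.tendsto_nhds_zero]
    intro η hη
    obtain ⟨δ, hδ, hδη⟩ := hY.exists_measure_near_le ℓ (u ℓ) (ENNReal.half_pos hη.ne')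
    have h2 := (ENNReal.tendsto_nhds_zero.1 (convInProb_iff_dist.1 (hX ℓ) δ hδ)) (η / 2)
      (ENNReal.half_pos hη.ne')
    filter_upwards [h2, hmap] with ν hν hm
    rw [← ENNReal.add_halves η]
    refine (measure_mono (t := {ω | δ ≤ dist (X ν ω ℓ - Y ℓ (G ν ω)) 0} ∪
      G ν ⁻¹' {g | dist (Y ℓ g) (u ℓ) ≤ δ}) fun ω hω => ?_).trans
      ((measure_union_le _ _).trans (add_le_add hν ?_))
    -- If `X` is within `δ` of `Y` while `Y` is further than `δ` from the threshold, both lie on the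
    -- same side of it.
    · by_contra hcon
      simp only [Set.mem_union, Set.mem_ofPred_eq, Set.mem_preimage, not_or, not_le,
        Real.dist_eq, sub_zero] at hcon
      obtain ⟨h3, h4⟩ := hcon
      rw [abs_lt] at h3
      rw [lt_abs] at h4
      simp only [Set.mem_symmDiff, Set.mem_ofPred_eq, not_lt] at hω
      rcases hω with ⟨h5, h6⟩ | ⟨h5, h6⟩ <;> rcases h4 with h4 | h4 <;> linarith
    · rw [← Measure.map_apply (hG ν), hm]
      · exact hδη
      · exact measurableSet_le ((hY.measurable ℓ).dist measurable_const) measurable_const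
  refine tendsto_measure_zero_of_subset (tendsto_measure_zero_iUnion h1)
    (Eventually.of_forall fun ν ω hω => ?_)
  simp only [Set.mem_iUnion, Set.mem_symmDiff, Set.mem_ofPred_eq, Set.mem_preimage] at hω ⊢
  grind

end Events

/-! ### Coupling the bootstrap statistics with fixed quadratic forms in normal vectors. -/

section Bootstrap

variable {Ω : Type*} [MeasurableSpace Ω] {P : Measure Ω} [IsProbabilityMeasure P] {a d L : ℕ}

lemma measurePreserving_prod_eval (b : ℕ) :
    MeasurePreserving (fun q : Ω × (ℕ → Fin a × ℕ → EuclideanSpace ℝ (Fin d)) => (q.1, q.2 b))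
      (P.prod (noiseSeq a d)) (P.prod (noise a d)) :=
  (MeasurePreserving.id P).prod (measurePreserving_eval_infinitePi (fun _ : ℕ => noise a d) b)

lemma measurable_resample_comp {n : Fin a → ℕ} {X : Ω → Sample d n} (hX : Measurable X) :
    Measurable fun q : Ω × (Fin a × ℕ → EuclideanSpace ℝ (Fin d)) => resample (X q.1) q.2 := by
  have h : Measurable fun q : Ω × (Fin a × ℕ → EuclideanSpace ℝ (Fin d)) => (X q.1, q.2) :=
    (hX.comp measurable_fst).prodMk measurable_snd
  have h2 := measurable_resample.comp h
  exact h2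

/-- A parametric bootstrap sample has the law of resampled noise. -/
lemma IsParametricBootstrap.map_apply_eq {n : Fin a → ℕ} {X : Ω → Sample d n} (hX : Measurable X)
    {Xstar : ℕ → Ω → Sample d n} (h : IsParametricBootstrap P X Xstar) (b : ℕ) :
    P.map (Xstar b) = (P.prod (noise a d)).map fun q => resample (X q.1) q.2 := by
  have h1 := congrArg (Measure.map fun s : ℕ → Sample d n => s b) (h.map_eq hX)
  have hF : Measurable fun q : Ω × (ℕ → Fin a × ℕ → EuclideanSpace ℝ (Fin d)) =>
      resampleSeq (X q.1, q.2) :=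
    measurable_resampleSeq.comp ((hX.comp measurable_fst).prodMk measurable_snd)
  rw [Measure.map_map (measurable_pi_apply b) (measurable_pi_lambda _ h.measurable),
    Measure.map_map (measurable_pi_apply b) hF] at h1
  rw [← (measurePreserving_prod_eval (P := P) (a := a) (d := d) b).map_eq,
    Measure.map_map (measurable_resample_comp hX)
      (measurePreserving_prod_eval (P := P) b).measurable]
  exact h1

variable {ε : Fin a → ℕ → Ω → EuclideanSpace ℝ (Fin d)} {Sig : Fin a → Matrix (Fin d) (Fin d) ℝ}
  {n : ℕ → Fin a → ℕ} {κ : Fin a → ℝ} {μ : Fin a → EuclideanSpace ℝ (Fin d)} {r : Fin L → ℕ}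
  {C : Matrix (Σ ℓ, Fin (r ℓ)) (Fin a × Fin d) ℝ} {M : WeightFunction a d}
  {Xstar : (ν : ℕ) → ℕ → Ω → Sample d (n ν)}

/-- Plug-in consistency is given for an actual bootstrap replicate. Equality of laws carries the
consistency of the resampled covariance matrix to that replicate, and the conclusion about `M` back
to the product space. -/
lemma convInProb_weight_resample (hε : IsErrorModel P ε Sig) (hn : IsProportionalDesign n κ)
    (hXstar : ∀ ν, IsParametricBootstrap P (observations μ ε (n ν)) (Xstar ν)) {ℓ : Fin L}
    (hM : ∀ s t, Measurable fun S : Fin a × Fin d → Fin a × Fin d → ℝ =>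
      M (r ℓ) (blockMat C ℓ) (Matrix.of S) s t)
    (hM_boot : PlugInConsistent P (M (r ℓ) (blockMat C ℓ))
      (fun ν ω => pooledCov (Xstar ν 0 ω)) (limitCov κ Sig)) :
    ConvInProb (P.prod (noise a d)) (fun ν q => M (r ℓ) (blockMat C ℓ)
      (pooledCov (resample (observations μ ε (n ν) q.1) q.2)))
      (M (r ℓ) (blockMat C ℓ) (limitCov κ Sig)) := by
  have hX : ∀ ν, Measurable (observations μ ε (n ν)) := fun ν => measurable_observations hε μ _
  have hlaw := fun ν => (hXstar ν).map_apply_eq (hX ν) 0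
  have hS := tendstoInProb_iff_convInProb.2 (convInProb_pooledCov_resample hε hn μ)
  have hS' : TendstoInProb P (fun ν ω => pooledCov (Xstar ν 0 ω)) (limitCov κ Sig) := fun p q =>
    convInProb_iff_tendstoInMeasure.1 (ConvInProb.of_map_eq
      (f := fun ν (x : Sample d (n ν)) => pooledCov x p q)
      (fun ν => measurable_pooledCov_apply p q) (fun ν => measurable_resample_comp (hX ν))
      (fun ν => (hXstar ν).measurable 0) (fun ν => (hlaw ν).symm)
      (convInProb_iff_tendstoInMeasure.2 (hS p q)))
  refine tendstoInProb_iff_convInProb.1 fun s t => convInProb_iff_tendstoInMeasure.1 ?_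
  have hm : ∀ ν, Measurable fun x : Sample d (n ν) => M (r ℓ) (blockMat C ℓ) (pooledCov x) s t :=
    fun ν => (hM s t).comp (measurable_pi_lambda _ fun p => measurable_pi_lambda _ fun q =>
      measurable_pooledCov_apply p q)
  exact ConvInProb.of_map_eq hm (fun ν => (hXstar ν).measurable 0)
      (fun ν => measurable_resample_comp (hX ν)) hlaw
      (convInProb_iff_tendstoInMeasure.2 (hM_boot hS' s t))

/-- The matrix of the quadratic form of standard normal variables that is the limit in law of a
test statistic. -/
def limitForm (M : WeightFunction a d) (C : Matrix (Σ ℓ, Fin (r ℓ)) (Fin a × Fin d) ℝ)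
    (κ : Fin a → ℝ) (Sig : Fin a → Matrix (Fin d) (Fin d) ℝ) (ℓ : Fin L) :
    Matrix (Fin a × Fin d) (Fin a × Fin d) ℝ :=
  (covRoot (fun i => (κ i)⁻¹) Sig)ᵀ * weightMatrix (blockMat C ℓ) (limitCov κ Sig)
    (M (r ℓ) (blockMat C ℓ) (limitCov κ Sig)) * covRoot (fun i => (κ i)⁻¹) Sig

lemma mulVec_form {p q : Type*} [Fintype p] [Fintype q] (D : Matrix p q ℝ) (A : Matrix p p ℝ)
    (g : q → ℝ) : (D *ᵥ g) ⬝ᵥ A *ᵥ (D *ᵥ g) = g ⬝ᵥ (Dᵀ * A * D) *ᵥ g := by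
  rw [← mulVec_mulVec, ← mulVec_mulVec, dotProduct_mulVec g Dᵀ, vecMul_transpose]

/-- The statistic is exactly a quadratic form in `noiseMean` with a matrix tending to `limitForm`;
each entry of the difference is a null sequence times a product of two coordinates of fixed law. -/
lemma convInProb_bootStat_sub (hε : IsErrorModel P ε Sig) (hn : IsProportionalDesign n κ)
    (hXstar : ∀ ν, IsParametricBootstrap P (observations μ ε (n ν)) (Xstar ν)) {ℓ : Fin L}
    (hM : ∀ s t, Measurable fun S : Fin a × Fin d → Fin a × Fin d → ℝ =>
      M (r ℓ) (blockMat C ℓ) (Matrix.of S) s t)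
    (hM_boot : PlugInConsistent P (M (r ℓ) (blockMat C ℓ))
      (fun ν ω => pooledCov (Xstar ν 0 ω)) (limitCov κ Sig))
    (ht : 0 < formTrace M (blockMat C ℓ) (limitCov κ Sig)) :
    ConvInProb (P.prod (noise a d)) (fun ν q =>
      bootStat M C (resample (observations μ ε (n ν) q.1) q.2) ℓ -
        noiseMean (n ν) q.2 ⬝ᵥ limitForm M C κ Sig ℓ *ᵥ noiseMean (n ν) q.2) 0 := by
  have hA := (convInProb_pooledCov_resample hε hn μ).comp₂
    (convInProb_weight_resample hε hn hXstar hM hM_boot)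
    (continuousAt_weightMatrix (C := blockMat C ℓ) ht)
  have hK := (convInProb_covRoot hε hn μ).comp₂ hA (f := fun D A => Dᵀ * A * D) (by fun_prop)
  have hterm : ∀ p p' : Fin a × Fin d, ConvInProb (P.prod (noise a d)) (fun ν q =>
      (((covRoot (fun i => (totalSize (n ν) : ℝ) / n ν i)
        (fun i => empCov (observations μ ε (n ν) q.1 i)))ᵀ *
        weightMatrix (blockMat C ℓ) (pooledCov (resample (observations μ ε (n ν) q.1) q.2))
          (M (r ℓ) (blockMat C ℓ) (pooledCov (resample (observations μ ε (n ν) q.1) q.2))) *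
        covRoot (fun i => (totalSize (n ν) : ℝ) / n ν i)
        (fun i => empCov (observations μ ε (n ν) q.1 i))) p p' - limitForm M C κ Sig ℓ p p') *
      (noiseMean (n ν) q.2 p * noiseMean (n ν) q.2 p')) 0 := fun p p' => by
    have h1 := hK.comp (f := fun K => K p p' - limitForm M C κ Sig ℓ p p')
      (((continuous_id.matrix_elem p p').sub continuous_const).continuousAt)
    rw [← limitForm, sub_self] at h1
    refine h1.mul_of_map_eq (Γ := stdNormal (Fin a × Fin d))
      (G := fun ν q => noiseMean (n ν) q.2) (f := fun g => g p * g p')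
      (fun ν => (measurable_noiseMean _).comp measurable_snd)
      (hn.eventually_ne_zero.mono fun ν hν => ?_)
      ((measurable_pi_apply p).mul (measurable_pi_apply p'))
    have h2 := Measure.map_map (μ := P.prod (noise a d)) (measurable_noiseMean (n ν)) measurable_snd
    rw [measurePreserving_snd.map_eq, map_noiseMean hν] at h2
    exact h2.symm
  have hsum := ConvInProb.sum Finset.univ fun p _ => ConvInProb.sum Finset.univ fun p' _ =>
    hterm p p'
  simp only [Finset.sum_const_zero] at hsum
  refine hsum.congr (Eventually.of_forall fun ν q => ?_)
  rw [bootStat, quadForm_mulVec, sqrt_smul_pooledMean_resample, mulVec_form, ← dotProduct_sub,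
    ← sub_mulVec]
  simp only [dotProduct, mulVec, Finset.mul_sum, Matrix.sub_apply]
  refine Finset.sum_congr rfl fun p _ => Finset.sum_congr rfl fun p' _ => by ring

end Bootstrap

end QFMCT

end

noncomputable section

namespace QFMCT

/-! ### Convergence of the critical values -/

section CriticalValue

variable {Ω : Type*} [MeasurableSpace Ω] {P : Measure Ω} [IsProbabilityMeasure P] {a d L : ℕ}
  {ε : Fin a → ℕ → Ω → EuclideanSpace ℝ (Fin d)} {Sig : Fin a → Matrix (Fin d) (Fin d) ℝ}
  {n : ℕ → Fin a → ℕ} {κ : Fin a → ℝ} {μ : Fin a → EuclideanSpace ℝ (Fin d)} {r : Fin L → ℕ}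
  {C : Matrix (Σ ℓ, Fin (r ℓ)) (Fin a × Fin d) ℝ} {M : WeightFunction a d}
  {Xstar : (ν : ℕ) → ℕ → Ω → Sample d (n ν)} {B : ℕ → ℕ}

lemma iIndepFun_noiseMean (n : Fin a → ℕ) :
    iIndepFun (fun (b : ℕ) (q : Ω × (ℕ → Fin a × ℕ → EuclideanSpace ℝ (Fin d))) =>
      noiseMean n (q.2 b)) (P.prod (noiseSeq a d)) := by
  have h1 : iIndepFun (fun (b : ℕ) (z : ℕ → Fin a × ℕ → EuclideanSpace ℝ (Fin d)) =>
      noiseMean n (z b)) (noiseSeq a d) :=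
    iIndepFun_infinitePi (X := fun _ => noiseMean n) fun _ => measurable_noiseMean n
  have hm : ∀ b, Measurable fun z : ℕ → Fin a × ℕ → EuclideanSpace ℝ (Fin d) =>
      noiseMean n (z b) := fun b => (measurable_noiseMean n).comp (measurable_pi_apply b)
  rw [iIndepFun_iff_map_fun_eq_infinitePi_map hm] at h1
  have hm2 : ∀ b, Measurable fun q : Ω × (ℕ → Fin a × ℕ → EuclideanSpace ℝ (Fin d)) =>
      noiseMean n (q.2 b) := fun b => (hm b).comp measurable_snd
  rw [iIndepFun_iff_map_fun_eq_infinitePi_map hm2]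
  have h2 : ∀ {F : Type _} [MeasurableSpace F]
      {f : (ℕ → Fin a × ℕ → EuclideanSpace ℝ (Fin d)) → F}, Measurable f →
      (P.prod (noiseSeq a d)).map (fun q => f q.2) = (noiseSeq a d).map f := fun hf => by
    have h := Measure.map_map (μ := P.prod (noiseSeq a d)) hf measurable_snd
    rw [measurePreserving_snd.map_eq] at h
    exact h.symm
  rw [h2 (measurable_pi_lambda _ hm), h1]
  congr 1
  ext1 b
  exact (h2 (hm b)).symm

lemma measurableSet_exists_lt_bootStat {n : Fin a → ℕ}
    (hM : ∀ ℓ s t, Measurable fun S : Fin a × Fin d → Fin a × Fin d → ℝ =>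
      M (r ℓ) (blockMat C ℓ) (Matrix.of S) s t) (T : Finset (Fin L)) (u : Fin L → ℝ) :
    MeasurableSet {x : Sample d n | ∃ ℓ ∈ T, u ℓ < bootStat M C x ℓ} := by
  have : {x : Sample d n | ∃ ℓ ∈ T, u ℓ < bootStat M C x ℓ} =
      ⋃ ℓ ∈ T, {x | u ℓ < bootStat M C x ℓ} := by ext; simp
  rw [this]
  exact T.measurableSet_biUnion fun ℓ _ => measurableSet_lt measurable_const
    (measurable_bootStat (hM ℓ))

/-- Each pair of the data and one noise vector has the same law, so the probability of mismatch with
the independent approximating event does not depend on `b`, and the perturbed weak law applies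
however dependent the replicates are. The frequency is a function of the whole bootstrap sequence,
so its limit carries over from the product space. -/
lemma convInProb_bootstrap_freq (hε : IsErrorModel P ε Sig) (hn : IsProportionalDesign n κ)
    (hXstar : ∀ ν, IsParametricBootstrap P (observations μ ε (n ν)) (Xstar ν))
    (hM : ∀ ℓ s t, Measurable fun S : Fin a × Fin d → Fin a × Fin d → ℝ =>
      M (r ℓ) (blockMat C ℓ) (Matrix.of S) s t)
    (hM_boot : ∀ ℓ, PlugInConsistent P (M (r ℓ) (blockMat C ℓ))
      (fun ν ω => pooledCov (Xstar ν 0 ω)) (limitCov κ Sig))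
    (ht : ∀ ℓ, 0 < formTrace M (blockMat C ℓ) (limitCov κ Sig))
    (hY : IsRegularLimit (stdNormal (Fin a × Fin d))
      fun ℓ g => g ⬝ᵥ limitForm M C κ Sig ℓ *ᵥ g)
    (hB : Tendsto B atTop atTop) (T : Finset (Fin L)) (u : Fin L → ℝ) :
    ConvInProb P (fun ν ω => (Nat.card {b : Fin (B ν) //
      ∃ ℓ ∈ T, u ℓ < bootStat M C (Xstar ν b ω) ℓ} : ℝ) / B ν)
      ((stdNormal (Fin a × Fin d)).real
        {g | ∃ ℓ ∈ T, u ℓ < g ⬝ᵥ limitForm M C κ Sig ℓ *ᵥ g}) := by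
  have hX : ∀ ν, Measurable (observations μ ε (n ν)) := fun ν => measurable_observations hε μ _
  set S := {g : Fin a × Fin d → ℝ | ∃ ℓ ∈ T, u ℓ < g ⬝ᵥ limitForm M C κ Sig ℓ *ᵥ g} with hS
  have hlaw : ∀ᶠ ν in atTop, (P.prod (noise a d)).map (fun q => noiseMean (n ν) q.2) =
      stdNormal (Fin a × Fin d) := hn.eventually_ne_zero.mono fun ν hν => by
    have h2 := Measure.map_map (μ := P.prod (noise a d)) (measurable_noiseMean (n ν)) measurable_snd
    rw [measurePreserving_snd.map_eq, map_noiseMean hν] at h2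
    exact h2.symm
  have hG : ∀ ν, Measurable fun q : Ω × (Fin a × ℕ → EuclideanSpace ℝ (Fin d)) =>
      noiseMean (n ν) q.2 := fun ν => (measurable_noiseMean (n ν)).comp measurable_snd
  have hdiff := fun ℓ => convInProb_bootStat_sub (C := C) (M := M) (ℓ := ℓ) hε hn hXstar (hM ℓ)
    (hM_boot ℓ) (ht ℓ)
  have hsymm := hY.tendsto_measure_symmDiff (P := P.prod (noise a d))
    (X := fun ν (q : Ω × (Fin a × ℕ → EuclideanSpace ℝ (Fin d))) =>
      bootStat M C (resample (observations μ ε (n ν) q.1) q.2))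
    (G := fun ν (q : Ω × (Fin a × ℕ → EuclideanSpace ℝ (Fin d))) => noiseMean (n ν) q.2)
    hG hlaw hdiff T u
  have hev : ∀ ν, MeasurableSet {q : Ω × (Fin a × ℕ → EuclideanSpace ℝ (Fin d)) |
      ∃ ℓ ∈ T, u ℓ < bootStat M C (resample (observations μ ε (n ν) q.1) q.2) ℓ} := fun ν => by
    have h := measurable_resample_comp (hX ν)
    have h2 := h (measurableSet_exists_lt_bootStat hM T u)
    exact h2
  have hSm : MeasurableSet S := hY.measurableSet_exists_lt T u
  have hmp := measurePreserving_prod_eval (P := P) (a := a) (d := d)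
  have hfreq := convInProb_freq (P := P.prod (noiseSeq a d)) hB
    (Y := fun ν b q => noiseMean (n ν) (q.2 b))
    (A := fun ν b => {q | ∃ ℓ ∈ T,
      u ℓ < bootStat M C (resample (observations μ ε (n ν) q.1) (q.2 b)) ℓ})
    (Γ := stdNormal (Fin a × Fin d)) (S := S) ?_ ?_ ?_ hSm ?_ hsymm ?_
  rotate_left
  · intro ν b
    have h := (hG ν).comp (hmp b).measurable
    exact h
  · exact fun ν => iIndepFun_noiseMean (n ν)
  · refine hlaw.mono fun ν hν b => ?_
    have h := Measure.map_map (hG ν) (hmp b).measurable (μ := P.prod (noiseSeq a d))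
    rw [(hmp b).map_eq, hν] at h
    exact h.symm
  · intro ν b
    have h := (hmp b).measurable (hev ν)
    exact h
  -- The mismatch event for replicate `b` is the preimage, under a measure preserving map, of one
  -- event for a single noise vector.
  · refine Eventually.of_forall fun ν b => ?_
    have h := (hmp b).measure_preimage ((hev ν).symmDiff (hG ν hSm)).nullMeasurableSet
    exact h.le
  have hm : ∀ ν, Measurable fun s : ℕ → Sample d (n ν) => (Nat.card {b : Fin (B ν) //
      ∃ ℓ ∈ T, u ℓ < bootStat M C (s b) ℓ} : ℝ) / B ν := fun ν => by
    refine measurable_natCard_div fun b => ?_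
    have h := measurable_pi_apply (X := fun _ : ℕ => Sample d (n ν)) (b : ℕ)
    have h2 := h (measurableSet_exists_lt_bootStat hM T u)
    exact h2
  have hF : ∀ ν, Measurable fun q : Ω × (ℕ → Fin a × ℕ → EuclideanSpace ℝ (Fin d)) =>
      resampleSeq (observations μ ε (n ν) q.1, q.2) := fun ν =>
    measurable_resampleSeq.comp (((hX ν).comp measurable_fst).prodMk measurable_snd)
  have hXs : ∀ ν, Measurable fun ω b => Xstar ν b ω := fun ν =>
    measurable_pi_lambda _ (hXstar ν).measurable
  have hfin := ConvInProb.of_map_eq hm hF hXs (fun ν => ((hXstar ν).map_eq (hX ν)).symm) hfreq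
  exact hfin

end CriticalValue

end QFMCT

end

noncomputable section

namespace QFMCT

/-! ### The tests -/

section Rejection

variable {L : ℕ}

open Classical in
lemma familyRejection_eq (T : Finset (Fin L)) (Q q : Fin L → ℝ) :
    familyRejection T Q q = if ∃ ℓ ∈ T, 1 < ratio (Q ℓ) (q ℓ) then 1 else 0 := by
  rw [familyRejection]
  split_ifs with h
  · obtain ⟨ℓ, hℓ, h⟩ := h
    have h1 : (T.sup fun ℓ => if 1 < ratio (Q ℓ) (q ℓ) then (1 : ℕ) else 0) = 1 := by
      refine le_antisymm (Finset.sup_le fun ℓ _ => by split_ifs <;> simp) ?_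
      have := Finset.le_sup (f := fun ℓ => if 1 < ratio (Q ℓ) (q ℓ) then (1 : ℕ) else 0) hℓ
      simpa only [if_pos h] using this
    rw [h1, Nat.cast_one]
  · push Not at h
    have h1 : (T.sup fun ℓ => if 1 < ratio (Q ℓ) (q ℓ) then (1 : ℕ) else 0) = 0 := by
      rw [← Nat.le_zero]
      exact Finset.sup_le fun ℓ hℓ => by rw [if_neg (not_lt.2 (h ℓ hℓ))]
    rw [h1, Nat.cast_zero]

lemma globalTest_eq (Q q : Fin L → ℝ) : globalTest Q q = familyRejection Finset.univ Q q := by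
  classical
  rw [familyRejection_eq, globalTest]
  simp only [Finset.lt_sup_iff]

/-- For a positive critical value neither convention about division by zero intervenes, and a
negative `x` is harmless since it is truncated to zero. -/
lemma one_lt_ratio_iff {x q : ℝ} (hq : 0 < q) : 1 < ratio x q ↔ q < x := by
  rw [ratio, if_neg fun h => hq.ne' h.2,
    ENNReal.lt_div_iff_mul_lt (Or.inl (by simpa using hq)) (Or.inl ENNReal.ofReal_ne_top), one_mul,
    ENNReal.ofReal_lt_ofReal_iff_of_nonneg hq.le]

variable {Z : Type*} [MeasurableSpace Z]

lemma measurable_ratio {f g : Z → ℝ} (hf : Measurable f) (hg : Measurable g) :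
    Measurable fun z => ratio (f z) (g z) :=
  Measurable.ite ((hf (measurableSet_singleton 0)).inter (hg (measurableSet_singleton 0)))
    measurable_const (hf.ennreal_ofReal.div hg.ennreal_ofReal)

lemma integral_familyRejection {P : Measure Z} (T : Finset (Fin L)) {Q q : Z → Fin L → ℝ}
    (hQ : ∀ ℓ, Measurable fun z => Q z ℓ) (hq : ∀ ℓ, Measurable fun z => q z ℓ) :
    ∫ z, familyRejection T (Q z) (q z) ∂P =
      P.real {z | ∃ ℓ ∈ T, 1 < ratio (Q z ℓ) (q z ℓ)} := by
  classical
  have hm : MeasurableSet {z | ∃ ℓ ∈ T, 1 < ratio (Q z ℓ) (q z ℓ)} := by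
    have : {z | ∃ ℓ ∈ T, 1 < ratio (Q z ℓ) (q z ℓ)} =
        ⋃ ℓ ∈ T, {z | 1 < ratio (Q z ℓ) (q z ℓ)} := by ext; simp
    rw [this]
    exact T.measurableSet_biUnion fun ℓ _ => measurableSet_lt measurable_const
      (measurable_ratio (hQ ℓ) (hq ℓ))
  rw [← integral_indicator_one hm]
  congr 1
  ext z
  rw [familyRejection_eq]
  simp [Set.indicator_apply]

end Rejection

/-! ### From convergence in law to convergence of rejection probabilities. -/

section Portmanteau

variable {L : ℕ} {Ω E : Type*} [MeasurableSpace Ω] [MeasurableSpace E] {P : Measure Ω}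
  {Γ : Measure E} [IsProbabilityMeasure P] [IsProbabilityMeasure Γ]

lemma isOpen_exists_pos (T : Finset (Fin L)) : IsOpen {x : Fin L → ℝ | ∃ ℓ ∈ T, 0 < x ℓ} := by
  have : {x : Fin L → ℝ | ∃ ℓ ∈ T, 0 < x ℓ} = ⋃ ℓ ∈ T, {x | 0 < x ℓ} := by ext; simp
  rw [this]
  exact isOpen_biUnion fun ℓ _ => isOpen_lt continuous_const (continuous_apply ℓ)

lemma frontier_exists_pos_subset (T : Finset (Fin L)) :
    frontier {x : Fin L → ℝ | ∃ ℓ ∈ T, 0 < x ℓ} ⊆ ⋃ ℓ, {x | x ℓ = 0} := by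
  intro x hx
  rw [(isOpen_exists_pos T).frontier_eq] at hx
  have hcl : IsClosed (⋃ ℓ ∈ T, {x : Fin L → ℝ | 0 ≤ x ℓ}) :=
    T.finite_toSet.isClosed_biUnion fun ℓ _ => isClosed_le continuous_const (continuous_apply ℓ)
  have hsub : {x : Fin L → ℝ | ∃ ℓ ∈ T, 0 < x ℓ} ⊆ ⋃ ℓ ∈ T, {x : Fin L → ℝ | 0 ≤ x ℓ} := by
    rintro y ⟨ℓ, hℓ, h⟩
    exact Set.mem_biUnion hℓ (le_of_lt h : y ∈ {x : Fin L → ℝ | 0 ≤ x ℓ})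
  have h1 := closure_minimal hsub hcl hx.1
  simp only [Set.mem_iUnion, Set.mem_ofPred_eq] at h1 ⊢
  obtain ⟨ℓ, hℓ, h⟩ := h1
  refine ⟨ℓ, le_antisymm ?_ h⟩
  by_contra hlt
  exact hx.2 ⟨ℓ, hℓ, not_le.1 hlt⟩

/-- The boundary of the rejection region lies in the coordinate hyperplanes, which are null for the
limit because the components have no atoms. -/
lemma IsRegularLimit.tendsto_real_exists_pos {Y : Fin L → E → ℝ} (hY : IsRegularLimit Γ Y)
    {c : Fin L → ℝ} {V : ℕ → Ω → Fin L → ℝ}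
    (hV : TendstoInDistribution V atTop (fun g ℓ => Y ℓ g - c ℓ) (fun _ => P) Γ)
    (T : Finset (Fin L)) :
    Tendsto (fun ν => P.real {ω | ∃ ℓ ∈ T, 0 < V ν ω ℓ}) atTop
      (𝓝 (Γ.real {g | ∃ ℓ ∈ T, c ℓ < Y ℓ g})) := by
  have hm := (isOpen_exists_pos T).measurableSet
  have h := ProbabilityMeasure.tendsto_measure_of_null_frontier_of_tendsto' hV.tendsto
    (E := {x : Fin L → ℝ | ∃ ℓ ∈ T, 0 < x ℓ}) ?_
  · simp only [ProbabilityMeasure.coe_mk] at h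
    rw [Measure.map_apply_of_aemeasurable hV.aemeasurable_limit hm] at h
    have h2 := (ENNReal.tendsto_toReal (measure_ne_top _ _)).comp h
    have h3 : (fun (g : E) ℓ => Y ℓ g - c ℓ) ⁻¹' {x : Fin L → ℝ | ∃ ℓ ∈ T, 0 < x ℓ} =
        {g | ∃ ℓ ∈ T, c ℓ < Y ℓ g} := by
      ext g; simp
    rw [h3] at h2
    refine h2.congr fun ν => ?_
    rw [Function.comp_apply, Measure.map_apply_of_aemeasurable (hV.forall_aemeasurable ν) hm]
    rfl
  · refine measure_mono_null (frontier_exists_pos_subset T) (measure_iUnion_null fun ℓ => ?_)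
    rw [ProbabilityMeasure.coe_mk, Measure.map_apply_of_aemeasurable hV.aemeasurable_limit
      (measurableSet_eq_fun (measurable_pi_apply ℓ) measurable_const)]
    have h3 : (fun (g : E) ℓ => Y ℓ g - c ℓ) ⁻¹' {x : Fin L → ℝ | x ℓ = 0} =
        {g | Y ℓ g = c ℓ} := by
      ext g; simp [sub_eq_zero]
    rw [h3]
    exact hY.measure_eq ℓ (c ℓ)

lemma tendsto_real_of_symmDiff {A A' : ℕ → Set Ω} {c : ℝ}
    (hA : Tendsto (fun ν => P.real (A ν)) atTop (𝓝 c)) {D : ℕ → Set Ω}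
    (hD : Tendsto (fun ν => P (D ν)) atTop (𝓝 0)) (h1 : ∀ ν, A ν ⊆ A' ν ∪ D ν)
    (h2 : ∀ ν, A' ν ⊆ A ν ∪ D ν) : Tendsto (fun ν => P.real (A' ν)) atTop (𝓝 c) := by
  have hD' : Tendsto (fun ν => P.real (D ν)) atTop (𝓝 0) := by
    have h := (ENNReal.tendsto_toReal ENNReal.zero_ne_top).comp hD
    rwa [ENNReal.toReal_zero] at h
  refine tendsto_of_tendsto_of_tendsto_of_le_of_le (by simpa using hA.sub hD')
    (by simpa using hA.add hD') (fun ν => ?_) fun ν => ?_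
  · have := (measureReal_mono (μ := P) (h1 ν)).trans (measureReal_union_le _ _)
    simp only
    linarith
  · exact (measureReal_mono (μ := P) (h2 ν)).trans (measureReal_union_le _ _)

end Portmanteau

/-! ### Joint limit law of the test statistics. -/

section Limit

variable {Ω : Type*} [MeasurableSpace Ω] {P : Measure Ω} [IsProbabilityMeasure P] {a d L : ℕ}
  {ε : Fin a → ℕ → Ω → EuclideanSpace ℝ (Fin d)} {Sig : Fin a → Matrix (Fin d) (Fin d) ℝ}
  {n : ℕ → Fin a → ℕ} {κ : Fin a → ℝ} {μ : Fin a → EuclideanSpace ℝ (Fin d)} {r : Fin L → ℕ}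
  {C : Matrix (Σ ℓ, Fin (r ℓ)) (Fin a × Fin d) ℝ} {β : (Σ ℓ, Fin (r ℓ)) → ℝ}
  {M : WeightFunction a d} {Sest : ℕ → Ω → Matrix (Fin a × Fin d) (Fin a × Fin d) ℝ}

lemma covRoot_mul_transpose_eq_limitCov (hε : IsErrorModel P ε Sig) (hκ : ∀ i, 0 < κ i) :
    covRoot (fun i => (κ i)⁻¹) Sig * (covRoot (fun i => (κ i)⁻¹) Sig)ᵀ = limitCov κ Sig :=
  covRoot_mul_transpose (fun i => (inv_pos.2 (hκ i)).le) hε.posSemidef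

lemma posSemidef_limitCov (hε : IsErrorModel P ε Sig) (hκ : ∀ i, 0 < κ i) :
    (limitCov κ Sig).PosSemidef := by
  rw [← covRoot_mul_transpose_eq_limitCov hε hκ, ← conjTranspose_eq_transpose_of_trivial]
  exact posSemidef_self_mul_conjTranspose _

/-- Under a true local hypothesis the test statistic is a quadratic form of the standardized
means. -/
lemma testStat_eq_of_mulVec_stack {Ω : Type*} {ε : Fin a → ℕ → Ω → EuclideanSpace ℝ (Fin d)}
    {ℓ : Fin L} (h : blockMat C ℓ *ᵥ stack μ = blockVec β ℓ)
    (n : Fin a → ℕ) (S : Matrix (Fin a × Fin d) (Fin a × Fin d) ℝ) (ω : Ω) :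
    testStat M C β S (observations μ ε n ω) ℓ = scaledMean μ ε n ω ⬝ᵥ
      weightMatrix (blockMat C ℓ) S (M (r ℓ) (blockMat C ℓ) S) *ᵥ scaledMean μ ε n ω := by
  rw [testStat, ← h, ← mulVec_sub, quadForm_mulVec]
  rfl

lemma measurable_weightMatrix_apply {Z : Type*} [MeasurableSpace Z] {m : ℕ} {p : Type*} [Fintype p]
    [DecidableEq p] (C : Matrix (Fin m) p ℝ) {S : Z → Matrix p p ℝ}
    {W : Z → Matrix (Fin m) (Fin m) ℝ} (hS : ∀ i j, Measurable fun z => S z i j)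
    (hW : ∀ i j, Measurable fun z => W z i j) (i j : p) :
    Measurable fun z => weightMatrix C (S z) (W z) i j := by
  have hH : ∀ i j, Measurable fun z => (Cᵀ * W z * C) i j :=
    measurable_mul_apply (measurable_mul_apply (fun _ _ => measurable_const) hW)
      fun _ _ => measurable_const
  have hHS := measurable_mul_apply hH hS
  have ht : Measurable fun z => ((Cᵀ * W z * C * S z) ^ 2).trace := by
    simp only [sq, trace, diag_apply]
    exact Finset.measurable_sum _ fun i _ => measurable_mul_apply hHS hHS i i
  simp only [weightMatrix, Matrix.smul_apply, smul_eq_mul]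
  exact ((ht.const_mul 2).sqrt.inv.mul
    (Measurable.ite (measurableSet_lt measurable_const ht) measurable_const
      measurable_const)).mul (hH i j)

/-- Joint convergence in law of the quadratic forms of the standardized means, centred at
consistent critical values. -/
lemma tendstoInDistribution_form_sub (hε : IsErrorModel P ε Sig) (hn : IsProportionalDesign n κ)
    (hM : ∀ ℓ s t, Measurable fun S : Fin a × Fin d → Fin a × Fin d → ℝ =>
      M (r ℓ) (blockMat C ℓ) (Matrix.of S) s t)
    (hSest_meas : ∀ ν p q, Measurable fun ω => Sest ν ω p q)
    (hSest : TendstoInProb P Sest (limitCov κ Sig))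
    (hM_est : ∀ ℓ, PlugInConsistent P (M (r ℓ) (blockMat C ℓ)) Sest (limitCov κ Sig))
    (ht : ∀ ℓ, 0 < formTrace M (blockMat C ℓ) (limitCov κ Sig))
    {q : ℕ → Ω → Fin L → ℝ} (hq : ∀ ν ℓ, Measurable fun ω => q ν ω ℓ) {c : Fin L → ℝ}
    (hqc : ∀ ℓ, ConvInProb P (fun ν ω => q ν ω ℓ) (c ℓ)) :
    TendstoInDistribution (fun ν ω ℓ => scaledMean μ ε (n ν) ω ⬝ᵥ
      weightMatrix (blockMat C ℓ) (Sest ν ω) (M (r ℓ) (blockMat C ℓ) (Sest ν ω)) *ᵥ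
        scaledMean μ ε (n ν) ω - q ν ω ℓ) atTop
      (fun g ℓ => g ⬝ᵥ limitForm M C κ Sig ℓ *ᵥ g - c ℓ) (fun _ => P)
      (stdNormal (Fin a × Fin d)) := by
  set A : ℕ → Ω → Fin L → Fin a × Fin d → Fin a × Fin d → ℝ := fun ν ω ℓ =>
    weightMatrix (blockMat C ℓ) (Sest ν ω) (M (r ℓ) (blockMat C ℓ) (Sest ν ω)) with hA
  have hA_conv : ConvInProb P A fun ℓ => weightMatrix (blockMat C ℓ) (limitCov κ Sig)
      (M (r ℓ) (blockMat C ℓ) (limitCov κ Sig)) := ConvInProb.pi fun ℓ =>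
    (tendstoInProb_iff_convInProb.1 hSest).comp₂
      (tendstoInProb_iff_convInProb.1 (hM_est ℓ hSest))
      (continuousAt_weightMatrix (C := blockMat C ℓ) (ht ℓ))
  have hA_meas : ∀ ν, Measurable (A ν) := fun ν => measurable_pi_lambda _ fun ℓ =>
    measurable_pi_lambda _ fun i => measurable_pi_lambda _ fun j =>
      measurable_weightMatrix_apply _ (hSest_meas ν)
        (fun s t => (hM ℓ s t).comp (measurable_pi_lambda _ fun p => measurable_pi_lambda _
          fun p' => hSest_meas ν p p')) i j
  have hq_conv : ConvInProb P q c := ConvInProb.pi hqc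
  have hg : Continuous fun x : EuclideanSpace ℝ (Fin a × Fin d) ×
      ((Fin L → Fin a × Fin d → Fin a × Fin d → ℝ) × (Fin L → ℝ)) =>
      fun ℓ => x.1.ofLp ⬝ᵥ (Matrix.of (x.2.1 ℓ)) *ᵥ x.1.ofLp - x.2.2 ℓ := by
    refine continuous_pi fun ℓ => ?_
    simp only [dotProduct, mulVec, of_apply]
    fun_prop
  -- Slutsky's lemma: only the means have a random limit. Matrices and critical values tend to
  -- constants, so their dependence on the data is immaterial.
  have h := (tendstoInDistribution_scaledMean hε μ hn
    (covRoot_mul_transpose_eq_limitCov hε hn.pos)).continuous_comp_prodMk_of_tendstoInMeasure_const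
    hg (convInProb_iff_tendstoInMeasure.1 (hA_conv.prodMk hq_conv))
    fun ν => ((hA_meas ν).prodMk (measurable_pi_lambda _ (hq ν))).aemeasurable
  have hlim : (fun (g : Fin a × Fin d → ℝ) (ℓ : Fin L) => g ⬝ᵥ limitForm M C κ Sig ℓ *ᵥ g - c ℓ) =
      fun g ℓ => (covRoot (fun i => (κ i)⁻¹) Sig *ᵥ g) ⬝ᵥ weightMatrix (blockMat C ℓ)
        (limitCov κ Sig) (M (r ℓ) (blockMat C ℓ) (limitCov κ Sig)) *ᵥ
        (covRoot (fun i => (κ i)⁻¹) Sig *ᵥ g) - c ℓ := by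
    ext g ℓ
    rw [limitForm, mulVec_form]
  rw [hlim]
  exact h

end Limit

end QFMCT

end

theorem mainTheorem5
    {Ω : Type*} [MeasurableSpace Ω] (P : Measure Ω) [IsProbabilityMeasure P]
    -- groups, dimension, model
    (a d : ℕ) (ha : 2 ≤ a)
    (μ : Fin a → EuclideanSpace ℝ (Fin d))
    (ε : Fin a → ℕ → Ω → EuclideanSpace ℝ (Fin d))
    (Sig : Fin a → Matrix (Fin d) (Fin d) ℝ)
    (hε : IsErrorModel P ε Sig)
    -- group sizes along a sequence of designs with total sample size tending to infinity
    (n : ℕ → Fin a → ℕ) (hN : Tendsto (fun ν => totalSize (n ν)) atTop atTop)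
    (κ : Fin a → ℝ) (hκ : ∀ i, κ i ∈ Set.Ioc (0 : ℝ) 1)
    (hn : ∀ i, Tendsto (fun ν => (n ν i : ℝ) / (totalSize (n ν) : ℝ)) atTop (𝓝 (κ i)))
    -- partitioned global hypothesis `C μ = β`
    (L : ℕ) (hL : 1 ≤ L) (r : Fin L → ℕ)
    (C : Matrix (Σ ℓ, Fin (r ℓ)) (Fin a × Fin d) ℝ) (β : (Σ ℓ, Fin (r ℓ)) → ℝ)
    -- consistent covariance estimator
    (Sest : ℕ → Ω → Matrix (Fin a × Fin d) (Fin a × Fin d) ℝ)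
    (hSest_meas : ∀ ν p q, Measurable fun ω => Sest ν ω p q)
    (hSest : TendstoInProb P Sest (limitCov κ Sig))
    -- parametric bootstrap samples
    (Xstar : (ν : ℕ) → ℕ → Ω → Sample d (n ν))
    (hXstar : ∀ ν, IsParametricBootstrap P (observations μ ε (n ν)) (Xstar ν))
    -- the function defining the quadratic forms
    (M : WeightFunction a d)
    (hM_meas : ∀ ℓ s t, Measurable fun S : Fin a × Fin d → Fin a × Fin d → ℝ =>
      M (r ℓ) (blockMat C ℓ) (Matrix.of S) s t)
    (hM_psd : ∀ ℓ (S : Matrix (Fin a × Fin d) (Fin a × Fin d) ℝ), S.PosSemidef →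
      (M (r ℓ) (blockMat C ℓ) S).PosSemidef)
    (hM_est : ∀ ℓ, PlugInConsistent P (M (r ℓ) (blockMat C ℓ)) Sest (limitCov κ Sig))
    (hM_boot : ∀ ℓ, PlugInConsistent P (M (r ℓ) (blockMat C ℓ))
      (fun ν ω => pooledCov (Xstar ν 0 ω)) (limitCov κ Sig))
    -- non-degeneracy of every quadratic form in the limit
    (hA3 : ∀ ℓ, ∃ lam : ℝ, lam ≠ 0 ∧ Module.End.HasEigenvalue
      (Matrix.toLin' ((blockMat C ℓ)ᵀ * M (r ℓ) (blockMat C ℓ) (limitCov κ Sig) *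
        blockMat C ℓ * limitCov κ Sig)) lam)
    -- level and numbers of bootstrap replicates
    (α : ℝ) (hα : α ∈ Set.Ioo (0 : ℝ) 1)
    (B : ℕ → ℕ) (hB : Tendsto B atTop atTop) :
    -- asymptotically correct level for the global hypothesis
    (C *ᵥ stack μ = β →
      Tendsto (fun ν => ∫ ω, globalTest
          (testStat M C β (Sest ν ω) (observations μ ε (n ν) ω))
          (criticalValue (fun b : Fin (B ν) => bootStat M C (Xstar ν b ω)) α) ∂P)
        atTop (𝓝 α)) ∧
    -- asymptotic strong control of the family-wise error rate
    (∀ T : Finset (Fin L),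
      (∀ ℓ ∈ T, blockMat C ℓ *ᵥ stack μ = blockVec β ℓ) →
      ∃ c ≤ α, Tendsto (fun ν => ∫ ω, familyRejection T
          (testStat M C β (Sest ν ω) (observations μ ε (n ν) ω))
          (criticalValue (fun b : Fin (B ν) => bootStat M C (Xstar ν b ω)) α) ∂P)
        atTop (𝓝 c)) := by
  have hdes : IsProportionalDesign n κ := ⟨hN, fun i => (hκ i).1, hn⟩
  have hW : ∀ ℓ, (M (r ℓ) (blockMat C ℓ) (limitCov κ Sig)).PosSemidef := fun ℓ =>
    hM_psd ℓ _ (posSemidef_limitCov hε hdes.pos)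
  have hroot := covRoot_mul_transpose_eq_limitCov hε hdes.pos
  have hform : ∀ ℓ, (covRoot (fun i => (κ i)⁻¹) Sig)ᵀ * ((blockMat C ℓ)ᵀ *
      M (r ℓ) (blockMat C ℓ) (limitCov κ Sig) * blockMat C ℓ) *
      covRoot (fun i => (κ i)⁻¹) Sig ≠ 0 := fun ℓ => by
    obtain ⟨lam, hlam, h⟩ := hA3 ℓ
    exact form_ne_zero_of_hasEigenvalue (hW ℓ) hroot hlam h
  have ht : ∀ ℓ, 0 < formTrace M (blockMat C ℓ) (limitCov κ Sig) := fun ℓ =>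
    trace_sq_pos (hW ℓ) hroot (hform ℓ)
  have hY : IsRegularLimit (stdNormal (Fin a × Fin d))
      fun ℓ g => g ⬝ᵥ limitForm M C κ Sig ℓ *ᵥ g := by
    refine isRegularLimit_form (fun ℓ => ?_) fun ℓ => weightMatrix_ne_zero (hW ℓ) hroot (hform ℓ)
    have h := (posSemidef_weightMatrix (C := blockMat C ℓ) (S := limitCov κ Sig)
      (hW ℓ)).conjTranspose_mul_mul_same (covRoot (fun i => (κ i)⁻¹) Sig)
    rwa [conjTranspose_eq_transpose_of_trivial] at h
  obtain ⟨c, γ, hγ, hc0, hc, hcα⟩ := hY.exists_critical hL hα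
  have hcrit : ∀ ℓ, ConvInProb P (fun ν ω =>
      criticalValue (fun b : Fin (B ν) => bootStat M C (Xstar ν b ω)) α ℓ) (c ℓ) :=
    hY.convInProb_criticalValue hL hγ hα.1.le hc0 hc hcα hB
      (q := fun ν b ω => bootStat M C (Xstar ν b ω))
      (convInProb_bootstrap_freq hε hdes hXstar hM_meas hM_boot ht hY hB)
  have hcrit_meas : ∀ ν ℓ, Measurable fun ω =>
      criticalValue (fun b : Fin (B ν) => bootStat M C (Xstar ν b ω)) α ℓ := fun ν ℓ =>
    measurable_criticalValue (q := fun ω (b : Fin (B ν)) => bootStat M C (Xstar ν b ω))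
      (fun b ℓ => (measurable_bootStat (hM_meas ℓ)).comp ((hXstar ν).measurable b)) hα.1.le ℓ
  have htest_meas : ∀ ν ℓ, Measurable fun ω =>
      testStat M C β (Sest ν ω) (observations μ ε (n ν) ω) ℓ := fun ν ℓ =>
    measurable_testStat (hM_meas ℓ) (hSest_meas ν) (measurable_observations hε μ (n ν))
  have hlim := tendstoInDistribution_form_sub (μ := μ) hε hdes hM_meas hSest_meas hSest hM_est ht
    hcrit_meas hcrit
  -- Since the limits `c ℓ` are positive, all critical values are positive off an event of vanishing
  -- probability, and there the ratio test is the comparison of the statistic with its critical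
  -- value.
  have hD : Tendsto (fun ν => P {ω | ∃ ℓ,
      criticalValue (fun b : Fin (B ν) => bootStat M C (Xstar ν b ω)) α ℓ ≤ 0}) atTop (𝓝 0) := by
    refine tendsto_measure_zero_of_subset (tendsto_measure_zero_iUnion fun ℓ =>
      hcrit ℓ (Set.Ioi 0) (Ioi_mem_nhds (hc0 ℓ))) (Eventually.of_forall fun ν ω hω => ?_)
    obtain ⟨ℓ, hℓ⟩ := hω
    exact Set.mem_iUnion.2 ⟨ℓ, not_lt.2 hℓ⟩
  have key : ∀ T : Finset (Fin L), (∀ ℓ ∈ T, blockMat C ℓ *ᵥ stack μ = blockVec β ℓ) →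
      Tendsto (fun ν => ∫ ω, familyRejection T
        (testStat M C β (Sest ν ω) (observations μ ε (n ν) ω))
        (criticalValue (fun b : Fin (B ν) => bootStat M C (Xstar ν b ω)) α) ∂P) atTop
      (𝓝 ((stdNormal (Fin a × Fin d)).real
        {g | ∃ ℓ ∈ T, c ℓ < g ⬝ᵥ limitForm M C κ Sig ℓ *ᵥ g})) := fun T hT => by
    have hint := fun ν => integral_familyRejection (P := P) T (htest_meas ν) (hcrit_meas ν)
    simp only [hint]
    refine tendsto_real_of_symmDiff (hY.tendsto_real_exists_pos hlim T) hD (fun ν ω hω => ?_)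
      fun ν ω hω => ?_
    · obtain ⟨ℓ, hℓ, h⟩ := hω
      by_cases hpos : ∃ ℓ, criticalValue (fun b : Fin (B ν) => bootStat M C (Xstar ν b ω)) α ℓ ≤ 0
      · exact Or.inr hpos
      · push Not at hpos
        refine Or.inl ⟨ℓ, hℓ, (one_lt_ratio_iff (hpos ℓ)).2 ?_⟩
        rw [testStat_eq_of_mulVec_stack (hT ℓ hℓ)]
        exact sub_pos.1 h
    · obtain ⟨ℓ, hℓ, h⟩ := hω
      by_cases hpos : ∃ ℓ, criticalValue (fun b : Fin (B ν) => bootStat M C (Xstar ν b ω)) α ℓ ≤ 0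
      · exact Or.inr hpos
      · push Not at hpos
        rw [one_lt_ratio_iff (hpos ℓ), testStat_eq_of_mulVec_stack (hT ℓ hℓ)] at h
        exact Or.inl ⟨ℓ, hℓ, sub_pos.2 h⟩
  refine ⟨fun hH => ?_, fun T hT => ⟨_, ?_, key T hT⟩⟩
  · simp only [globalTest_eq]
    have h := key Finset.univ fun ℓ _ => funext fun s => congrFun hH ⟨ℓ, s⟩
    rwa [hcα] at h
  -- Exceedance within `T` implies exceedance somewhere, and the latter has limit probability
  -- exactly `α`.
  · rw [← hcα]
    exact measureReal_mono fun g ⟨ℓ, _, h⟩ => ⟨ℓ, Finset.mem_univ ℓ, h⟩
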